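/- Let $p>1$, $p'=p/(p-1)$, $S=\mathbb R^d$ with $d\ge1$, and $\mathbb X=S\times S$ with its Euclidean norm and points $x=(x_1,x_2)$. Let $\mathcal P_p(\mathbb X)$ be the set of Borel probability measures on $\mathbb X$ with finite $p$-th moment. Let $\mathbb W_p$ be the $p$-Wasserstein distance, and $\mathbb W_p^{\rm ad}$ the adapted one, i.e. the infimum of $\mathbb E^\pi[|X-X'|^p]^{1/p}$ over bi-causal couplings $\pi$ only. Here a law of $(X,X')$ on $\mathbb X\times\mathbb X$ is causal if $(X_1,X_2)$ and $X_1'$ are conditionally independent given $X_1$, and bi-causal if it and its image under swapping $X$ and $X'$ are causal. Fix $\mathbf d\in\{\mathbb W_p,\mathbb W_p^{\rm ad}\}$ and $\mu\in\mathcal P_p(\mathbb X)$ with first marginal $\mu_1$, and write $\mathbb E=\mathbb E^\mu$, $\mathbb E_1[\cdot]=\mathbb E^\mu[\,\cdot\,|X_1]$. Set $\partial_x^{\mathbf d}u=\partial_xu$ if $\mathbf d=\mathbb W_p$ and $\partial^{\mathbf d}_xu=\partial_x^{\rm ad}u=(\mathbb E_1[\partial_{x_1}u],\partial_{x_2}u)$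 if $\mathbf d=\mathbb W_p^{\rm ad}$. For a matrix $A$ with Euclidean norm $|A|$ let $\mathbf N(A)=A/|A|^{2-p'}$ (with $\mathbf N(0)=0$), and for a matrix with two column blocks $A=(A_1,A_2)$ let $\mathbf N_{\rm ad}(A)=(\mathbf N(A_1),\mathbf N(A_2))$. Let $\varphi:\mathcal P_p(\mathbb X)\to\mathbb R^k$ satisfy $\varphi(\mu)=0$ and have a linear functional derivative: a map $\delta_m\varphi:\mathcal P_p(\mathbb X)\times\mathbb X\to\mathbb R^k$ that is jointly continuous, with growth $O(1+|x|^p)$ locally uniformly in $m$, such that $\frac1t\big(\varphi(m+t(m'-m))-\varphi(m)\big)\to\int\delta_m\varphi(m,\cdot)\,d(m'-m)$ as $t\searrow0$ for all $m,m'\in\mathcal P_p(\mathbb X)$. Assume also that $\delta_m\varphi$ is $C^1$ in $x$ and that $\partial_x\delta_m\varphi$ is jointly continuous with growth $O(1+|x|^{p-1})$ locally uniformly in $m$. (The topology on $\mathcal P_p(\mathbb X)$ is that of $\mathbb W_p$.) Below, $\delta_m\varphi$ without a measure argument is $\delta_m\varphi(\mu,\cdot)$. Let $\psi:\mathbb X\to\mathbb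 R^l$, and let $\mathcal E_\psi^\perp$ be the set of $\nu\in\mathcal P_p(\mathbb X)$ with $\int h(x_1)\cdot\psi(x)\,\nu(dx)=0$ for all $C^1$ functions $h:S\to\mathbb R^l$ that are bounded with bounded derivative. If $\mathbf d=\mathbb W_p$, assume that $\psi=0$ and $\mathbb E\big[(\partial_x\delta_m\varphi)(\partial_x\delta_m\varphi)^\top/|\partial_x\delta_m\varphi|^{2-p'}\big]\ge c\,\mathrm{Id}$ for some $c>0$. If $\mathbf d=\mathbb W_p^{\rm ad}$, put $\Lambda=\partial_x^{\rm ad}\delta_m\varphi$ and assume that (i) $\mathbb E_1[|X_2|]\in\mathbb L^\infty_{\rm loc}(\mu_1)$; (ii) $\psi$ is $C^2$ with bounded first and second derivatives, and $\mathbb E_1[\psi]=0$; (iii) for some $c>0$, $M:=\mathbb E_1[(\partial_{x_2}\psi)(\partial_{x_2}\psi)^\top]\ge c\,\mathrm{Id}$ almost surely; (iv) for some $c>0$ and all $\lambda\in\mathbb R^k$, $h\in\mathbb L^{p'}(\mu_1;\mathbb R^l)$, $\|\Lambda^\top\lambda+(\partial_x^{\rm ad}\psi)^\top h\|_{\mathbb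 L^{p'}(\mu)}\ge c(|\lambda|+\|h\|_{\mathbb L^{p'}(\mu)})$; (v) the $k\times k$ matrix $\mathbb E\big[\Lambda\mathbf N_{\rm ad}(\Lambda)^\top-(\partial_{x_2}\delta_m\varphi)(\partial_{x_2}\psi)^\top M^{-1}\,\mathbb E_1[\partial_x\psi\,\mathbf N_{\rm ad}(\Lambda)^\top]\big]$ is invertible. Then there is a constant $C>0$ such that $$\limsup_{r\searrow0}\frac1r\,\mathbf d\big(\mu^{r\Theta},\varphi^{-1}(\{0\})\cap\mathcal E_\psi^\perp\big)\le C\,\Big(\big|\mathbb E[(\partial_x^{\mathbf d}\delta_m\varphi)\Theta]\big|+\big\|\mathbb E_1[(\partial_x^{\mathbf d}\psi)\Theta]\big\|_{\mathbb L^p(\mu_1)}\Big)$$ for every compactly supported $C^1$ map $\Theta:\mathbb X\to\mathbb X$ if $\mathbf d=\mathbb W_p$, and for every $\Theta(x)=(\Theta_1(x_1),\Theta_2(x_1,x_2))$ with $\Theta_1:S\to S$ and $\Theta_2:\mathbb X\to S$ of class $C^1$ and compactly supported if $\mathbf d=\mathbb W^{\rm ad}_p$. Here $\mu^{T}=\mu\circ(X+T)^{-1}$,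 and $\mathbf d(m,U)=\inf_{\nu\in U}\mathbf d(m,\nu)$, which is $\infty$ if $U=\emptyset$. -/

import Mathlib

open MeasureTheory Filter Topology
open scoped NNReal ENNReal

noncomputable section

namespace ConstrainedDRO

/-- The state space `S = ℝ^d` with its Euclidean norm. -/
abbrev S (d : ℕ) : Type := EuclideanSpace ℝ (Fin d)

/-- The path space `𝕏 = S × S` with its Euclidean norm `|x|² = |x₁|² + |x₂|²`. -/
abbrev X (d : ℕ) : Type := WithLp 2 (S d × S d)

/-- The choice of a distance: the `p`-Wasserstein distance or its adapted version. -/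
inductive Kind : Type
  | classical : Kind
  | adapted : Kind

/-- The conjugate exponent `p' = p / (p - 1)`. -/
def conj (p : ℝ) : ℝ := p / (p - 1)

/-- Probability measures on `𝕏` with finite `p`-th moment. -/
def Pp (d : ℕ) (p : ℝ) : Type :=
  {m : Measure (X d) // IsProbabilityMeasure m ∧ ∫⁻ x, ‖x‖ₑ ^ p ∂m < ∞}

/-- The convex combination `m + t (m' - m)`. -/
def Pp.mix {d : ℕ} {p : ℝ} (m m' : Pp d p) (t : unitInterval) : Pp d p :=
  ⟨ENNReal.ofReal (1 - t) • m.1 + ENNReal.ofReal t • m'.1, by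
    obtain ⟨m, hm, hm2⟩ := m
    obtain ⟨m', hm', hm2'⟩ := m'
    refine ⟨⟨?_⟩, ?_⟩
    · simp only [Measure.coe_add, Measure.coe_smul, Pi.add_apply, Pi.smul_apply,
        measure_univ, smul_eq_mul, mul_one]
      rw [← ENNReal.ofReal_add (by linarith [t.2.2]) t.2.1]
      simp
    · rw [lintegral_add_measure, lintegral_smul_measure, lintegral_smul_measure]
      exact ENNReal.add_lt_top.2 ⟨ENNReal.mul_lt_top ENNReal.ofReal_lt_top hm2,
        ENNReal.mul_lt_top ENNReal.ofReal_lt_top hm2'⟩⟩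

/-! ### Transport distances -/

/-- `π` is a coupling of `μ` and `ν`. -/
def IsCoupling {d : ℕ} (π : Measure (X d × X d)) (μ ν : Measure (X d)) : Prop :=
  π.map Prod.fst = μ ∧ π.map Prod.snd = ν

/-- Causality of a measure on `𝕏 × 𝕏`: given `X₁`, the pair `(X₁, X₂)` and `X'₁` are
conditionally independent. -/
def IsCausal {d : ℕ} (π : Measure (X d × X d)) : Prop :=
  ∀ (f : X d → ℝ) (g : S d → ℝ), Measurable f → Measurable g →
    (∃ K, ∀ x, |f x| ≤ K) → (∃ K, ∀ y, |g y| ≤ K) →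
    π[fun z => f z.1 * g z.2.fst | MeasurableSpace.comap (fun z => z.1.fst) inferInstance]
      =ᵐ[π]
    π[fun z => f z.1 | MeasurableSpace.comap (fun z => z.1.fst) inferInstance] *
    π[fun z => g z.2.fst | MeasurableSpace.comap (fun z => z.1.fst) inferInstance]

/-- Couplings that are admissible for the chosen distance: all couplings, respectively the
bi-causal ones. -/
def IsAdmissible {d : ℕ} (kd : Kind) (π : Measure (X d × X d)) (μ ν : Measure (X d)) : Prop :=
  match kd with
  | .classical => IsCoupling π μ ν
  | .adapted => IsCoupling π μ ν ∧ IsCausal π ∧ IsCausal (π.map Prod.swap)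

/-- The distance `𝕎_p` (for `classical`) or `𝕎_p^ad` (for `adapted`), with values in `[0, ∞]`. -/
def transportDist {d : ℕ} (kd : Kind) (p : ℝ) (μ ν : Measure (X d)) : ℝ≥0∞ :=
  ⨅ (π : Measure (X d × X d)) (_ : IsAdmissible kd π μ ν),
    (∫⁻ z, ‖z.1 - z.2‖ₑ ^ p ∂π) ^ (1 / p)

/-- The distance from `μ` to a set of measures (`∞` if the set is empty). -/
def distToSet {d : ℕ} {p : ℝ} (kd : Kind) (μ : Measure (X d)) (U : Set (Pp d p)) : ℝ≥0∞ :=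
  ⨅ ν ∈ U, transportDist kd p μ ν.1

/-! ### Functionals on measures -/

/-- Joint continuity on `𝒫_p(𝕏) × 𝕏`, where `𝒫_p(𝕏)` carries the distance `𝕎_p`. -/
def JointlyContinuous {d : ℕ} {p : ℝ} {F : Type*} [NormedAddCommGroup F]
    (f : Pp d p → X d → F) : Prop :=
  ∀ (m : Pp d p) (x : X d), ∀ ε > (0 : ℝ), ∃ δ > (0 : ℝ), ∀ (m' : Pp d p) (x' : X d),
    transportDist .classical p m.1 m'.1 < ENNReal.ofReal δ → ‖x' - x‖ < δ →
      ‖f m' x' - f m x‖ < ε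

/-- Growth of order `q` in `x`, locally uniformly in `m` for the distance `𝕎_p`. -/
def LocallyGrowth {d : ℕ} {p : ℝ} {F : Type*} [NormedAddCommGroup F] (q : ℝ)
    (f : Pp d p → X d → F) : Prop :=
  ∀ m : Pp d p, ∃ δ > (0 : ℝ), ∃ K : ℝ, ∀ (m' : Pp d p) (x : X d),
    transportDist .classical p m.1 m'.1 < ENNReal.ofReal δ → ‖f m' x‖ ≤ K * (1 + ‖x‖ ^ q)

/-- `D` is a linear functional derivative `δ_m φ` of `φ : 𝒫_p(𝕏) → ℝ^k`. -/
structure IsLinearFunctionalDeriv {d k : ℕ} {p : ℝ} (φ : Pp d p → EuclideanSpace ℝ (Fin k))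
    (D : Pp d p → X d → EuclideanSpace ℝ (Fin k)) : Prop where
  continuous : JointlyContinuous D
  growth : LocallyGrowth p D
  deriv : ∀ m m' : Pp d p,
    Tendsto (fun t : unitInterval => (t : ℝ)⁻¹ • (φ (m.mix m' t) - φ m)) (𝓝[>] 0)
      (𝓝 (∫ x, D m x ∂m'.1 - ∫ x, D m x ∂m.1))

/-- The smoothness assumption on `φ`, with linear functional derivative `D`: `D` is `C¹` in `x`,
and `∂_x D` is jointly continuous with growth of order `p - 1` in `x`, locally in `m`. -/
structure RegularFunctional {d k : ℕ} {p : ℝ} (φ : Pp d p → EuclideanSpace ℝ (Fin k))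
    (D : Pp d p → X d → EuclideanSpace ℝ (Fin k)) : Prop where
  isDeriv : IsLinearFunctionalDeriv φ D
  contDiff : ∀ m, ContDiff ℝ 1 (D m)
  grad_continuous : JointlyContinuous fun m x => fderiv ℝ (D m) x
  grad_growth : LocallyGrowth (p - 1) fun m x => fderiv ℝ (D m) x

/-! ### Gradients and conditional expectations

A matrix with `n` rows in a Euclidean space `E` is written as a family `Fin n → E` of its rows. -/

/-- `𝔼^μ_1[f] = 𝔼^μ[f(X) | X₁]`, as a function on `𝕏` that depends on `x₁` only. -/
def condE1 {d : ℕ} {F : Type*} [NormedAddCommGroup F] [NormedSpace ℝ F] [CompleteSpace F]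
    (μ : Measure (X d)) (f : X d → F) : X d → F :=
  μ[f | MeasurableSpace.comap (fun x : X d => x.fst) inferInstance]

/-- The Jacobian `∂_x u` of `u : 𝕏 → ℝ^n`; its rows are the gradients of the components. -/
def jac {d n : ℕ} (u : X d → EuclideanSpace ℝ (Fin n)) (x : X d) : Fin n → X d :=
  fun i => gradient (fun y => u y i) x

/-- The gradient `∂_x^kd`: the Jacobian, respectively `(𝔼^μ_1[∂_{x₁} u], ∂_{x₂} u)`. -/
def grad {d n : ℕ} (kd : Kind) (μ : Measure (X d)) (u : X d → EuclideanSpace ℝ (Fin n)) :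
    X d → Fin n → X d :=
  match kd with
  | .classical => jac u
  | .adapted => fun x i =>
      WithLp.toLp 2 (condE1 μ (fun y => (jac u y i).fst) x, (jac u x i).snd)

/-- The product `A Bᵀ` of two matrices given by their rows. -/
def mulT {n m : ℕ} {E : Type*} [NormedAddCommGroup E] [InnerProductSpace ℝ E]
    (A : Fin n → E) (B : Fin m → E) : Matrix (Fin n) (Fin m) ℝ :=
  Matrix.of fun i j => inner ℝ (A i) (B j)

/-- The matrix-vector product `A v`. -/
def mulV {n : ℕ} {E : Type*} [NormedAddCommGroup E] [InnerProductSpace ℝ E]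
    (A : Fin n → E) (v : E) : EuclideanSpace ℝ (Fin n) :=
  WithLp.toLp 2 fun i => inner ℝ (A i) v

/-- The product `Aᵀ c = ∑ i, c_i A_i`. -/
def tmulV {n : ℕ} {E : Type*} [NormedAddCommGroup E] [InnerProductSpace ℝ E]
    (A : Fin n → E) (c : EuclideanSpace ℝ (Fin n)) : E :=
  ∑ i, c i • A i

/-- The Euclidean norm of a matrix. -/
def frob {n : ℕ} {E : Type*} [NormedAddCommGroup E] (A : Fin n → E) : ℝ :=
  Real.sqrt (∑ i, ‖A i‖ ^ 2)

/-- `𝐍(A) = A / |A|^(2 - p')`, which is `0` at `A = 0`. -/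
def bigN {n : ℕ} {E : Type*} [NormedAddCommGroup E] [InnerProductSpace ℝ E] (p : ℝ)
    (A : Fin n → E) : Fin n → E :=
  fun i => (frob A ^ (2 - conj p))⁻¹ • A i

/-- `𝐍_ad(A)`: the map `𝐍` applied to the two blocks of `A = (A₁, A₂)` separately. -/
def bigNad {d n : ℕ} (p : ℝ) (A : Fin n → X d) : Fin n → X d :=
  fun i => WithLp.toLp 2
    (bigN p (fun j => (A j).fst) i, bigN p (fun j => (A j).snd) i)

/-- The block `∂_{x₂} u` of the Jacobian. -/
def jac2 {d n : ℕ} (u : X d → EuclideanSpace ℝ (Fin n)) (x : X d) : Fin n → S d :=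
  fun i => (jac u x i).snd

/-! ### Constraints -/

/-- `C¹_b(S, ℝ^l)`. -/
def IsC1b {d l : ℕ} (h : S d → EuclideanSpace ℝ (Fin l)) : Prop :=
  ContDiff ℝ 1 h ∧ ∃ K, ∀ y, ‖h y‖ ≤ K ∧ ‖fderiv ℝ h y‖ ≤ K

/-- `𝓔_ψ`, the set of the functions `x ↦ h(x₁) · ψ(x)` with `h ∈ C¹_b`. -/
def calE {d l : ℕ} (ψ : X d → EuclideanSpace ℝ (Fin l)) : Set (X d → ℝ) :=
  {f | ∃ h : S d → EuclideanSpace ℝ (Fin l), IsC1b h ∧ f = fun x => inner ℝ (h x.fst) (ψ x)}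

/-- `𝓔^⊥` inside `𝒫_p(𝕏)`. -/
def perp {d : ℕ} (p : ℝ) (E : Set (X d → ℝ)) : Set (Pp d p) :=
  {m | ∀ f ∈ E, ∫ x, f x ∂m.1 = 0}

/-- The assumption for `𝕎_p`. Here `Dμ = δ_m φ(μ, ·)`. -/
structure AssumptionW {d k l : ℕ} (p : ℝ) (μ : Measure (X d))
    (Dμ : X d → EuclideanSpace ℝ (Fin k)) (ψ : X d → EuclideanSpace ℝ (Fin l)) : Prop where
  psi_zero : ψ = 0
  nondegenerate : ∃ c > (0 : ℝ),
    (Matrix.of (fun i j => ∫ x, mulT (jac Dμ x) (jac Dμ x) i j / frob (jac Dμ x) ^ (2 - conj p) ∂μ)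
      - c • (1 : Matrix (Fin k) (Fin k) ℝ)).PosSemidef

/-- The conditional Gram matrix `𝔼^μ_1[(∂_{x₂} ψ)(∂_{x₂} ψ)ᵀ]`. -/
def condGram {d l : ℕ} (μ : Measure (X d)) (ψ : X d → EuclideanSpace ℝ (Fin l)) (x : X d) :
    Matrix (Fin l) (Fin l) ℝ :=
  Matrix.of fun i j => condE1 μ (fun y => mulT (jac2 ψ y) (jac2 ψ y) i j) x

/-- The matrix `𝔼^μ_1[∂_x ψ 𝐍_ad(Λ)ᵀ]` with `Λ = ∂_x^ad δ_m φ`. -/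
def condCross {d k l : ℕ} (p : ℝ) (μ : Measure (X d)) (Dμ : X d → EuclideanSpace ℝ (Fin k))
    (ψ : X d → EuclideanSpace ℝ (Fin l)) (x : X d) : Matrix (Fin l) (Fin k) ℝ :=
  Matrix.of fun i j =>
    condE1 μ (fun y => mulT (jac ψ y) (bigNad p (grad .adapted μ Dμ y)) i j) x

/-- The matrix `H = 𝔼[Λ 𝐍_ad(Λ)ᵀ
  - (∂_{x₂} δ_m φ)(∂_{x₂} ψ)ᵀ 𝔼_1[(∂_{x₂} ψ)(∂_{x₂} ψ)ᵀ]⁻¹ 𝔼_1[∂_x ψ 𝐍_ad(Λ)ᵀ]]`. -/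
def matH {d k l : ℕ} (p : ℝ) (μ : Measure (X d)) (Dμ : X d → EuclideanSpace ℝ (Fin k))
    (ψ : X d → EuclideanSpace ℝ (Fin l)) : Matrix (Fin k) (Fin k) ℝ :=
  Matrix.of fun i j => ∫ x,
    (mulT (grad .adapted μ Dμ x) (bigNad p (grad .adapted μ Dμ x))
      - mulT (jac2 Dμ x) (jac2 ψ x) * (condGram μ ψ x)⁻¹ * condCross p μ Dμ ψ x) i j ∂μ

/-- The assumption for `𝕎_p^ad`. Here `Dμ = δ_m φ(μ, ·)`. -/
structure AssumptionWad {d k l : ℕ} (p : ℝ) (μ : Measure (X d))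
    (Dμ : X d → EuclideanSpace ℝ (Fin k)) (ψ : X d → EuclideanSpace ℝ (Fin l)) : Prop where
  locally_bounded : ∀ K : Set (S d), IsCompact K →
    MemLp (Set.indicator {x : X d | x.fst ∈ K} (condE1 μ fun y => ‖y.snd‖)) ∞ μ
  psi_contDiff : ContDiff ℝ 2 ψ
  psi_bounded : ∃ K, ∀ x, ‖fderiv ℝ ψ x‖ ≤ K ∧ ‖fderiv ℝ (fderiv ℝ ψ) x‖ ≤ K
  psi_cond : condE1 μ ψ =ᵐ[μ] 0
  gram : ∃ c > (0 : ℝ), ∀ᵐ x ∂μ,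
    (condGram μ ψ x - c • (1 : Matrix (Fin l) (Fin l) ℝ)).PosSemidef
  nonredundant : ∃ c > (0 : ℝ), ∀ (lam : EuclideanSpace ℝ (Fin k))
    (h : S d → EuclideanSpace ℝ (Fin l)),
    MemLp h (ENNReal.ofReal (conj p)) (μ.map fun x => x.fst) →
    ENNReal.ofReal c * (‖lam‖ₑ + eLpNorm (fun x => h x.fst) (ENNReal.ofReal (conj p)) μ) ≤
      eLpNorm (fun x => tmulV (grad .adapted μ Dμ x) lam + tmulV (grad .adapted μ ψ x) (h x.fst))
        (ENNReal.ofReal (conj p)) μ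
  invertible : IsUnit (matH p μ Dμ ψ)

/-- The assumption that belongs to the distance `kd`. -/
def AssumptionA {d k l : ℕ} (kd : Kind) (p : ℝ) (μ : Measure (X d))
    (Dμ : X d → EuclideanSpace ℝ (Fin k)) (ψ : X d → EuclideanSpace ℝ (Fin l)) : Prop :=
  match kd with
  | .classical => AssumptionW p μ Dμ ψ
  | .adapted => AssumptionWad p μ Dμ ψ

/-- Compactly supported `C¹` vector fields in `𝕃^p_kd`. In the adapted case
`Θ(x) = (Θ₁(x₁), Θ₂(x₁, x₂))`, and the support condition is on `Θ₁` as a function on `S` and on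
`Θ₂` as a function on `𝕏`. -/
def IsTestField {d : ℕ} (kd : Kind) (Θ : X d → X d) : Prop :=
  match kd with
  | .classical => ContDiff ℝ 1 Θ ∧ HasCompactSupport Θ
  | .adapted => ∃ (Θ₁ : S d → S d) (Θ₂ : X d → S d),
      ContDiff ℝ 1 Θ₁ ∧ HasCompactSupport Θ₁ ∧ ContDiff ℝ 1 Θ₂ ∧ HasCompactSupport Θ₂ ∧
      ∀ x, Θ x = WithLp.toLp 2 (Θ₁ x.fst, Θ₂ x)

/-- The pushforward `μ^T = μ ∘ (X + T)⁻¹`. -/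
def shift {d : ℕ} (μ : Measure (X d)) (T : X d → X d) : Measure (X d) :=
  μ.map fun x => x + T x

/-- First component `𝔼^μ[(∂_x^kd δ_m φ) Θ]` of the linearised constraint operator. -/
def opL1 {d k : ℕ} (kd : Kind) (μ : Measure (X d)) (Dμ : X d → EuclideanSpace ℝ (Fin k))
    (Θ : X d → X d) : EuclideanSpace ℝ (Fin k) :=
  ∫ x, mulV (grad kd μ Dμ x) (Θ x) ∂μ

/-- Second component `𝔼^μ_1[(∂_x^kd ψ) Θ]` of the linearised constraint operator. -/
def opL2 {d l : ℕ} (kd : Kind) (μ : Measure (X d)) (ψ : X d → EuclideanSpace ℝ (Fin l))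
    (Θ : X d → X d) : X d → EuclideanSpace ℝ (Fin l) :=
  condE1 μ fun x => mulV (grad kd μ ψ x) (Θ x)

/-- The norm of the linearised constraint operator at `Θ`. The second component depends on `x₁`
only, so its norm in `𝕃^p(μ₁)` is its norm in `𝕃^p(μ)`. -/
def opNorm {d k l : ℕ} (kd : Kind) (p : ℝ) (μ : Measure (X d))
    (Dμ : X d → EuclideanSpace ℝ (Fin k)) (ψ : X d → EuclideanSpace ℝ (Fin l))
    (Θ : X d → X d) : ℝ≥0∞ :=
  ‖opL1 kd μ Dμ Θ‖ₑ + eLpNorm (opL2 kd μ ψ Θ) (ENNReal.ofReal p) μ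

end ConstrainedDRO

end

open ConstrainedDRO

/-! The idea is to correct `Θ` by a bounded field `W` so that the law of `X + r(Θ + W)` satisfies
every constraint. Moving `x + rΘ(x)` to `x + r(Θ(x) + W(x))` costs at most `r‖W‖_p`. In the adapted
case this coupling is bi-causal for small `r`: the first components of `Θ` and `W` are Lipschitz
functions of `x₁`, so each of the two shifted first coordinates determines the other
(`transportDist_adapted_shift_le`).

To find `W`, let `T` be a linear right inverse of the linearised constraints, let `z₀` be minus
their value at `Θ`, and try `W = T z`. The constraints are strictly differentiable along bounded
displacements (`RegularFunctional.exists_strict_deriv`, `norm_kerE_diffQuot_sub_le`). Hence, divided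
by `r`, they form a map of `z` which for small `r` is a small Lipschitz perturbation of `z ↦ z -
z₀`, and it has a zero close to `z₀`. The limsup is therefore at most `‖T z₀‖_p`
(`RegularFunctional.limsup_distToSet_le`). Two norms of `z` are in play: the fixed point argument
runs in the supremum norm, while the final estimate needs `T` to be bounded in `L^p`.

In the classical case, `T` combines finitely many test fields on which the derivative of `φ` takes
the unit vectors as values; a vector `λ` orthogonal to all attainable values satisfies `(∂_x δ_m
φ)ᵀλ = 0`, so that `λ = 0` by nondegeneracy. In the adapted case, the vertical fields `(0,
(∂_{x₂}ψ)ᵀ M⁻¹ g)` solve the conditional constraint, and subtracting such a field projects any test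
field onto its kernel. That enough values of the derivative of `φ` remain attainable there follows
by duality: an orthogonal `λ` comes with a multiplier `-h(x₁)` for which the adapted gradient of the
Lagrangian vanishes, and the nonredundancy assumption (iv) gives `λ = 0`
(`eq_zero_of_integral_lagrangian_eq_zero`, `exists_adapted_correction`). -/

namespace ConstrainedDRO

/-! ### Upper bounds for transport distances by explicit couplings. -/

section Transport

variable {d : ℕ} {p : ℝ}

theorem measurable_fst : Measurable (fun x : X d => x.fst) := by fun_prop

theorem measurable_snd : Measurable (fun x : X d => x.snd) := by fun_prop

theorem comap_fst_le : MeasurableSpace.comap (fun x : X d => x.fst) inferInstance ≤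
    (inferInstance : MeasurableSpace (X d)) := measurable_fst.comap_le

theorem Pp.memLp_id (hp : 1 < p) (m : Pp d p) : MemLp (fun x => x) (ENNReal.ofReal p) m.1 := by
  refine ⟨measurable_id.aestronglyMeasurable, ?_⟩
  rw [eLpNorm_lt_top_iff_lintegral_rpow_enorm_lt_top (by simp; linarith) (by simp),
    ENNReal.toReal_ofReal (by linarith)]
  exact m.2.2

/-- The law of `X + T` under `m`, which is `m` itself if this law has no finite `p`-th moment. -/
noncomputable def push (m : Pp d p) (T : X d → X d) : Pp d p :=
  open Classical in
  if h : IsProbabilityMeasure (shift m.1 T) ∧ ∫⁻ x, ‖x‖ₑ ^ p ∂(shift m.1 T) < ∞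
  then ⟨shift m.1 T, h⟩ else m

theorem push_val (hp : 1 < p) (m : Pp d p) {T : X d → X d} (hT : Measurable T) {K : ℝ}
    (hK : ∀ x, ‖T x‖ ≤ K) : (push m T).1 = shift m.1 T := by
  have := m.2.1
  have hm : Measurable fun x => x + T x := by fun_prop
  have h : IsProbabilityMeasure (shift m.1 T) ∧ ∫⁻ x, ‖x‖ₑ ^ p ∂(shift m.1 T) < ∞ := by
    refine ⟨Measure.isProbabilityMeasure_map hm.aemeasurable, ?_⟩
    have h1 : MemLp (fun x => x + T x) (ENNReal.ofReal p) m.1 :=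
      (m.memLp_id hp).add (MemLp.of_bound hT.aestronglyMeasurable K (.of_forall hK))
    have h2 := h1.2
    rw [eLpNorm_lt_top_iff_lintegral_rpow_enorm_lt_top (by simp; linarith) (by simp),
      ENNReal.toReal_ofReal (by linarith)] at h2
    rwa [shift, lintegral_map (by fun_prop) hm]
  simp [push, h]

theorem transportDist_le_of_isAdmissible {kd : Kind} {π : Measure (X d × X d)}
    {μ ν : Measure (X d)} (h : IsAdmissible kd π μ ν) :
    transportDist kd p μ ν ≤ (∫⁻ z, ‖z.1 - z.2‖ₑ ^ p ∂π) ^ (1 / p) :=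
  iInf₂_le (f := fun (π : Measure (X d × X d)) (_ : IsAdmissible kd π μ ν) =>
    (∫⁻ z, ‖z.1 - z.2‖ₑ ^ p ∂π) ^ (1 / p)) π h

theorem transportDist_classical_map_le (μ : Measure (X d)) {f g : X d → X d} (hf : Measurable f)
    (hg : Measurable g) :
    transportDist .classical p (μ.map f) (μ.map g) ≤ (∫⁻ x, ‖f x - g x‖ₑ ^ p ∂μ) ^ (1 / p) := by
  have adm : IsAdmissible .classical (μ.map fun x => (f x, g x)) (μ.map f) (μ.map g) := by
    refine ⟨?_, ?_⟩ <;> rw [Measure.map_map (by fun_prop) (by fun_prop)] <;> rfl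
  refine (transportDist_le_of_isAdmissible adm).trans ?_
  rw [lintegral_map (by fun_prop) (by fun_prop)]

/-- Mixing the couplings `(x, f x)` and `(x, g x)` with the same weights couples `μ` to the mixture.
It keeps the whole segment between two perturbed laws in a small ball around `μ`, where the growth
and continuity assumptions are uniform. -/
theorem transportDist_classical_mix_le (hp : 1 < p) (μ m m' : Pp d p) {f g : X d → X d}
    (hf : Measurable f) (hg : Measurable g) (hm : m.1 = μ.1.map f) (hm' : m'.1 = μ.1.map g)
    {δ : ℝ} (hfδ : ∀ x, ‖x - f x‖ ≤ δ) (hgδ : ∀ x, ‖x - g x‖ ≤ δ)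
    (t : unitInterval) :
    transportDist .classical p μ.1 (m.mix m' t).1 ≤ ENNReal.ofReal δ := by
  have := μ.2.1
  have ht : ENNReal.ofReal (1 - t) + ENNReal.ofReal t = 1 := by
    rw [← ENNReal.ofReal_add (by linarith [t.2.2]) t.2.1]; simp
  have adm : IsAdmissible .classical (ENNReal.ofReal (1 - t) • μ.1.map (fun x => (x, f x)) +
      ENNReal.ofReal t • μ.1.map (fun x => (x, g x))) μ.1 (m.mix m' t).1 := by
    refine ⟨?_, ?_⟩
    · rw [Measure.map_add _ _ (by fun_prop), Measure.map_smul, Measure.map_smul,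
        Measure.map_map (by fun_prop) (by fun_prop), Measure.map_map (by fun_prop) (by fun_prop)]
      change ENNReal.ofReal (1 - t) • μ.1.map id + ENNReal.ofReal t • μ.1.map id = μ.1
      rw [← add_smul, ht, one_smul, Measure.map_id]
    · rw [Measure.map_add _ _ (by fun_prop), Measure.map_smul, Measure.map_smul,
        Measure.map_map (by fun_prop) (by fun_prop), Measure.map_map (by fun_prop) (by fun_prop)]
      simp only [Pp.mix, hm, hm']
      rfl
  refine (transportDist_le_of_isAdmissible adm).trans ?_
  · have key : ∀ F : X d → X d, (∀ x, ‖x - F x‖ ≤ δ) →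
        ∫⁻ x, ‖x - F x‖ₑ ^ p ∂μ.1 ≤ ENNReal.ofReal δ ^ p := by
      intro F hF
      calc _ ≤ ∫⁻ x, ENNReal.ofReal δ ^ p ∂μ.1 := by
            refine lintegral_mono fun x => ENNReal.rpow_le_rpow ?_ (by linarith)
            rw [← ofReal_norm]
            exact ENNReal.ofReal_le_ofReal (hF x)
        _ = _ := by simp
    rw [lintegral_add_measure, lintegral_smul_measure, lintegral_smul_measure,
      lintegral_map (by fun_prop) (by fun_prop), lintegral_map (by fun_prop) (by fun_prop)]
    calc _ ≤ (ENNReal.ofReal (1 - t) * ENNReal.ofReal δ ^ p +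
          ENNReal.ofReal t * ENNReal.ofReal δ ^ p) ^ (1 / p) := by
          refine ENNReal.rpow_le_rpow ?_ (by positivity)
          simp only [smul_eq_mul]
          gcongr
          · exact key f hfδ
          · exact key g hgδ
      _ = _ := by
          rw [← add_mul, ht, one_mul, ← ENNReal.rpow_mul, mul_one_div_cancel (by linarith),
            ENNReal.rpow_one]

theorem transportDist_classical_self (hp : 1 < p) (μ : Measure (X d)) :
    transportDist .classical p μ μ = 0 := by
  have h := transportDist_classical_map_le (p := p) μ measurable_id measurable_id
  simpa [show 0 < p by linarith] using h

/-- A coupling whose second path starts at a function of the start of the first path is causal. -/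
theorem isCausal_of_fst_eq {π : Measure (X d × X d)} [IsFiniteMeasure π] {q : S d → S d}
    (hq : Measurable q) (h : ∀ᵐ z ∂π, z.2.fst = q z.1.fst) : IsCausal π := by
  intro f g hf hg ⟨K, hK⟩ ⟨K', hK'⟩
  have hle : MeasurableSpace.comap (fun z : X d × X d => z.1.fst) inferInstance ≤
      (inferInstance : MeasurableSpace (X d × X d)) := Measurable.comap_le (by fun_prop)
  set 𝓖 := MeasurableSpace.comap (fun z : X d × X d => z.1.fst) inferInstance with h𝓖
  have hsm : StronglyMeasurable[𝓖] fun z : X d × X d => g (q z.1.fst) :=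
    ((hg.comp hq).comp (comap_measurable _)).stronglyMeasurable
  have hif : Integrable (fun z : X d × X d => f z.1) π :=
    Integrable.of_bound (Measurable.aestronglyMeasurable (by fun_prop)) K (.of_forall fun z => hK z.1)
  have hig : Integrable (fun z : X d × X d => g (q z.1.fst)) π :=
    Integrable.of_bound (Measurable.aestronglyMeasurable (by fun_prop)) K' (.of_forall fun z => hK' _)
  have hfg : Integrable ((fun z : X d × X d => f z.1) * fun z => g (q z.1.fst)) π :=
    hif.mul_bdd (c := K') hig.1 (.of_forall fun z => hK' _)
  have e1 : (fun z : X d × X d => f z.1 * g z.2.fst) =ᵐ[π]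
      (fun z : X d × X d => f z.1) * fun z => g (q z.1.fst) := by
    filter_upwards [h] with z hz
    simp [hz]
  have e2 : (fun z : X d × X d => g z.2.fst) =ᵐ[π] fun z => g (q z.1.fst) := by
    filter_upwards [h] with z hz
    simp [hz]
  refine (condExp_congr_ae e1).trans ?_
  refine (condExp_mul_of_stronglyMeasurable_right hsm hfg hif).trans ?_
  refine EventuallyEq.rfl.mul ?_
  refine EventuallyEq.trans ?_ (condExp_congr_ae e2).symm
  rw [condExp_of_stronglyMeasurable hle hsm hig]

/-- Under the law of `(f, g)` each of the two first coordinates is a function of the other, which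
makes the coupling causal in both directions. -/
theorem transportDist_adapted_map_le (μ : Measure (X d)) [IsFiniteMeasure μ] {f g : X d → X d}
    (hf : Measurable f) (hg : Measurable g) {q q' : S d → S d} (hq : Measurable q)
    (hq' : Measurable q') (h : ∀ x, (g x).fst = q (f x).fst) (h' : ∀ x, (f x).fst = q' (g x).fst) :
    transportDist .adapted p (μ.map f) (μ.map g) ≤ (∫⁻ x, ‖f x - g x‖ₑ ^ p ∂μ) ^ (1 / p) := by
  have adm : IsAdmissible .adapted (μ.map fun x => (f x, g x)) (μ.map f) (μ.map g) := by
    refine ⟨⟨?_, ?_⟩, ?_, ?_⟩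
    · rw [Measure.map_map (by fun_prop) (by fun_prop)]; rfl
    · rw [Measure.map_map (by fun_prop) (by fun_prop)]; rfl
    · refine isCausal_of_fst_eq hq ?_
      rw [ae_map_iff (by fun_prop) (measurableSet_eq_fun (by fun_prop) (by fun_prop))]
      exact .of_forall h
    · rw [Measure.map_map (by fun_prop) (by fun_prop)]
      refine isCausal_of_fst_eq hq' ?_
      rw [ae_map_iff (by fun_prop) (measurableSet_eq_fun (by fun_prop) (by fun_prop))]
      exact .of_forall h'
  refine (transportDist_le_of_isAdmissible adm).trans ?_
  rw [lintegral_map (by fun_prop) (by fun_prop)]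

end Transport

/-! ### Strict differentiability of `φ` along displacements of `μ`. -/

section StrictDifferentiability

variable {d k : ℕ} {p : ℝ}

theorem Pp.integrable_add_one_rpow (hp : 1 < p) (m : Pp d p) :
    Integrable (fun x => (‖x‖ + 1) ^ p) m.1 := by
  have := m.2.1
  have h := ((m.memLp_id hp).norm.add (memLp_const (1 : ℝ))).integrable_norm_rpow'
  rw [ENNReal.toReal_ofReal (by linarith)] at h
  refine h.congr (.of_forall fun x => ?_)
  simp only [Pi.add_apply]
  rw [Real.norm_of_nonneg (by positivity)]

theorem integrable_of_continuous_of_growth {F : Type*} [NormedAddCommGroup F]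
    (hp : 1 < p) {q : ℝ} (hq : q ≤ p) (hq0 : 0 ≤ q) {f : X d → F} (hf : Continuous f) {K : ℝ}
    (hK : ∀ x, ‖f x‖ ≤ K * (1 + ‖x‖ ^ q)) (m : Pp d p) : Integrable f m.1 := by
  refine Integrable.mono' ((m.integrable_add_one_rpow hp).const_mul (|K| * 2))
    hf.aestronglyMeasurable (.of_forall fun x => (hK x).trans ?_)
  have h1 : (1 : ℝ) ≤ (‖x‖ + 1) ^ p := Real.one_le_rpow (by simp) (by linarith)
  have h2 : ‖x‖ ^ q ≤ (‖x‖ + 1) ^ p :=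
    (Real.rpow_le_rpow (norm_nonneg x) (by linarith) hq0).trans
      (Real.rpow_le_rpow_of_exponent_le (by simp) hq)
  have h3 : 0 ≤ ‖x‖ ^ q := by positivity
  calc _ ≤ |K| * (1 + ‖x‖ ^ q) := by gcongr; exact le_abs_self K
    _ ≤ |K| * (2 * (‖x‖ + 1) ^ p) := by gcongr; linarith
    _ = _ := by ring

theorem LocallyGrowth.exists_bound {F : Type*} [NormedAddCommGroup F] {q : ℝ} (hp : 1 < p)
    {f : Pp d p → X d → F} (hf : LocallyGrowth q f) (m : Pp d p) :
    ∃ K, ∀ x, ‖f m x‖ ≤ K * (1 + ‖x‖ ^ q) := by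
  obtain ⟨δ, hδ, K, hK⟩ := hf m
  exact ⟨K, fun x => hK m x (by simpa [transportDist_classical_self hp] using hδ)⟩

theorem RegularFunctional.integrable (hp : 1 < p) {φ : Pp d p → EuclideanSpace ℝ (Fin k)}
    {D : Pp d p → X d → EuclideanSpace ℝ (Fin k)} (h : RegularFunctional φ D) (m m' : Pp d p) :
    Integrable (D m) m'.1 := by
  obtain ⟨K, hK⟩ := h.isDeriv.growth.exists_bound hp m
  exact integrable_of_continuous_of_growth hp le_rfl (by linarith) (h.contDiff m).continuous hK m'

theorem RegularFunctional.integrable_fderiv (hp : 1 < p) {φ : Pp d p → EuclideanSpace ℝ (Fin k)}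
    {D : Pp d p → X d → EuclideanSpace ℝ (Fin k)} (h : RegularFunctional φ D) (m m' : Pp d p) :
    Integrable (fderiv ℝ (D m)) m'.1 := by
  obtain ⟨K, hK⟩ := h.grad_growth.exists_bound hp m
  exact integrable_of_continuous_of_growth hp (by linarith) (by linarith)
    ((h.contDiff m).continuous_fderiv (by simp)) hK m'

theorem aestronglyMeasurable_fderiv_apply {n : ℕ} {u : X d → EuclideanSpace ℝ (Fin n)}
    (hu : ContDiff ℝ 1 u) {m : Measure (X d)} {U : X d → X d} (hU : Measurable U) :
    AEStronglyMeasurable (fun x => fderiv ℝ u x (U x)) m :=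
  isBoundedBilinearMap_apply.continuous.comp_aestronglyMeasurable
    ((hu.continuous_fderiv (by simp)).aestronglyMeasurable.prodMk hU.aestronglyMeasurable)

theorem RegularFunctional.integrable_fderiv_apply (hp : 1 < p)
    {φ : Pp d p → EuclideanSpace ℝ (Fin k)}
    {D : Pp d p → X d → EuclideanSpace ℝ (Fin k)} (h : RegularFunctional φ D) (m : Pp d p)
    {U : X d → X d} (hU : Measurable U) {K : ℝ} (hK : ∀ x, ‖U x‖ ≤ K) :
    Integrable (fun x => fderiv ℝ (D m) x (U x)) m.1 :=
  Integrable.mono' ((h.integrable_fderiv hp m m).norm.mul_const K)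
    (aestronglyMeasurable_fderiv_apply (h.contDiff m) hU)
    (.of_forall fun x => (ContinuousLinearMap.le_opNorm _ _).trans (by gcongr; exact hK x))

/-- Growth of order `p - 1` matches the exponent `p'`, as `(p - 1)p' = p`. -/
theorem RegularFunctional.memLp_fderiv (hp : 1 < p) {φ : Pp d p → EuclideanSpace ℝ (Fin k)}
    {D : Pp d p → X d → EuclideanSpace ℝ (Fin k)} (h : RegularFunctional φ D) (m : Pp d p) :
    MemLp (fderiv ℝ (D m)) (ENNReal.ofReal (conj p)) m.1 := by
  have := m.2.1
  obtain ⟨K, hK⟩ := h.grad_growth.exists_bound hp m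
  have h1 := (m.memLp_id hp).norm_rpow_div (ENNReal.ofReal (p - 1))
  rw [ENNReal.toReal_ofReal (by linarith), ← ENNReal.ofReal_div_of_pos (by linarith)] at h1
  have h2 : MemLp (fun x : X d => K * (1 + ‖x‖ ^ (p - 1))) (ENNReal.ofReal (conj p)) m.1 :=
    (((memLp_const (1 : ℝ)).add h1).const_mul K)
  refine h2.mono ((h.contDiff m).continuous_fderiv (by simp)).aestronglyMeasurable
    (.of_forall fun x => (hK x).trans (le_abs_self _))

theorem Pp.mix_zero (m m' : Pp d p) : m.mix m' 0 = m := by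
  apply Subtype.ext
  simp [Pp.mix]

theorem Pp.mix_one (m m' : Pp d p) : m.mix m' 1 = m' := by
  apply Subtype.ext
  simp [Pp.mix]

theorem Pp.mix_symm (m m' : Pp d p) (t : unitInterval) :
    m.mix m' (unitInterval.symm t) = m'.mix m t := by
  apply Subtype.ext
  simp [Pp.mix, add_comm]

theorem Pp.mix_mix (m m' : Pp d p) {s t u : unitInterval} (h : (u : ℝ) = t + s * (1 - t)) :
    (m.mix m' t).mix m' s = m.mix m' u := by
  apply Subtype.ext
  simp only [Pp.mix, smul_add, smul_smul, add_assoc, ← add_smul]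
  have hs := s.2.1; have hs' := s.2.2; have ht := t.2.1; have ht' := t.2.2
  rw [← ENNReal.ofReal_mul (by linarith), ← ENNReal.ofReal_mul (by linarith),
    ← ENNReal.ofReal_add (mul_nonneg (by linarith) ht) hs, h]
  congr 3 <;> ring_nf

theorem Pp.integral_mix {F : Type*} [NormedAddCommGroup F] [NormedSpace ℝ F] (m m' : Pp d p)
    (t : unitInterval) {f : X d → F} (hf : Integrable f m.1) (hf' : Integrable f m'.1) :
    ∫ x, f x ∂(m.mix m' t).1 = (1 - t : ℝ) • ∫ x, f x ∂m.1 + (t : ℝ) • ∫ x, f x ∂m'.1 := by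
  simp only [Pp.mix]
  rw [integral_add_measure (hf.smul_measure ENNReal.ofReal_ne_top)
    (hf'.smul_measure ENNReal.ofReal_ne_top), integral_smul_measure, integral_smul_measure,
    ENNReal.toReal_ofReal (by linarith [t.2.2]), ENNReal.toReal_ofReal t.2.1]

variable {φ : Pp d p → EuclideanSpace ℝ (Fin k)} {D : Pp d p → X d → EuclideanSpace ℝ (Fin k)}

/-- The functional derivative is only a one-sided derivative at the start of a segment. Restarting
the segment at its point of parameter `t` gives the right derivative there; the new parameter runs
at speed `1 / (1 - t)`. -/
theorem RegularFunctional.hasDerivWithinAt_mix (hp : 1 < p) (h : RegularFunctional φ D)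
    (m m' : Pp d p) {t : ℝ} (ht : t ∈ Set.Ico (0 : ℝ) 1) :
    HasDerivWithinAt (fun s : ℝ => φ (m.mix m' (Set.projIcc 0 1 zero_le_one s)))
      (∫ x, D (m.mix m' ⟨t, ht.1, ht.2.le⟩) x ∂m'.1 - ∫ x, D (m.mix m' ⟨t, ht.1, ht.2.le⟩) x ∂m.1)
      (Set.Ici t) t := by
  set t' : unitInterval := ⟨t, ht.1, ht.2.le⟩ with ht'
  have h1t : 0 < 1 - t := by linarith [ht.2]
  have hd := h.isDeriv.deriv (m.mix m' t') m'
  rw [m.integral_mix m' t' (h.integrable hp _ _) (h.integrable hp _ _)] at hd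
  set A := ∫ x, D (m.mix m' t') x ∂m'.1
  set B := ∫ x, D (m.mix m' t') x ∂m.1
  rw [← hasDerivWithinAt_Ioi_iff_Ici, hasDerivWithinAt_iff_tendsto_slope' (by simp)]
  -- `σ u` is the position of `u` on the segment restarted at `t`.
  set σ : ℝ → unitInterval := fun u => Set.projIcc 0 1 zero_le_one ((u - t) / (1 - t)) with hσ
  have hσc : Continuous σ := continuous_projIcc.comp (by fun_prop)
  have hσt : σ t = 0 := by
    simp only [hσ, sub_self, zero_div]
    exact Set.projIcc_left _
  have hIoo : ∀ᶠ u in 𝓝[>] t, u ∈ Set.Ioo t 1 := Ioo_mem_nhdsGT ht.2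
  have hval : ∀ u ∈ Set.Ioo t 1, (σ u : ℝ) = (u - t) / (1 - t) := by
    intro u hu
    have : (u - t) / (1 - t) ∈ Set.Icc (0 : ℝ) 1 :=
      ⟨div_nonneg (by linarith [hu.1]) h1t.le, (div_le_one h1t).2 (by linarith [hu.2])⟩
    simp only [hσ, Set.projIcc_of_mem _ this]
  have hσ0 : Tendsto σ (𝓝[>] t) (𝓝[>] 0) := by
    refine tendsto_nhdsWithin_iff.2 ⟨?_, ?_⟩
    · have := hσc.tendsto t
      rw [hσt] at this
      exact this.mono_left nhdsWithin_le_nhds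
    · filter_upwards [hIoo] with u hu
      change (0 : ℝ) < σ u
      rw [hval u hu]
      exact div_pos (by linarith [hu.1]) h1t
  have hlim : (1 - t)⁻¹ • (A - ((1 - (t' : ℝ)) • B + (t' : ℝ) • A)) = A - B := by
    have : A - ((1 - (t' : ℝ)) • B + (t' : ℝ) • A) = (1 - t) • (A - B) := by
      simp only [ht']; module
    rw [this, smul_smul, inv_mul_cancel₀ h1t.ne', one_smul]
  rw [← hlim]
  refine ((hd.comp hσ0).const_smul (1 - t)⁻¹).congr' ?_
  filter_upwards [hIoo] with u hu
  have hu' : u ∈ Set.Icc (0 : ℝ) 1 := ⟨by linarith [ht.1, hu.1], hu.2.le⟩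
  have e1 : (m.mix m' t').mix m' (σ u) = m.mix m' ⟨u, hu'⟩ := by
    refine Pp.mix_mix m m' ?_
    rw [hval u hu]
    simp only [ht']
    field_simp
    ring
  have hne : u - t ≠ 0 := by linarith [hu.1]
  simp only [Function.comp_apply, slope, vsub_eq_sub]
  rw [e1, hval u hu, smul_smul, Set.projIcc_of_mem _ hu', Set.projIcc_of_mem _ ⟨ht.1, ht.2.le⟩]
  congr 1
  field_simp

/-- Mean value inequality for `φ(m + t(m' - m)) - t c`, which requires only continuity and a right
derivative. -/
theorem RegularFunctional.norm_sub_sub_le (hp : 1 < p) (h : RegularFunctional φ D)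
    (m m' : Pp d p) (c : EuclideanSpace ℝ (Fin k)) {C : ℝ}
    (hC : ∀ t : unitInterval,
      ‖∫ x, D (m.mix m' t) x ∂m'.1 - ∫ x, D (m.mix m' t) x ∂m.1 - c‖ ≤ C) :
    ‖φ m' - φ m - c‖ ≤ C := by
  set g : ℝ → EuclideanSpace ℝ (Fin k) :=
    fun s : ℝ => φ (m.mix m' (Set.projIcc 0 1 zero_le_one s)) with hg
  have hgc : ContinuousOn g (Set.Icc 0 1) := by
    intro t ht
    have hr : ContinuousWithinAt g (Set.Icc t 1) t := by
      rcases eq_or_lt_of_le ht.2 with h1 | h1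
      · rw [h1, Set.Icc_self]
        exact continuousWithinAt_singleton
      · exact (h.hasDerivWithinAt_mix hp m m' ⟨ht.1, h1⟩).continuousWithinAt.mono
          Set.Icc_subset_Ici_self
    -- Left continuity is right continuity of the reversed segment from `m'` to `m`.
    have hl : ContinuousWithinAt g (Set.Icc 0 t) t := by
      rcases eq_or_lt_of_le ht.1 with h1 | h1
      · rw [← h1, Set.Icc_self]
        exact continuousWithinAt_singleton
      · have hc := (h.hasDerivWithinAt_mix hp m' m (t := 1 - t)
          ⟨by linarith [ht.2], by linarith⟩).continuousWithinAt
        have hc2 : ContinuousWithinAt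
            ((fun s : ℝ => φ (m'.mix m (Set.projIcc 0 1 zero_le_one s))) ∘ fun s => 1 - s)
            (Set.Icc 0 t) t := by
          refine ContinuousWithinAt.comp (t := Set.Ici (1 - t)) hc (by fun_prop) ?_
          intro s hs
          simp only [Set.mem_Ici]
          linarith [hs.2]
        refine hc2.congr ?_ ?_
        · intro s hs
          have hs' : s ∈ Set.Icc (0 : ℝ) 1 := ⟨hs.1, hs.2.trans ht.2⟩
          have hs'' : 1 - s ∈ Set.Icc (0 : ℝ) 1 := ⟨by linarith [hs'.2], by linarith [hs.1]⟩
          simp only [hg, Function.comp_apply]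
          rw [Set.projIcc_of_mem _ hs', Set.projIcc_of_mem _ hs'', ← Pp.mix_symm]
          congr 2
        · have hs'' : 1 - t ∈ Set.Icc (0 : ℝ) 1 := ⟨by linarith [ht.2], by linarith [ht.1]⟩
          simp only [hg, Function.comp_apply]
          rw [Set.projIcc_of_mem _ ht, Set.projIcc_of_mem _ hs'', ← Pp.mix_symm]
          congr 2
    have := hl.union hr
    rwa [Set.Icc_union_Icc_eq_Icc ht.1 ht.2] at this
  have key := norm_image_sub_le_of_norm_deriv_right_le_segment
    (f := fun s => g s - s • c) (a := 0) (b := 1) (C := C)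
    (f' := fun t => ∫ x, D (m.mix m' (Set.projIcc 0 1 zero_le_one t)) x ∂m'.1
      - ∫ x, D (m.mix m' (Set.projIcc 0 1 zero_le_one t)) x ∂m.1 - c)
    (hgc.sub (by fun_prop)) ?_ (fun t _ => hC _) 1 (by simp)
  · have e0 : g 0 = φ m := by
      simp only [hg]
      rw [show Set.projIcc (0 : ℝ) 1 zero_le_one 0 = 0 from Set.projIcc_left _, Pp.mix_zero]
    have e1 : g 1 = φ m' := by
      simp only [hg]
      rw [show Set.projIcc (0 : ℝ) 1 zero_le_one 1 = 1 from Set.projIcc_right _, Pp.mix_one]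
    simp only [e0, e1, one_smul, zero_smul, sub_zero, mul_one] at key
    rwa [sub_right_comm] at key
  · intro t ht
    have h1 := h.hasDerivWithinAt_mix hp m m' ht
    have h2 : HasDerivWithinAt (fun s : ℝ => s • c) c (Set.Ici t) t := by
      simpa using ((hasDerivAt_id t).smul_const c).hasDerivWithinAt
    rw [Set.projIcc_of_mem _ ⟨ht.1, ht.2.le⟩]
    exact h1.sub h2

/-- A modulus of continuity at `μ`, uniform on bounded sets, and integrable at infinity. -/
theorem exists_integrable_modulus {F : Type*} [NormedAddCommGroup F] (hp : 1 < p)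
    {f : Pp d p → X d → F} (hf : JointlyContinuous f) (hg : LocallyGrowth (p - 1) f)
    (μ : Pp d p) {ε : ℝ} (hε : 0 < ε) :
    ∃ δ > (0 : ℝ), ∃ a : X d → ℝ, Integrable a μ.1 ∧ ∫ x, a x ∂μ.1 ≤ ε ∧ (∀ x, 0 ≤ a x) ∧
      ∀ m' : Pp d p, transportDist .classical p μ.1 m'.1 < ENNReal.ofReal δ →
        ∀ x x', ‖x' - x‖ ≤ δ → ‖f m' x' - f μ x‖ ≤ a x := by
  have := μ.2.1
  obtain ⟨δ₁, hδ₁, K, hK⟩ := hg μ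
  have hself : ∀ δ > (0 : ℝ), transportDist .classical p μ.1 μ.1 < ENNReal.ofReal δ := by
    intro δ hδ
    simpa [transportDist_classical_self hp] using hδ
  -- `b` dominates the difference of `f` at any two points at distance at most `1`; it serves as
  -- modulus outside a large ball, where its integral is small.
  set b : X d → ℝ := fun x => 4 * |K| * (‖x‖ + 1 + 1) ^ p with hb
  have hbi : Integrable b μ.1 := by
    have h := (((μ.memLp_id hp).norm.add (memLp_const (1 : ℝ))).add
      (memLp_const (1 : ℝ))).integrable_norm_rpow'
    rw [ENNReal.toReal_ofReal (by linarith)] at h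
    refine (h.const_mul (4 * |K|)).congr (.of_forall fun x => ?_)
    simp only [Pi.add_apply]
    rw [Real.norm_of_nonneg (by positivity)]
  have hb0 : ∀ x, 0 ≤ b x := fun x => by positivity
  have hgrow : ∀ m' : Pp d p, transportDist .classical p μ.1 m'.1 < ENNReal.ofReal δ₁ →
      ∀ x x', ‖x' - x‖ ≤ 1 → ‖f m' x' - f μ x‖ ≤ b x := by
    intro m' hm' x x' hx
    have aux : ∀ y : X d, ‖y‖ ≤ ‖x‖ + 1 → K * (1 + ‖y‖ ^ (p - 1)) ≤
        2 * |K| * (‖x‖ + 1 + 1) ^ p := by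
      intro y hy
      have h1 : (1 : ℝ) ≤ (‖x‖ + 1 + 1) ^ p :=
        Real.one_le_rpow (by linarith [norm_nonneg x]) (by linarith)
      have h2 : ‖y‖ ^ (p - 1) ≤ (‖x‖ + 1 + 1) ^ p :=
        (Real.rpow_le_rpow (norm_nonneg y) (by linarith) (by linarith)).trans
          (Real.rpow_le_rpow_of_exponent_le (by linarith [norm_nonneg x]) (by linarith))
      have h3 : 0 ≤ ‖y‖ ^ (p - 1) := by positivity
      calc _ ≤ |K| * (1 + ‖y‖ ^ (p - 1)) := by gcongr; exact le_abs_self K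
        _ ≤ |K| * (2 * (‖x‖ + 1 + 1) ^ p) := by gcongr; linarith
        _ = _ := by ring
    have hx' : ‖x'‖ ≤ ‖x‖ + 1 := by
      have := norm_add_le x (x' - x)
      rw [add_sub_cancel] at this
      linarith
    calc ‖f m' x' - f μ x‖ ≤ ‖f m' x'‖ + ‖f μ x‖ := norm_sub_le _ _
      _ ≤ 2 * |K| * (‖x‖ + 1 + 1) ^ p + 2 * |K| * (‖x‖ + 1 + 1) ^ p :=
          add_le_add ((hK m' x' hm').trans (aux x' hx'))
            ((hK μ x (hself _ hδ₁)).trans (aux x (by linarith)))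
      _ = b x := by simp only [hb]; ring
  have htail : Tendsto (fun n : ℕ => ∫ x, {x : X d | (n : ℝ) < ‖x‖}.indicator b x ∂μ.1) atTop
      (𝓝 0) := by
    have h0 : (0 : ℝ) = ∫ x : X d, (0 : ℝ) ∂μ.1 := by simp
    rw [h0]
    refine tendsto_integral_of_dominated_convergence b (fun n => ?_) hbi (fun n => ?_) ?_
    · exact (hbi.indicator (measurableSet_lt measurable_const measurable_norm)).1
    · refine .of_forall fun x => ?_
      rw [Real.norm_of_nonneg (Set.indicator_nonneg (fun x _ => hb0 x) x)]
      exact Set.indicator_le_self' (fun x _ => hb0 x) x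
    · refine .of_forall fun x => tendsto_const_nhds.congr' ?_
      obtain ⟨N, hN⟩ := exists_nat_ge ‖x‖
      filter_upwards [eventually_ge_atTop N] with n hn
      rw [Set.indicator_of_notMem]
      simp only [Set.mem_ofPred_eq, not_lt]
      exact hN.trans (by exact_mod_cast hn)
  obtain ⟨R, hR⟩ := (htail.eventually (gt_mem_nhds (half_pos hε))).exists
  -- Joint continuity is uniform over a compact set of `x`, even though `m'` ranges over a ball that
  -- need not be compact.
  have hcpt : ∃ δ > (0 : ℝ), ∀ m' : Pp d p,
      transportDist .classical p μ.1 m'.1 < ENNReal.ofReal δ →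
        ∀ x ∈ Metric.closedBall (0 : X d) R, ∀ x', ‖x' - x‖ ≤ δ →
          ‖f m' x' - f μ x‖ ≤ ε / 2 := by
    refine (isCompact_closedBall (0 : X d) R).induction_on
      (p := fun s => ∃ δ > (0 : ℝ), ∀ m' : Pp d p,
        transportDist .classical p μ.1 m'.1 < ENNReal.ofReal δ →
          ∀ x ∈ s, ∀ x', ‖x' - x‖ ≤ δ → ‖f m' x' - f μ x‖ ≤ ε / 2) ?_ ?_ ?_ ?_
    · exact ⟨1, one_pos, by simp⟩
    · rintro s t hst ⟨δ, hδ, H⟩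
      exact ⟨δ, hδ, fun m' hm' x hx => H m' hm' x (hst hx)⟩
    · rintro s t ⟨δ, hδ, H⟩ ⟨δ', hδ', H'⟩
      refine ⟨min δ δ', lt_min hδ hδ', fun m' hm' x hx x' hx' => ?_⟩
      rcases hx with hx | hx
      · exact H m' (hm'.trans_le (ENNReal.ofReal_le_ofReal (min_le_left _ _))) x hx x'
          (hx'.trans (min_le_left _ _))
      · exact H' m' (hm'.trans_le (ENNReal.ofReal_le_ofReal (min_le_right _ _))) x hx x'
          (hx'.trans (min_le_right _ _))
    · intro x _
      obtain ⟨δ, hδ, H⟩ := hf μ x (ε / 4) (by positivity)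
      -- The radii satisfy `δ / 2 + δ / 3 < δ`, so `x'` stays in the `δ`-ball around the centre `x`.
      refine ⟨Metric.ball x (δ / 2), mem_nhdsWithin_of_mem_nhds
        (Metric.ball_mem_nhds _ (by positivity)), δ / 3, by positivity, ?_⟩
      intro m' hm' y hy x' hx'
      rw [mem_ball_iff_norm] at hy
      have h1 := H m' x' (hm'.trans_le (ENNReal.ofReal_le_ofReal (by linarith))) (by
        have := norm_add_le (x' - y) (y - x)
        rw [sub_add_sub_cancel] at this
        linarith)
      have h2 := H μ y (hself δ hδ) (by linarith)
      calc ‖f m' x' - f μ y‖ = ‖(f m' x' - f μ x) - (f μ y - f μ x)‖ := by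
            congr 1; abel
        _ ≤ ‖f m' x' - f μ x‖ + ‖f μ y - f μ x‖ := norm_sub_le _ _
        _ ≤ ε / 2 := by linarith
  obtain ⟨δ₂, hδ₂, hcpt⟩ := hcpt
  have hind : Integrable ({x : X d | (R : ℝ) < ‖x‖}.indicator b) μ.1 :=
    hbi.indicator (measurableSet_lt measurable_const measurable_norm)
  refine ⟨min (min δ₁ δ₂) 1, by positivity,
    fun x => ε / 2 + {x : X d | (R : ℝ) < ‖x‖}.indicator b x,
    (integrable_const _).add hind, ?_, ?_, ?_⟩
  · rw [integral_add (integrable_const _) hind]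
    simp only [integral_const, probReal_univ, one_smul]
    linarith
  · intro x
    have := Set.indicator_nonneg (s := {x : X d | (R : ℝ) < ‖x‖}) (fun x _ => hb0 x) x
    positivity
  · intro m' hm' x x' hx
    beta_reduce
    by_cases hxR : (R : ℝ) < ‖x‖
    · rw [Set.indicator_of_mem (by exact hxR)]
      have := hgrow m' (hm'.trans_le (ENNReal.ofReal_le_ofReal
        ((min_le_left _ _).trans (min_le_left _ _)))) x x' (hx.trans (min_le_right _ _))
      linarith
    · rw [Set.indicator_of_notMem (by exact hxR), add_zero]
      exact hcpt m' (hm'.trans_le (ENNReal.ofReal_le_ofReal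
        ((min_le_left _ _).trans (min_le_right _ _)))) x (by simpa using hxR) x'
        (hx.trans ((min_le_left _ _).trans (min_le_right _ _)))

/-- Strict differentiability of `φ` at `μ` along bounded displacements. -/
theorem RegularFunctional.exists_strict_deriv (hp : 1 < p) (h : RegularFunctional φ D)
    (μ : Pp d p) {ε : ℝ} (hε : 0 < ε) :
    ∃ δ > (0 : ℝ), ∀ T T' : X d → X d, Measurable T → Measurable T' →
      (∀ x, ‖T x‖ ≤ δ) → (∀ x, ‖T' x‖ ≤ δ) → ∀ η : ℝ, (∀ x, ‖T' x - T x‖ ≤ η) →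
      ‖φ (push μ T') - φ (push μ T) - ∫ x, fderiv ℝ (D μ) x (T' x - T x) ∂μ.1‖ ≤ ε * η := by
  have := μ.2.1
  obtain ⟨δ, hδ, a, hai, haε, ha0, ha⟩ :=
    exists_integrable_modulus hp h.grad_continuous h.grad_growth μ hε
  refine ⟨δ / 2, by positivity, fun T T' hT hT' hTδ hTδ' η hη => ?_⟩
  have hη0 : 0 ≤ η := (norm_nonneg _).trans (hη 0)
  -- The derivative along the segment is `∫ (D m (x + T' x) - D m (x + T x)) dμ` with `m` on the
  -- segment. It remains to replace the increment of `D m` by `∂_x D μ` at `x`.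
  refine h.norm_sub_sub_le hp (push μ T) (push μ T') _ fun t => ?_
  set m := (push μ T).mix (push μ T') t with hm
  have hW : transportDist .classical p μ.1 m.1 < ENNReal.ofReal δ := by
    refine (transportDist_classical_mix_le hp μ (push μ T) (push μ T')
      (f := fun x => x + T x) (g := fun x => x + T' x) (by fun_prop) (by fun_prop)
      (push_val hp μ hT hTδ) (push_val hp μ hT' hTδ') (δ := δ / 2)
      (by simpa using hTδ) (by simpa using hTδ') t).trans_lt ?_
    rw [ENNReal.ofReal_lt_ofReal_iff hδ]
    linarith
  have hint : ∀ U : X d → X d, Measurable U → (∀ x, ‖U x‖ ≤ δ / 2) →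
      ∫ x, D m x ∂(push μ U).1 = ∫ x, D m (x + U x) ∂μ.1 ∧
      Integrable (fun x => D m (x + U x)) μ.1 := by
    intro U hU hUδ
    have hi := h.integrable hp m (push μ U)
    rw [push_val hp μ hU hUδ] at hi ⊢
    have hsm : AEStronglyMeasurable (D m) (shift μ.1 U) := hi.1
    have hmeas : Measurable fun x => x + U x := by fun_prop
    exact ⟨integral_map hmeas.aemeasurable hsm, (integrable_map_measure hsm hmeas.aemeasurable).1 hi⟩
  obtain ⟨e1, i1⟩ := hint T hT hTδ
  obtain ⟨e2, i2⟩ := hint T' hT' hTδ'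
  have i3 : Integrable (fun x => fderiv ℝ (D μ) x (T' x - T x)) μ.1 :=
    h.integrable_fderiv_apply hp μ (hT'.sub hT) hη
  rw [e1, e2, ← integral_sub i2 i1]
  have e3 := integral_sub (i2.sub i1) i3
  simp only [Pi.sub_apply] at e3
  rw [← e3]
  calc _ ≤ ∫ x, a x * η ∂μ.1 := by
        refine norm_integral_le_of_norm_le (hai.mul_const η) (.of_forall fun x => ?_)
        -- On the ball of radius `δ` around `x` the gradient of `D m` differs from `∂_x D μ x` by at
        -- most `a x`.
        have hconv := (convex_closedBall x δ).norm_image_sub_le_of_norm_fderiv_le'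
          (f := D m) (φ := fderiv ℝ (D μ) x) (C := a x) (x := x + T x) (y := x + T' x)
          (fun y _ => ((h.contDiff m).differentiable (by simp)) y)
          (fun y hy => ha m hW x y (by simpa [dist_eq_norm] using hy))
          (by simpa using (hTδ x).trans (by linarith)) (by simpa using (hTδ' x).trans (by linarith))
        rw [add_sub_add_left_eq_sub] at hconv
        exact hconv.trans (mul_le_mul_of_nonneg_left (hη x) (ha0 x))
    _ = (∫ x, a x ∂μ.1) * η := integral_mul_const _ _
    _ ≤ ε * η := by gcongr

end StrictDifferentiability

/-! ### Zeros of small perturbations of a translation. -/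

section Newton

/-- The identity approximates `F` with constant `1/2`, so the image of the ball of radius `ρ`
contains the ball of radius `(1 - 1/2)ρ` around `F z₀`, and this contains `0`. -/
theorem exists_zero_of_approx_id {Z : Type*} [NormedAddCommGroup Z] [NormedSpace ℝ Z]
    [CompleteSpace Z] {F : Z → Z} {z₀ : Z} {ρ : ℝ} (hρ : 0 ≤ ρ)
    (h : ∀ z ∈ Metric.closedBall z₀ ρ, ∀ z' ∈ Metric.closedBall z₀ ρ,
      ‖F z - F z' - (z - z')‖ ≤ 1 / 2 * ‖z - z'‖) (h0 : ‖F z₀‖ ≤ ρ / 2) :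
    ∃ z ∈ Metric.closedBall z₀ ρ, F z = 0 := by
  have hF : ApproximatesLinearOn F (ContinuousLinearMap.id ℝ Z) (Metric.closedBall z₀ ρ)
      (1 / 2 : ℝ≥0) := fun z hz z' hz' => by simpa using h z hz z' hz'
  let inv : (ContinuousLinearMap.id ℝ Z).NonlinearRightInverse :=
    { toFun := id, nnnorm := 1, bound' := fun y => by simp, right_inv' := fun y => by simp }
  have := hF.surjOn_closedBall_of_nonlinearRightInverse inv hρ subset_rfl
  obtain ⟨z, hz, hz0⟩ := this (a := 0) (by
    simp only [Metric.mem_closedBall, dist_zero_left, inv]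
    norm_num
    linarith)
  exact ⟨z, hz, hz0⟩

/-- If `F r` is close to a translation of the identity near `z₀` and almost vanishes at `z₀`,
then a bound of `D r` in terms of the zeros of `F r` passes to the limit. -/
theorem limsup_div_le_of_approx_id {Z : Type*} [NormedAddCommGroup Z] [NormedSpace ℝ Z]
    [CompleteSpace Z] {F : ℝ → Z → Z} {z₀ : Z} {D : ℝ → ℝ≥0∞} {N : ℝ≥0∞} {K : ℝ} (hK : 0 ≤ K)
    (h1 : ∀ ε > (0 : ℝ), ∀ᶠ r in 𝓝[>] (0 : ℝ), ∀ z ∈ Metric.closedBall z₀ 1,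
      ∀ z' ∈ Metric.closedBall z₀ 1, ‖F r z - F r z' - (z - z')‖ ≤ ε * ‖z - z'‖)
    (h2 : Tendsto (fun r => F r z₀) (𝓝[>] (0 : ℝ)) (𝓝 0))
    (h3 : ∀ᶠ r in 𝓝[>] (0 : ℝ), ∀ z ∈ Metric.closedBall z₀ 1, F r z = 0 →
      D r ≤ ENNReal.ofReal r * (N + ENNReal.ofReal (K * ‖z - z₀‖))) :
    limsup (fun r => D r / ENNReal.ofReal r) (𝓝[>] (0 : ℝ)) ≤ N := by
  refine ENNReal.le_of_forall_pos_le_add fun ε hε _ => ?_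
  -- The zero is sought so close to `z₀` that it adds at most `ε` to the bound.
  set ρ : ℝ := min 1 (ε / (K + 1)) with hρ
  have hρ0 : 0 < ρ := lt_min one_pos (by positivity)
  have hKρ : K * ρ ≤ ε := by
    calc K * ρ ≤ (K + 1) * (ε / (K + 1)) := by
          gcongr
          · linarith
          · exact min_le_right _ _
      _ = ε := by field_simp
  have hsub : Metric.closedBall z₀ ρ ⊆ Metric.closedBall z₀ 1 :=
    Metric.closedBall_subset_closedBall (min_le_left _ _)
  have h2' : ∀ᶠ r in 𝓝[>] (0 : ℝ), ‖F r z₀‖ < ρ / 2 := by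
    have := h2.norm
    rw [norm_zero] at this
    exact this.eventually (gt_mem_nhds (half_pos hρ0))
  refine limsup_le_of_le (by isBoundedDefault) ?_
  filter_upwards [h1 (1 / 2) (by norm_num), h2', h3, self_mem_nhdsWithin] with r h1 h2 h3 hr
  obtain ⟨z, hz, hz0⟩ := exists_zero_of_approx_id hρ0.le
    (fun z hz z' hz' => h1 z (hsub hz) z' (hsub hz')) h2.le
  have hr' : ENNReal.ofReal r ≠ 0 := by simpa using hr
  rw [ENNReal.div_le_iff hr' ENNReal.ofReal_ne_top, mul_comm]
  refine (h3 z (hsub hz) hz0).trans ?_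
  gcongr
  rw [← ENNReal.ofReal_coe_nnreal]
  refine ENNReal.ofReal_le_ofReal (le_trans ?_ hKρ)
  gcongr
  simpa [dist_eq_norm] using hz

end Newton

/-! ### The rescaled functional `φ(μ^{rU}) / r` as `r ↘ 0`. -/

section Scaling

variable {d k : ℕ} {p : ℝ} {φ : Pp d p → EuclideanSpace ℝ (Fin k)}
  {D : Pp d p → X d → EuclideanSpace ℝ (Fin k)}

theorem push_zero (hp : 1 < p) (μ : Pp d p) : push μ (fun _ => 0) = μ := by
  apply Subtype.ext
  rw [push_val hp μ measurable_const (K := 0) (by simp)]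
  simp [shift]

/-- For fields bounded by `R`, the displacements `rU` and `rU'` are eventually small enough for
strict differentiability, and both sides of that estimate are homogeneous in `r`. -/
theorem RegularFunctional.eventually_strict_deriv (hp : 1 < p) (h : RegularFunctional φ D)
    (μ : Pp d p) (R : ℝ) {ε : ℝ} (hε : 0 < ε) :
    ∀ᶠ r in 𝓝[>] (0 : ℝ), ∀ U U' : X d → X d, Measurable U → Measurable U' →
      (∀ x, ‖U x‖ ≤ R) → (∀ x, ‖U' x‖ ≤ R) → ∀ η : ℝ, (∀ x, ‖U' x - U x‖ ≤ η) →
      ‖r⁻¹ • φ (push μ fun x => r • U' x) - r⁻¹ • φ (push μ fun x => r • U x)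
        - ∫ x, fderiv ℝ (D μ) x (U' x - U x) ∂μ.1‖ ≤ ε * η := by
  obtain ⟨δ, hδ, H⟩ := h.exists_strict_deriv hp μ hε
  have hr0 : ∀ᶠ r in 𝓝[>] (0 : ℝ), r < δ / (|R| + 1) :=
    nhdsWithin_le_nhds (gt_mem_nhds (by positivity))
  filter_upwards [hr0, self_mem_nhdsWithin] with r hrδ hr U U' hU hU' hUR hUR' η hη
  have hr : 0 < r := hr
  have hb : ∀ W : X d → X d, (∀ x, ‖W x‖ ≤ R) → ∀ x, ‖r • W x‖ ≤ δ := by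
    intro W hW x
    rw [norm_smul, Real.norm_of_nonneg hr.le]
    calc r * ‖W x‖ ≤ δ / (|R| + 1) * (|R| + 1) := by
          gcongr
          exact (hW x).trans ((le_abs_self R).trans (by linarith))
      _ = δ := by field_simp
  have key := H (fun x => r • U x) (fun x => r • U' x) (by fun_prop) (by fun_prop)
    (hb U hUR) (hb U' hUR') (r * η) (fun x => by
      rw [← smul_sub, norm_smul, Real.norm_of_nonneg hr.le]
      gcongr
      exact hη x)
  simp only [← smul_sub, map_smul, integral_smul] at key
  have e : r⁻¹ • φ (push μ fun x => r • U' x) - r⁻¹ • φ (push μ fun x => r • U x)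
        - ∫ x, fderiv ℝ (D μ) x (U' x - U x) ∂μ.1 =
      r⁻¹ • (φ (push μ fun x => r • U' x) - φ (push μ fun x => r • U x)
        - r • ∫ x, fderiv ℝ (D μ) x (U' x - U x) ∂μ.1) := by
    rw [smul_sub, smul_sub, smul_smul, inv_mul_cancel₀ hr.ne', one_smul]
  rw [e, norm_smul, norm_inv, Real.norm_of_nonneg hr.le, inv_mul_le_iff₀ hr]
  linarith

theorem RegularFunctional.tendsto_push (hp : 1 < p) (h : RegularFunctional φ D)
    (μ : Pp d p) (hμ : φ μ = 0) {U : X d → X d} (hU : Measurable U) {R : ℝ}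
    (hR : ∀ x, ‖U x‖ ≤ R) :
    Tendsto (fun r : ℝ => r⁻¹ • φ (push μ fun x => r • U x)) (𝓝[>] 0)
      (𝓝 (∫ x, fderiv ℝ (D μ) x (U x) ∂μ.1)) := by
  have hR0 : 0 ≤ R := (norm_nonneg _).trans (hR 0)
  rw [tendsto_iff_norm_sub_tendsto_zero, Metric.tendsto_nhds]
  intro ε hε
  filter_upwards [h.eventually_strict_deriv hp μ R (ε := ε / (R + 1)) (by positivity)] with r H
  have key := H (fun _ => 0) U measurable_const hU (by simpa using hR0) hR R (by simpa using hR)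
  simp only [smul_zero, sub_zero, push_zero hp, hμ] at key
  rw [Real.dist_eq, sub_zero, abs_of_nonneg (norm_nonneg _)]
  refine key.trans_lt ?_
  rw [div_mul_eq_mul_div, div_lt_iff₀ (by positivity)]
  nlinarith

end Scaling

/-! ### Jacobians, test functions and duality. -/

section Jacobian

variable {d k : ℕ}

theorem inner_gradient_apply {E : Type*} [NormedAddCommGroup E] [InnerProductSpace ℝ E]
    [CompleteSpace E] {u : E → EuclideanSpace ℝ (Fin k)} {x : E} (hu : DifferentiableAt ℝ u x)
    (i : Fin k) (v : E) : inner ℝ (gradient (fun y => u y i) x) v = fderiv ℝ u x v i := by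
  have h : HasFDerivAt (fun y => u y i)
      ((EuclideanSpace.proj i : EuclideanSpace ℝ (Fin k) →L[ℝ] ℝ) ∘L fderiv ℝ u x) x :=
    (EuclideanSpace.proj i : EuclideanSpace ℝ (Fin k) →L[ℝ] ℝ).hasFDerivAt.comp x hu.hasFDerivAt
  rw [gradient, InnerProductSpace.toDual_symm_apply, h.fderiv]
  rfl

theorem inner_jac {u : X d → EuclideanSpace ℝ (Fin k)} {x : X d} (hu : DifferentiableAt ℝ u x)
    (i : Fin k) (v : X d) : inner ℝ (jac u x i) v = fderiv ℝ u x v i :=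
  inner_gradient_apply hu i v

theorem mulV_jac {u : X d → EuclideanSpace ℝ (Fin k)} {x : X d} (hu : DifferentiableAt ℝ u x)
    (v : X d) : mulV (jac u x) v = fderiv ℝ u x v := by
  ext i
  simp [mulV, inner_jac hu]

theorem inner_tmulV {E : Type*} [NormedAddCommGroup E] [InnerProductSpace ℝ E] (A : Fin k → E)
    (c : EuclideanSpace ℝ (Fin k)) (v : E) : inner ℝ (tmulV A c) v = inner ℝ c (mulV A v) := by
  simp [tmulV, mulV, sum_inner, inner_smul_left, PiLp.inner_apply, mul_comm]

theorem jac_eq {u : X d → EuclideanSpace ℝ (Fin k)} {x : X d} (hu : DifferentiableAt ℝ u x)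
    (i : Fin k) : jac u x i = (InnerProductSpace.toDual ℝ (X d)).symm
      ((EuclideanSpace.proj i : EuclideanSpace ℝ (Fin k) →L[ℝ] ℝ) ∘L fderiv ℝ u x) := by
  refine ext_inner_right ℝ fun v => ?_
  rw [inner_jac hu, InnerProductSpace.toDual_symm_apply]
  rfl

theorem continuous_jac {u : X d → EuclideanSpace ℝ (Fin k)} (hu : ContDiff ℝ 1 u) (i : Fin k) :
    Continuous fun x => jac u x i := by
  have hd : ∀ x, DifferentiableAt ℝ u x := hu.differentiable (by simp)
  simp only [jac_eq (hd _)]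
  exact (LinearIsometryEquiv.continuous _).comp
    (continuous_const.clm_comp (hu.continuous_fderiv (by simp)))

theorem norm_jac_le {u : X d → EuclideanSpace ℝ (Fin k)} {x : X d} (hu : DifferentiableAt ℝ u x)
    (i : Fin k) : ‖jac u x i‖ ≤ ‖fderiv ℝ u x‖ := by
  rw [jac_eq hu, LinearIsometryEquiv.norm_map]
  refine ContinuousLinearMap.opNorm_le_bound _ (norm_nonneg _) fun v => ?_
  exact (PiLp.norm_apply_le (fderiv ℝ u x v) i).trans (ContinuousLinearMap.le_opNorm _ _)

/-- Fundamental lemma of the calculus of variations, tested with fields of constant direction. -/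
theorem ae_eq_zero_of_integral_inner_eq_zero {E E' : Type*} [NormedAddCommGroup E]
    [NormedSpace ℝ E] [FiniteDimensional ℝ E] [MeasurableSpace E] [BorelSpace E]
    [NormedAddCommGroup E'] [InnerProductSpace ℝ E'] [CompleteSpace E']
    {m : Measure E} {w : E → E'} (hw : Integrable w m)
    (h : ∀ (g : E → ℝ) (e : E'), ContDiff ℝ 1 g → HasCompactSupport g →
      ∫ x, inner ℝ (w x) (g x • e) ∂m = 0) : w =ᵐ[m] 0 := by
  refine ae_eq_zero_of_integral_contDiff_smul_eq_zero hw.locallyIntegrable fun g hg hgc => ?_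
  have hg1 : ContDiff ℝ 1 g := hg.of_le (by exact_mod_cast le_top)
  obtain ⟨K, hK⟩ := hgc.exists_bound_of_continuous hg1.continuous
  have hi : Integrable (fun x => g x • w x) m :=
    hw.bdd_smul K hg1.continuous.aestronglyMeasurable (.of_forall hK)
  refine ext_inner_left ℝ fun e => ?_
  rw [← integral_inner hi, inner_zero_right, ← h g e hg1 hgc]
  refine integral_congr_ae (.of_forall fun x => ?_)
  simp only [inner_smul_right, real_inner_comm]

/-- In finite dimension, a range with trivial orthogonal complement is everything; no topology on
`V` is needed. -/
theorem exists_preimage_single {V : Type*} [AddCommGroup V] [Module ℝ V]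
    (L : V →ₗ[ℝ] EuclideanSpace ℝ (Fin k))
    (h : ∀ lam, (∀ v, inner ℝ lam (L v) = 0) → lam = 0) :
    ∃ v : Fin k → V, ∀ j, L (v j) = EuclideanSpace.single j 1 := by
  have : L.range = ⊤ := by
    rw [← Submodule.orthogonal_eq_bot_iff, Submodule.eq_bot_iff]
    intro lam hlam
    refine h lam fun v => ?_
    rw [real_inner_comm]
    exact hlam _ ⟨v, rfl⟩
  rw [LinearMap.range_eq_top] at this
  choose v hv using fun j => this (EuclideanSpace.single j 1)
  exact ⟨v, hv⟩

end Jacobian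

/-! ### From a right inverse of the linearised constraints to the distance bound. -/

section Correction

variable {d k : ℕ} {p : ℝ} {φ : Pp d p → EuclideanSpace ℝ (Fin k)}
  {D : Pp d p → X d → EuclideanSpace ℝ (Fin k)}

theorem lintegral_shift_sub_rpow (hp : 1 < p) (μ : Measure (X d)) (Θ W : X d → X d) {r : ℝ}
    (hr : 0 ≤ r) :
    (∫⁻ x, ‖(x + r • Θ x) - (x + r • (Θ x + W x))‖ₑ ^ p ∂μ) ^ (1 / p) =
      ENNReal.ofReal r * eLpNorm W (ENNReal.ofReal p) μ := by
  have h := eLpNorm_const_smul r W (ENNReal.ofReal p) μ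
  rw [← ofReal_norm, Real.norm_of_nonneg hr] at h
  rw [← h, eLpNorm_eq_lintegral_rpow_enorm_toReal (by simp; linarith) (by simp),
    ENNReal.toReal_ofReal (by linarith)]
  congr 2
  funext x
  rw [add_sub_add_left_eq_sub, smul_add, sub_add_cancel_left, enorm_neg]
  rfl

/-- The distance to the constraint set is controlled by a linear right inverse `T` of the
linearised constraints, applied to their value at `Θ`. -/
theorem RegularFunctional.limsup_distToSet_le (hp : 1 < p) (h : RegularFunctional φ D)
    (μ : Pp d p) (hμ : φ μ = 0) (kd : Kind) {P : Set (Pp d p)}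
    {Z : Type*} [NormedAddCommGroup Z] [NormedSpace ℝ Z] [CompleteSpace Z]
    {T : EuclideanSpace ℝ (Fin k) × Z → X d → X d} (hTm : ∀ z, Measurable (T z))
    (hTsub : ∀ z z' x, T (z - z') x = T z x - T z' x) {K : ℝ} (hK : 0 ≤ K)
    (hTK : ∀ z x, ‖T z x‖ ≤ K * ‖z‖)
    (hTint : ∀ z, ∫ x, fderiv ℝ (D μ) x (T z x) ∂μ.1 = z.1)
    {Θ : X d → X d} (hΘ : Measurable Θ) {B : ℝ} (hB : ∀ x, ‖Θ x‖ ≤ B)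
    {z₀ : EuclideanSpace ℝ (Fin k) × Z} (hz₀ : z₀.1 = -∫ x, fderiv ℝ (D μ) x (Θ x) ∂μ.1)
    {F : ℝ → EuclideanSpace ℝ (Fin k) × Z → Z}
    (hF : ∀ ε > (0 : ℝ), ∀ᶠ r in 𝓝[>] (0 : ℝ), ∀ z ∈ Metric.closedBall z₀ 1,
      ∀ z' ∈ Metric.closedBall z₀ 1, ‖F r z - F r z' - (z.2 - z'.2)‖ ≤ ε * ‖z - z'‖)
    (hF0 : Tendsto (fun r => F r z₀) (𝓝[>] (0 : ℝ)) (𝓝 0))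
    (hP : ∀ᶠ r in 𝓝[>] (0 : ℝ), ∀ z ∈ Metric.closedBall z₀ 1, F r z = 0 →
      (push μ fun x => r • (Θ x + T z x)) ∈ P ∧
      transportDist kd p (shift μ.1 fun x => r • Θ x) (shift μ.1 fun x => r • (Θ x + T z x)) ≤
        ENNReal.ofReal r * eLpNorm (T z) (ENNReal.ofReal p) μ.1) :
    limsup (fun r : ℝ => distToSet kd (shift μ.1 fun x => r • Θ x) (φ ⁻¹' {0} ∩ P)
      / ENNReal.ofReal r) (𝓝[>] 0) ≤ eLpNorm (T z₀) (ENNReal.ofReal p) μ.1 := by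
  have := μ.2.1
  have hB0 : 0 ≤ B := (norm_nonneg _).trans (hB 0)
  set R := B + K * (‖z₀‖ + 1) with hR
  have hm : ∀ z, Measurable fun x => Θ x + T z x := fun z => hΘ.add (hTm z)
  have hbd : ∀ z ∈ Metric.closedBall z₀ 1, ∀ x, ‖Θ x + T z x‖ ≤ R := by
    intro z hz x
    refine (norm_add_le _ _).trans (add_le_add (hB x) ((hTK z x).trans ?_))
    gcongr
    rw [mem_closedBall_iff_norm] at hz
    have := norm_add_le z₀ (z - z₀)
    rw [add_sub_cancel] at this
    linarith
  have hTi : ∀ z, Integrable (fun x => fderiv ℝ (D μ) x (T z x)) μ.1 := fun z =>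
    h.integrable_fderiv_apply hp μ (hTm z) (hTK z)
  -- The first component is the rescaled constraint `φ = 0`; the second, abstract one encodes
  -- membership in `P`.
  refine limsup_div_le_of_approx_id (Z := EuclideanSpace ℝ (Fin k) × Z) (z₀ := z₀)
    (F := fun r z => (r⁻¹ • φ (push μ fun x => r • (Θ x + T z x)), F r z)) hK ?_ ?_ ?_
  · intro ε hε
    filter_upwards [h.eventually_strict_deriv hp μ R (ε := ε / (K + 1)) (by positivity),
      hF ε hε] with r H1 H2 z hz z' hz'
    refine norm_prod_le_iff.2 ⟨?_, H2 z hz z' hz'⟩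
    have key := H1 _ _ (hm z') (hm z) (hbd z' hz') (hbd z hz) (K * ‖z - z'‖) (fun x => by
      rw [add_sub_add_left_eq_sub, ← hTsub]
      exact hTK _ x)
    simp only [add_sub_add_left_eq_sub, ← hTsub, hTint] at key
    refine key.trans ?_
    rw [← mul_assoc]
    gcongr
    rw [div_mul_eq_mul_div, div_le_iff₀ (by positivity)]
    nlinarith
  · refine Tendsto.prodMk_nhds ?_ hF0
    have := h.tendsto_push hp μ hμ (hm z₀) (hbd z₀ (by simp))
    simp only [map_add] at this
    rwa [integral_add (h.integrable_fderiv_apply hp μ hΘ hB) (hTi z₀), hTint, hz₀,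
      add_neg_cancel] at this
  · filter_upwards [hP, self_mem_nhdsWithin] with r H hr z hz hz0
    have hr : 0 < r := hr
    rw [Prod.mk_eq_zero] at hz0
    obtain ⟨hzP, hzd⟩ := H z hz hz0.2
    have hmem : (push μ fun x => r • (Θ x + T z x)) ∈ φ ⁻¹' {0} ∩ P := by
      refine ⟨?_, hzP⟩
      simpa [hr.ne'] using hz0.1
    refine (iInf₂_le _ hmem).trans ?_
    have hmr : Measurable fun x => r • (Θ x + T z x) := (hm z).const_smul r
    rw [push_val hp μ hmr (K := r * R) (fun x => by
      rw [norm_smul, Real.norm_of_nonneg hr.le]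
      gcongr
      exact hbd z hz x)]
    refine hzd.trans ?_
    gcongr
    -- Only the small remainder `T (z - z₀)` is estimated in the supremum norm; `T z₀` keeps its
    -- `L^p` norm.
    have e : T z = T z₀ + T (z - z₀) := by
      funext x
      simp [hTsub]
    rw [e]
    refine (eLpNorm_add_le (hTm _).aestronglyMeasurable (hTm _).aestronglyMeasurable ?_).trans ?_
    · rw [← ENNReal.ofReal_one]
      exact ENNReal.ofReal_le_ofReal hp.le
    · gcongr
      refine (eLpNorm_le_of_ae_bound (.of_forall (hTK (z - z₀)))).trans ?_
      simp

end Correction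

/-! ### The classical case. -/

section Classical

variable {d k l : ℕ} {p : ℝ} {φ : Pp d p → EuclideanSpace ℝ (Fin k)}
  {D : Pp d p → X d → EuclideanSpace ℝ (Fin k)}

theorem RegularFunctional.memLp_jac (hp : 1 < p) (h : RegularFunctional φ D) (μ : Pp d p)
    (i : Fin k) : MemLp (fun x => jac (D μ) x i) (ENNReal.ofReal (conj p)) μ.1 :=
  (h.memLp_fderiv hp μ).mono (continuous_jac (h.contDiff μ) i).aestronglyMeasurable
    (.of_forall fun x => norm_jac_le ((h.contDiff μ).differentiable (by simp) x) i)

theorem frob_le_sum {n : ℕ} {E : Type*} [NormedAddCommGroup E] (A : Fin n → E) :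
    frob A ≤ ∑ i, ‖A i‖ := by
  rw [frob]
  refine Real.sqrt_le_iff.2 ⟨by positivity, ?_⟩
  exact Finset.sum_sq_le_sq_sum_of_nonneg fun i _ => norm_nonneg _

theorem norm_le_frob {n : ℕ} {E : Type*} [NormedAddCommGroup E] (A : Fin n → E) (i : Fin n) :
    ‖A i‖ ≤ frob A := by
  refine Real.le_sqrt_of_sq_le ?_
  exact Finset.single_le_sum (f := fun i => ‖A i‖ ^ 2) (fun i _ => by positivity)
    (Finset.mem_univ i)

theorem conj_pos (hp : 1 < p) : 0 < conj p := div_pos (by linarith) (by linarith)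

theorem one_lt_conj (hp : 1 < p) : 1 < conj p := by
  rw [conj, lt_div_iff₀ (by linarith)]
  linarith

theorem one_le_ofReal_conj (hp : 1 < p) : 1 ≤ ENNReal.ofReal (conj p) := by
  rw [← ENNReal.ofReal_one]
  exact ENNReal.ofReal_le_ofReal (one_lt_conj hp).le

theorem sum_smul_single_one (a : EuclideanSpace ℝ (Fin k)) :
    ∑ j, a j • (EuclideanSpace.single j 1 : EuclideanSpace ℝ (Fin k)) = a := by
  ext i
  simp [Finset.sum_apply, Pi.single_apply]

/-- The entries are bounded by `|A|^2 / |A|^(2 - p') = |A|^p'`, and `A = ∂_x δ_m φ` lies in `L^p'`.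
-/
theorem RegularFunctional.integrable_mulT_div (hp : 1 < p) (h : RegularFunctional φ D)
    (μ : Pp d p) (i j : Fin k) :
    Integrable (fun x => mulT (jac (D μ) x) (jac (D μ) x) i j /
      frob (jac (D μ) x) ^ (2 - conj p)) μ.1 := by
  have := μ.2.1
  have hc := fun i => continuous_jac (h.contDiff μ) i
  have h1 : MemLp (fun x => ∑ i, ‖jac (D μ) x i‖) (ENNReal.ofReal (conj p)) μ.1 :=
    memLp_finsetSum _ fun i _ => (h.memLp_jac hp μ i).norm
  have h2 := h1.integrable_norm_rpow'
  rw [ENNReal.toReal_ofReal (conj_pos hp).le] at h2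
  refine h2.mono' ?_ (.of_forall fun x => ?_)
  · have hfrob : Measurable fun x => frob (jac (D μ) x) :=
      (Continuous.sqrt (continuous_finsetSum _ fun i _ => (hc i).norm.pow 2)).measurable
    have hin : Measurable fun x => mulT (jac (D μ) x) (jac (D μ) x) i j :=
      ((hc i).inner (hc j)).measurable
    exact (hin.div (hfrob.pow_const _)).aestronglyMeasurable
  · set A := jac (D μ) x
    have hf0 : 0 ≤ frob A := Real.sqrt_nonneg _
    rw [norm_div, Real.norm_of_nonneg (Real.rpow_nonneg hf0 _),
      Real.norm_of_nonneg (show 0 ≤ ∑ i, ‖A i‖ by positivity)]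
    have hle : ‖mulT A A i j‖ ≤ frob A ^ 2 :=
      (norm_inner_le_norm (A i) (A j)).trans ((mul_le_mul (norm_le_frob A i) (norm_le_frob A j)
        (norm_nonneg _) hf0).trans_eq (sq _).symm)
    -- Where `A = 0` the numerator vanishes, so the value of the power of `0` is immaterial.
    rcases hf0.eq_or_lt with h0 | h0
    · have : ‖mulT A A i j‖ = 0 := le_antisymm (by simpa [← h0] using hle) (norm_nonneg _)
      rw [this, zero_div]
      positivity
    · calc _ ≤ frob A ^ 2 / frob A ^ (2 - conj p) := by gcongr
        _ = frob A ^ conj p := by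
            rw [← Real.rpow_natCast, ← Real.rpow_sub h0]
            norm_num
        _ ≤ _ := Real.rpow_le_rpow hf0 (frob_le_sum A) (conj_pos hp).le

/-- Since `A Aᵀ λ = 0`, the weighted Gram matrix annihilates `λ`, and coercivity leaves `0 ≤
-c|λ|²`. -/
theorem eq_zero_of_tmulV_jac_ae_eq_zero (hp : 1 < p) (h : RegularFunctional φ D) (μ : Pp d p)
    {ψ : X d → EuclideanSpace ℝ (Fin l)} (hA : AssumptionW p μ.1 (D μ) ψ)
    {lam : EuclideanSpace ℝ (Fin k)} (hl : (fun x => tmulV (jac (D μ) x) lam) =ᵐ[μ.1] 0) :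
    lam = 0 := by
  obtain ⟨c, hc, hpos⟩ := hA.nondegenerate
  have key := hpos.dotProduct_mulVec_nonneg (WithLp.ofLp lam)
  have hH : (Matrix.of fun i j => ∫ x, mulT (jac (D μ) x) (jac (D μ) x) i j /
      frob (jac (D μ) x) ^ (2 - conj p) ∂μ.1).mulVec (WithLp.ofLp lam) = 0 := by
    funext i
    simp only [Matrix.mulVec, dotProduct, Matrix.of_apply, Pi.zero_apply, ← integral_mul_const]
    rw [← integral_finsetSum _ fun j _ => (h.integrable_mulT_div hp μ i j).mul_const _]
    refine integral_eq_zero_of_ae ?_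
    filter_upwards [hl] with x hx
    have : ∑ j, mulT (jac (D μ) x) (jac (D μ) x) i j * lam j = 0 := by
      have h0 : inner ℝ (jac (D μ) x i) (tmulV (jac (D μ) x) lam) = 0 := by rw [hx]; simp
      rw [← h0]
      simp [tmulV, inner_sum, inner_smul_right, mulT, mul_comm]
    simp only [div_mul_eq_mul_div, ← Finset.sum_div]
    rw [this]
    simp
  rw [Matrix.sub_mulVec, hH, Matrix.smul_mulVec, Matrix.one_mulVec] at key
  have hsq : star (WithLp.ofLp lam) ⬝ᵥ WithLp.ofLp lam = ‖lam‖ ^ 2 := by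
    rw [EuclideanSpace.norm_sq_eq]
    simp [dotProduct, sq]
  simp only [zero_sub, dotProduct_neg, dotProduct_smul, hsq, smul_eq_mul] at key
  have : ‖lam‖ ^ 2 = 0 := by
    have := sq_nonneg ‖lam‖
    nlinarith
  simpa using this

/-- If `λ` is orthogonal to all attainable values, then `(∂_x δ_m φ)ᵀλ` integrates to zero against
every test field, hence vanishes almost everywhere. -/
theorem exists_classical_fields (hp : 1 < p) (h : RegularFunctional φ D) (μ : Pp d p)
    {ψ : X d → EuclideanSpace ℝ (Fin l)} (hA : AssumptionW p μ.1 (D μ) ψ) :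
    ∃ V : Fin k → X d → X d, (∀ j, IsTestField .classical (V j)) ∧
      ∀ j, ∫ x, fderiv ℝ (D μ) x (V j x) ∂μ.1 = EuclideanSpace.single j 1 := by
  let W : Submodule ℝ (X d → X d) :=
    { carrier := {V | ContDiff ℝ 1 V ∧ HasCompactSupport V}
      add_mem' := fun h h' => ⟨h.1.add h'.1, h.2.add h'.2⟩
      zero_mem' := ⟨contDiff_const, HasCompactSupport.zero⟩
      smul_mem' := fun c V h => ⟨h.1.const_smul c, h.2.smul_left (f := fun _ => c)⟩ }
  have hint : ∀ V : W, Integrable (fun x => fderiv ℝ (D μ) x (V.1 x)) μ.1 := by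
    intro V
    obtain ⟨K, hK⟩ := V.2.2.exists_bound_of_continuous V.2.1.continuous
    exact h.integrable_fderiv_apply hp μ V.2.1.continuous.measurable hK
  let L : W →ₗ[ℝ] EuclideanSpace ℝ (Fin k) :=
    { toFun := fun V => ∫ x, fderiv ℝ (D μ) x (V.1 x) ∂μ.1
      map_add' := fun V V' => by
        rw [← integral_add (hint V) (hint V')]
        simp
      map_smul' := fun c V => by
        simp [integral_smul] }
  have hL : ∀ lam, (∀ v, inner ℝ lam (L v) = 0) → lam = 0 := by
    intro lam hlam
    refine eq_zero_of_tmulV_jac_ae_eq_zero hp h μ hA ?_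
    have := μ.2.1
    have hi : Integrable (fun x => tmulV (jac (D μ) x) lam) μ.1 := by
      exact integrable_finsetSum _ fun i _ =>
        ((h.memLp_jac hp μ i).integrable (one_le_ofReal_conj hp)).smul (lam i)
    refine ae_eq_zero_of_integral_inner_eq_zero hi fun g e hg hgc => ?_
    have key := hlam ⟨fun x => g x • e, hg.smul contDiff_const, hgc.smul_right⟩
    simp only [L, LinearMap.coe_mk, AddHom.coe_mk] at key
    rw [← integral_inner (hint ⟨fun x => g x • e, hg.smul contDiff_const, hgc.smul_right⟩)] at key
    rw [← key]
    refine integral_congr_ae (.of_forall fun x => ?_)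
    simp only [inner_tmulV]
    rw [mulV_jac ((h.contDiff μ).differentiable (by simp) x)]
  obtain ⟨V, hV⟩ := exists_preimage_single L hL
  exact ⟨fun j => (V j).1, fun j => (V j).2, hV⟩

theorem classical_bound (hp : 1 < p) (h : RegularFunctional φ D) (μ : Pp d p) (hμ : φ μ = 0)
    {ψ : X d → EuclideanSpace ℝ (Fin l)} (hA : AssumptionW p μ.1 (D μ) ψ) :
    ∃ C : ℝ≥0, 0 < C ∧ ∀ Θ : X d → X d, IsTestField .classical Θ →
      limsup (fun r : ℝ =>
          distToSet .classical (shift μ.1 fun x => r • Θ x) (φ ⁻¹' {0} ∩ perp p (calE ψ))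
            / ENNReal.ofReal r) (𝓝[>] 0)
        ≤ C * opNorm .classical p μ.1 (D μ) ψ Θ := by
  have := μ.2.1
  obtain ⟨V, hV, hVe⟩ := exists_classical_fields hp h μ hA
  choose K hK using fun j => (hV j).2.exists_bound_of_continuous (hV j).1.continuous
  have hK0 : ∀ j, 0 ≤ K j := fun j => (norm_nonneg _).trans (hK j 0)
  have hVi : ∀ j, Integrable (fun x => fderiv ℝ (D μ) x (V j x)) μ.1 := fun j =>
    h.integrable_fderiv_apply hp μ (hV j).1.continuous.measurable (hK j)
  -- The trivial space `PUnit` stands for the absent conditional constraint, as `ψ = 0`.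
  set T : EuclideanSpace ℝ (Fin k) × PUnit.{1} → X d → X d :=
    fun z x => ∑ j, z.1 j • V j x with hT
  have hTK : ∀ z x, ‖T z x‖ ≤ (∑ j, K j) * ‖z‖ := by
    intro z x
    rw [Finset.sum_mul]
    refine norm_sum_le_of_le _ fun j _ => ?_
    rw [norm_smul, mul_comm]
    exact mul_le_mul (hK j x) ((PiLp.norm_apply_le z.1 j).trans (norm_fst_le z)) (norm_nonneg _)
      (hK0 j)
  have hsum0 : 0 ≤ ∑ j, K j := Finset.sum_nonneg fun j _ => hK0 j
  refine ⟨(∑ j, K j).toNNReal + 1, by positivity, fun Θ hΘ => ?_⟩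
  obtain ⟨B, hB⟩ := hΘ.2.exists_bound_of_continuous hΘ.1.continuous
  have hΘm : Measurable Θ := hΘ.1.continuous.measurable
  have hTm : ∀ z, Measurable (T z) := fun z =>
    Finset.measurable_fun_sum _ fun j _ => ((hV j).1.continuous.measurable.const_smul (z.1 j))
  have hop : opL1 .classical μ.1 (D μ) Θ = ∫ x, fderiv ℝ (D μ) x (Θ x) ∂μ.1 := by
    refine integral_congr_ae (.of_forall fun x => ?_)
    exact mulV_jac ((h.contDiff μ).differentiable (by simp) x) _
  have key := h.limsup_distToSet_le hp μ hμ .classical (P := perp p (calE ψ)) (T := T) hTm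
    (fun z z' x => by simp [hT, sub_smul]) hsum0 hTK
    (fun z => by
      simp only [hT, map_sum, map_smul]
      have e := integral_finsetSum Finset.univ fun j _ => (hVi j).smul (z.1 j)
      simp only [Pi.smul_apply] at e
      rw [e]
      simp only [integral_smul, hVe, sum_smul_single_one])
    hΘm hB (z₀ := (-opL1 .classical μ.1 (D μ) Θ, 0)) (by simp [hop]) (F := fun _ _ => 0)
    (by
      intro ε hε
      refine .of_forall fun r z _ z' _ => ?_
      rw [Subsingleton.elim (_ - _ - _ : PUnit) 0, norm_zero]
      positivity) tendsto_const_nhds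
    (by
      filter_upwards [self_mem_nhdsWithin] with r hr z hz _
      refine ⟨?_, ?_⟩
      · rintro f ⟨g, hg, rfl⟩
        simp [hA.psi_zero]
      · rw [← lintegral_shift_sub_rpow hp μ.1 Θ (T z) (le_of_lt hr)]
        have hTz := hTm z
        exact transportDist_classical_map_le μ.1 (by fun_prop) (by fun_prop))
  refine key.trans ?_
  refine (eLpNorm_le_of_ae_bound (.of_forall (hTK _))).trans ?_
  simp only [measure_univ, ENNReal.one_rpow, one_mul, opNorm]
  rw [ENNReal.ofReal_mul hsum0]
  have e : ENNReal.ofReal ‖((-opL1 .classical μ.1 (D μ) Θ, 0) :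
      EuclideanSpace ℝ (Fin k) × PUnit.{1})‖ = ‖opL1 .classical μ.1 (D μ) Θ‖ₑ := by
    rw [Prod.norm_def]
    simp
  rw [e]
  push_cast
  gcongr
  · exact le_self_add
  · exact le_self_add

end Classical

/-! ### The Banach space in which the conditional constraint takes its values. -/

section BoundedMeasurable

/-- The Banach space of bounded measurable functions with the supremum norm. -/
def boundedMeasurable (α E : Type*) [MeasurableSpace α] [NormedAddCommGroup E]
    [InnerProductSpace ℝ E] [FiniteDimensional ℝ E] [MeasurableSpace E] [BorelSpace E] :
    Submodule ℝ (lp (fun _ : α => E) ∞) where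
  carrier := {f | Measurable (f : α → E)}
  add_mem' := fun {f g} hf hg => by
    have := FiniteDimensional.proper_real E
    exact Measurable.add hf hg
  zero_mem' := measurable_const
  smul_mem' := fun c f hf => by
    have := FiniteDimensional.proper_real E
    exact Measurable.const_smul hf c

variable {α E : Type*} [MeasurableSpace α] [NormedAddCommGroup E]
    [InnerProductSpace ℝ E] [FiniteDimensional ℝ E] [MeasurableSpace E] [BorelSpace E]

/-- Uniform limits of measurable functions are measurable. Completeness of the subspace is what the
search for a zero needs. -/
theorem isClosed_boundedMeasurable :
    IsClosed (boundedMeasurable α E : Set (lp (fun _ : α => E) ∞)) := by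
  refine IsSeqClosed.isClosed fun f g hf hfg => ?_
  refine measurable_of_tendsto_metrizable (f := fun n => (f n : α → E)) hf ?_
  refine tendsto_pi_nhds.2 fun a => ?_
  rw [tendsto_iff_norm_sub_tendsto_zero] at hfg ⊢
  refine squeeze_zero (fun _ => norm_nonneg _) (fun n => ?_) hfg
  exact lp.norm_apply_le_norm ENNReal.top_ne_zero (f n - g) a

instance : CompleteSpace (boundedMeasurable α E) := by
  have := FiniteDimensional.complete ℝ E
  exact isClosed_boundedMeasurable.completeSpace_coe

theorem exists_boundedMeasurable {f : α → E} (hf : Measurable f) {K : ℝ} (hK : ∀ a, ‖f a‖ ≤ K) :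
    ∃ g : boundedMeasurable α E, ∀ a, (g : lp (fun _ : α => E) ∞) a = f a :=
  ⟨⟨⟨f, memℓp_infty ⟨K, by rintro _ ⟨a, rfl⟩; exact hK a⟩⟩, hf⟩, fun _ => rfl⟩

theorem norm_boundedMeasurable_apply_le (g : boundedMeasurable α E) (a : α) :
    ‖(g : lp (fun _ : α => E) ∞) a‖ ≤ ‖g‖ :=
  lp.norm_apply_le_norm ENNReal.top_ne_zero (g : lp (fun _ : α => E) ∞) a

theorem norm_boundedMeasurable_le {g : boundedMeasurable α E} {C : ℝ} (hC : 0 ≤ C)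
    (h : ∀ a, ‖(g : lp (fun _ : α => E) ∞) a‖ ≤ C) : ‖g‖ ≤ C :=
  lp.norm_le_of_forall_le hC h

end BoundedMeasurable

/-! ### Conditional expectations through a regular conditional law. -/

section Disintegration

theorem integrable_map_prod {d : ℕ} {F : Type*} [NormedAddCommGroup F]
    {m : Measure (X d)} {f : X d → F} (hf : Integrable f m) :
    Integrable (fun q : S d × S d => f (WithLp.toLp 2 q)) (m.map fun x => (x.fst, x.snd)) := by
  have e : m = (m.map fun x : X d => (x.fst, x.snd)).map (WithLp.toLp 2) := by
    rw [Measure.map_map (by fun_prop) (by fun_prop)]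
    exact Measure.map_id.symm
  have hf' := hf
  rw [e] at hf'
  exact (integrable_map_measure hf'.1 (by fun_prop)).1 hf'

theorem stronglyMeasurable_slice {d : ℕ} {F : Type*} [NormedAddCommGroup F] {f : X d → F}
    (hf : StronglyMeasurable f) (y : S d) :
    StronglyMeasurable fun z => f (WithLp.toLp 2 (y, z)) :=
  hf.comp_measurable (by fun_prop)

variable {d : ℕ} {F : Type*} [NormedAddCommGroup F]

/-- The conditional law of `X₂` given `X₁`. -/
noncomputable def condLaw (m : Measure (X d)) [IsFiniteMeasure m] :
    ProbabilityTheory.Kernel (S d) (S d) :=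
  ProbabilityTheory.condDistrib (fun x : X d => x.snd) (fun x : X d => x.fst) m

instance (m : Measure (X d)) [IsFiniteMeasure m] :
    ProbabilityTheory.IsMarkovKernel (condLaw m) := by
  unfold condLaw
  infer_instance

variable {m : Measure (X d)} [IsFiniteMeasure m]

theorem ae_integrable_slice {f : X d → F} (hf : Integrable f m) :
    ∀ᵐ x ∂m, Integrable (fun z => f (WithLp.toLp 2 (x.fst, z))) (condLaw m x.fst) :=
  (integrable_map_prod hf).condDistrib_ae measurable_fst.aemeasurable measurable_snd.aemeasurable

theorem integrable_slice {f : X d → F} (hf : StronglyMeasurable f) {K : ℝ} (hK : ∀ x, ‖f x‖ ≤ K)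
    (y : S d) : Integrable (fun z => f (WithLp.toLp 2 (y, z))) (condLaw m y) :=
  Integrable.of_bound (stronglyMeasurable_slice hf y).aestronglyMeasurable K
    (.of_forall fun _ => hK _)

variable [NormedSpace ℝ F]

/-- The version `y ↦ ∫ f(y, z) κ(y, dz)` of `𝔼[f(X) | X₁ = y]`, with `κ` the conditional law. -/
noncomputable def kerE (m : Measure (X d)) [IsFiniteMeasure m] (f : X d → F) (y : S d) : F :=
  ∫ z, f (WithLp.toLp 2 (y, z)) ∂condLaw m y

theorem condE1_ae_eq [CompleteSpace F] {f : X d → F} (hf : Integrable f m) :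
    condE1 m f =ᵐ[m] fun x => kerE m f x.fst :=
  ProbabilityTheory.condExp_prod_ae_eq_integral_condDistrib' measurable_fst
    measurable_snd.aemeasurable (integrable_map_prod hf)

theorem integral_kerE [CompleteSpace F] {f : X d → F} (hf : Integrable f m) :
    ∫ x, kerE m f x.fst ∂m = ∫ x, f x ∂m := by
  rw [← integral_congr_ae (condE1_ae_eq hf)]
  exact integral_condExp comap_fst_le

theorem integrable_kerE [CompleteSpace F] {f : X d → F} (hf : Integrable f m) :
    Integrable (fun x => kerE m f x.fst) m :=
  integrable_condExp.congr (condE1_ae_eq hf)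

theorem stronglyMeasurable_kerE {f : X d → F} (hf : StronglyMeasurable f) :
    StronglyMeasurable (kerE m f) :=
  StronglyMeasurable.integral_condDistrib (f := fun q : S d × S d => f (WithLp.toLp 2 q))
    (hf.comp_measurable (by fun_prop))

/-- The bound holds at every `y`, not just almost everywhere. This is why a fixed kernel replaces
the conditional expectation: the constraint becomes a genuine function of `y`, controlled in the
supremum norm. -/
theorem norm_kerE_le {f : X d → F} {K : ℝ} (hK : ∀ x, ‖f x‖ ≤ K) (y : S d) :
    ‖kerE m f y‖ ≤ K := by
  refine (norm_integral_le_of_norm_le_const (.of_forall fun z => hK _)).trans ?_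
  simp

theorem kerE_add {f g : X d → F} (hf : StronglyMeasurable f) {K : ℝ} (hK : ∀ x, ‖f x‖ ≤ K)
    (hg : StronglyMeasurable g) {K' : ℝ} (hK' : ∀ x, ‖g x‖ ≤ K') (y : S d) :
    kerE m (fun x => f x + g x) y = kerE m f y + kerE m g y :=
  integral_add (integrable_slice hf hK y) (integrable_slice hg hK' y)

theorem kerE_sub {f g : X d → F} (hf : StronglyMeasurable f) {K : ℝ} (hK : ∀ x, ‖f x‖ ≤ K)
    (hg : StronglyMeasurable g) {K' : ℝ} (hK' : ∀ x, ‖g x‖ ≤ K') (y : S d) :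
    kerE m (fun x => f x - g x) y = kerE m f y - kerE m g y :=
  integral_sub (integrable_slice hf hK y) (integrable_slice hg hK' y)

/-- Functions of `X₁` factor out of the conditional expectation. -/
theorem integral_inner_kerE {E : Type*} [NormedAddCommGroup E] [InnerProductSpace ℝ E]
    [CompleteSpace E] {f : X d → E} (hf : Integrable f m) {a : S d → E}
    (ha : Integrable (fun x => inner ℝ (a x.fst) (f x)) m) :
    ∫ x, inner ℝ (a x.fst) (kerE m f x.fst) ∂m = ∫ x, inner ℝ (a x.fst) (f x) ∂m := by
  rw [← integral_kerE ha]
  refine integral_congr_ae ?_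
  filter_upwards [ae_integrable_slice hf] with x hx
  simp only [kerE]
  exact (integral_inner hx _).symm

end Disintegration

/-! ### Inversion of the conditional Gram matrix. -/

section Gram

variable {d l : ℕ}

theorem stronglyMeasurable_fderiv_apply {n : ℕ} {u : X d → EuclideanSpace ℝ (Fin n)}
    (hu : ContDiff ℝ 1 u) {U : X d → X d} (hU : Measurable U) :
    StronglyMeasurable (fun x => fderiv ℝ u x (U x)) :=
  isBoundedBilinearMap_apply.continuous.comp_stronglyMeasurable
    ((hu.continuous_fderiv (by simp)).stronglyMeasurable.prodMk hU.stronglyMeasurable)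

theorem norm_tmulV_le {E : Type*} [NormedAddCommGroup E] [InnerProductSpace ℝ E] {A : Fin l → E}
    {K : ℝ} (hK : ∀ i, ‖A i‖ ≤ K) (c : EuclideanSpace ℝ (Fin l)) :
    ‖tmulV A c‖ ≤ l * K * ‖c‖ := by
  calc ‖tmulV A c‖ ≤ ∑ _i : Fin l, K * ‖c‖ := by
        refine norm_sum_le_of_le _ fun i _ => ?_
        rw [norm_smul, mul_comm]
        exact mul_le_mul (hK i) (PiLp.norm_apply_le c i) (norm_nonneg _)
          ((norm_nonneg _).trans (hK i))
    _ = _ := by simp; ring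

theorem fderiv_apply_snd {n : ℕ} {u : X d → EuclideanSpace ℝ (Fin n)} {x : X d}
    (hu : DifferentiableAt ℝ u x) (v : S d) :
    fderiv ℝ u x (WithLp.toLp 2 (0, v)) = mulV (jac2 u x) v := by
  ext i
  rw [← inner_jac hu, WithLp.prod_inner_apply]
  simp [mulV, jac2]

/-- A measurable field of right inverses of the conditional Gram matrices. -/
theorem exists_gram_inverse {m : Measure (X d)} [IsProbabilityMeasure m]
    {ψ : X d → EuclideanSpace ℝ (Fin l)} (hψ : ContDiff ℝ 1 ψ) {K : ℝ}
    (hK : ∀ x, ‖fderiv ℝ ψ x‖ ≤ K)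
    (hgram : ∃ c > (0 : ℝ), ∀ᵐ x ∂m,
      (condGram m ψ x - c • (1 : Matrix (Fin l) (Fin l) ℝ)).PosSemidef) :
    ∃ G : Set (S d), MeasurableSet G ∧ (∀ᵐ x ∂m, x.fst ∈ G) ∧
      ∃ (P : S d → EuclideanSpace ℝ (Fin l) →ₗ[ℝ] EuclideanSpace ℝ (Fin l)) (C : ℝ), 0 ≤ C ∧
        (∀ y v, ‖P y v‖ ≤ C * ‖v‖) ∧
        (∀ g : S d → EuclideanSpace ℝ (Fin l), Measurable g → Measurable fun y => P y (g y)) ∧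
        ∀ y ∈ G, ∀ v, kerE m (fun x => mulV (jac2 ψ x) (tmulV (jac2 ψ x) (P y v))) y = v := by
  classical
  obtain ⟨c, hc, hgram⟩ := hgram
  have hd : ∀ x, DifferentiableAt ℝ ψ x := hψ.differentiable (by simp)
  have hj : ∀ i, Continuous fun x => jac2 ψ x i := fun i => by
    have := continuous_jac hψ i
    unfold jac2
    fun_prop
  have hjK : ∀ i x, ‖jac2 ψ x i‖ ≤ K := fun i x =>
    (WithLp.norm_snd_le (S d) _).trans ((norm_jac_le (hd x) i).trans (hK x))
  have hentry : ∀ i j, StronglyMeasurable fun x => mulT (jac2 ψ x) (jac2 ψ x) i j := fun i j =>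
    ((hj i).inner (hj j)).stronglyMeasurable
  have hentryK : ∀ i j x, ‖mulT (jac2 ψ x) (jac2 ψ x) i j‖ ≤ K * K := fun i j x =>
    (norm_inner_le_norm (jac2 ψ x i) (jac2 ψ x j)).trans (mul_le_mul (hjK i x) (hjK j x)
      (norm_nonneg _) ((norm_nonneg _).trans (hjK i x)))
  let _ : MeasurableSpace (Matrix (Fin l) (Fin l) ℝ) := MeasurableSpace.pi
  have : BorelSpace (Matrix (Fin l) (Fin l) ℝ) :=
    inferInstanceAs (BorelSpace (Fin l → Fin l → ℝ))
  set M : S d → Matrix (Fin l) (Fin l) ℝ :=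
    fun y => Matrix.of fun i j => kerE m (fun x => mulT (jac2 ψ x) (jac2 ψ x) i j) y with hM
  have hMm : Measurable M := by
    refine measurable_pi_lambda _ fun i => measurable_pi_lambda _ fun j => ?_
    exact (stronglyMeasurable_kerE (hentry i j)).measurable
  -- The coercive matrices form a closed set, so the good set `M ⁻¹' A` of starting points is
  -- measurable. `P` is the inverse there and `0` elsewhere, which makes the bound `c⁻¹` hold at
  -- every point.
  set A : Set (Matrix (Fin l) (Fin l) ℝ) :=
    {Q | ∀ v : Fin l → ℝ, c * ∑ i, v i ^ 2 ≤ v ⬝ᵥ Q.mulVec v} with hA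
  have hAc : IsClosed A := by
    simp only [hA, Set.ofPred_forall]
    exact isClosed_iInter fun v => isClosed_le continuous_const (by fun_prop)
  have hG : MeasurableSet (M ⁻¹' A) := hMm hAc.measurableSet
  have hAinj : ∀ Q ∈ A, ∀ v : EuclideanSpace ℝ (Fin l),
      c * ‖v‖ ≤ ‖(WithLp.toLp 2 (Q.mulVec v) : EuclideanSpace ℝ (Fin l))‖ := by
    intro Q hQ v
    have h1 := hQ v
    have h2 : (WithLp.ofLp v) ⬝ᵥ Q.mulVec v =
        inner ℝ v (WithLp.toLp 2 (Q.mulVec v) : EuclideanSpace ℝ (Fin l)) := by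
      simp [PiLp.inner_apply, dotProduct, mul_comm]
    have h3 : ∑ i, v i ^ 2 = ‖v‖ ^ 2 := by
      rw [EuclideanSpace.norm_sq_eq]; simp
    rw [h2, h3] at h1
    have h4 := h1.trans (real_inner_le_norm _ _)
    rcases (norm_nonneg v).eq_or_lt with h0 | h0
    · rw [← h0]; simp
    · nlinarith
  have hAunit : ∀ Q ∈ A, IsUnit Q := by
    intro Q hQ
    rw [← Matrix.mulVec_injective_iff_isUnit]
    intro v w hvw
    have h := hAinj Q hQ (WithLp.toLp 2 (v - w))
    rw [Matrix.mulVec_sub, hvw, sub_self] at h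
    simp only [WithLp.toLp_zero, norm_zero] at h
    have h' : ‖(WithLp.toLp 2 (v - w) : EuclideanSpace ℝ (Fin l))‖ = 0 := by
      have := norm_nonneg (WithLp.toLp 2 (v - w) : EuclideanSpace ℝ (Fin l))
      nlinarith
    rw [norm_eq_zero] at h'
    exact sub_eq_zero.1 (congrArg WithLp.ofLp h')
  refine ⟨M ⁻¹' A, hG, ?_, fun y => if y ∈ M ⁻¹' A then Matrix.toEuclideanLin (M y)⁻¹ else 0,
    c⁻¹, by positivity, ?_, ?_, ?_⟩
  · have hae : ∀ᵐ x ∂m, ∀ i j, condGram m ψ x i j = M x.fst i j := by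
      rw [ae_all_iff]; intro i
      rw [ae_all_iff]; intro j
      exact condE1_ae_eq (Integrable.of_bound (hentry i j).aestronglyMeasurable _
        (.of_forall (hentryK i j)))
    filter_upwards [hae, hgram] with x hx hpos v
    have e : condGram m ψ x = M x.fst := by ext i j; exact hx i j
    have h := hpos.dotProduct_mulVec_nonneg v
    rw [e, Matrix.sub_mulVec, Matrix.smul_mulVec, Matrix.one_mulVec, dotProduct_sub,
      dotProduct_smul] at h
    have h3 : star v ⬝ᵥ v = ∑ i, v i ^ 2 := by simp [dotProduct, sq]
    rw [h3] at h
    simpa using h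
  · intro y v
    by_cases hy : y ∈ M ⁻¹' A
    · simp only [hy, if_true]
      have h := hAinj _ hy (Matrix.toEuclideanLin (M y)⁻¹ v)
      have e : (M y).mulVec (Matrix.toEuclideanLin (M y)⁻¹ v) = WithLp.ofLp v := by
        change (M y).mulVec ((M y)⁻¹.mulVec (WithLp.ofLp v)) = _
        rw [Matrix.mulVec_mulVec,
          Matrix.mul_nonsing_inv _ ((Matrix.isUnit_iff_isUnit_det _).1 (hAunit _ hy)),
          Matrix.one_mulVec]
      rw [e] at h
      rw [inv_mul_eq_div, le_div_iff₀ hc, mul_comm]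
      exact h
    · simp only [hy, if_false, LinearMap.zero_apply, norm_zero]
      positivity
  · intro g hg
    -- By Cramer's rule the entries of the inverse are quotients of polynomials in the entries of `M
    -- y`.
    have hinv : ∀ i j, Measurable fun y => (M y)⁻¹ i j := by
      intro i j
      simp only [Matrix.inv_def, Ring.inverse_eq_inv', Matrix.smul_apply, smul_eq_mul]
      have h1 : Continuous fun Q : Matrix (Fin l) (Fin l) ℝ => Q.det := by fun_prop
      have h2 : Continuous fun Q : Matrix (Fin l) (Fin l) ℝ => Q.adjugate i j :=
        (Continuous.matrix_adjugate continuous_id).matrix_elem i j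
      exact (h1.measurable.comp hMm).inv.mul (h2.measurable.comp hMm)
    have hmul : Measurable fun y => Matrix.toEuclideanLin (M y)⁻¹ (g y) := by
      have : (fun y => Matrix.toEuclideanLin (M y)⁻¹ (g y)) =
          fun y => WithLp.toLp 2 fun i => ∑ j, (M y)⁻¹ i j * g y j := by
        funext y
        ext i
        simp [Matrix.mulVec, dotProduct]
      rw [this]
      refine (WithLp.measurable_toLp 2 _).comp (measurable_pi_lambda _ fun i => ?_)
      refine Finset.measurable_fun_sum _ fun j _ => (hinv i j).mul ?_
      exact (EuclideanSpace.proj j : EuclideanSpace ℝ (Fin l) →L[ℝ] ℝ).continuous.measurable.comp hg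
    have : (fun y => (if y ∈ M ⁻¹' A then Matrix.toEuclideanLin (M y)⁻¹ else 0 :
        EuclideanSpace ℝ (Fin l) →ₗ[ℝ] EuclideanSpace ℝ (Fin l)) (g y)) =
        (M ⁻¹' A).indicator fun y => Matrix.toEuclideanLin (M y)⁻¹ (g y) := by
      funext y
      by_cases hy : y ∈ M ⁻¹' A <;> simp only [hy, if_true, if_false, Set.indicator_of_mem,
        Set.indicator_of_notMem, not_false_eq_true, LinearMap.zero_apply]
    rw [this]
    exact hmul.indicator hG
  · intro y hy v
    simp only [hy, if_true]
    set w := Matrix.toEuclideanLin (M y)⁻¹ v with hw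
    have e : (M y).mulVec w = WithLp.ofLp v := by
      change (M y).mulVec ((M y)⁻¹.mulVec (WithLp.ofLp v)) = _
      rw [Matrix.mulVec_mulVec,
        Matrix.mul_nonsing_inv _ ((Matrix.isUnit_iff_isUnit_det _).1 (hAunit _ hy)),
        Matrix.one_mulVec]
    have hterm : ∀ x, mulV (jac2 ψ x) (tmulV (jac2 ψ x) w) =
        ∑ j, w j • (WithLp.toLp 2 fun i => mulT (jac2 ψ x) (jac2 ψ x) i j :
          EuclideanSpace ℝ (Fin l)) := by
      intro x
      ext i
      simp [mulV, tmulV, inner_sum, inner_smul_right, mulT, Finset.sum_apply]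
    ext i
    have hi : Integrable (fun z => mulV (jac2 ψ (WithLp.toLp 2 (y, z)))
        (tmulV (jac2 ψ (WithLp.toLp 2 (y, z))) w)) (condLaw m y) := by
      simp only [hterm]
      refine integrable_finsetSum _ fun j _ => ?_
      refine Integrable.smul (w j) ?_
      refine (EuclideanSpace.equiv (Fin l) ℝ).symm.toContinuousLinearMap.integrable_comp
        (φ := fun z => fun i => mulT (jac2 ψ (WithLp.toLp 2 (y, z)))
          (jac2 ψ (WithLp.toLp 2 (y, z))) i j) ?_
      exact Integrable.of_eval fun i => integrable_slice (hentry i j) (hentryK i j) y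
    have e1 : kerE m (fun x => mulV (jac2 ψ x) (tmulV (jac2 ψ x) w)) y i =
        ∫ z, (mulV (jac2 ψ (WithLp.toLp 2 (y, z)))
          (tmulV (jac2 ψ (WithLp.toLp 2 (y, z))) w)) i ∂condLaw m y :=
      ((EuclideanSpace.proj i : EuclideanSpace ℝ (Fin l) →L[ℝ] ℝ).integral_comp_comm hi).symm
    rw [e1, ← congrFun e i]
    simp only [Matrix.mulVec, dotProduct, hM, Matrix.of_apply, kerE, ← integral_mul_const]
    rw [← integral_finsetSum _ fun j _ =>
      (integrable_slice (hentry i j) (hentryK i j) y).mul_const _]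
    refine integral_congr_ae (.of_forall fun z => ?_)
    simp [mulV, tmulV, inner_sum, inner_smul_right, mulT, mul_comm]

end Gram

/-! ### The adapted gradient acting on adapted fields. -/

section AdaptedGradient

variable {d n : ℕ} {m : Measure (X d)} {u : X d → EuclideanSpace ℝ (Fin n)}

theorem inner_toLp_fst (q : X d) (v : S d) :
    inner ℝ q (WithLp.toLp 2 (v, 0) : X d) = inner ℝ q.fst v := by
  rw [WithLp.prod_inner_apply]
  simp

theorem inner_toLp_snd (q : X d) (v : S d) :
    inner ℝ q (WithLp.toLp 2 (0, v) : X d) = inner ℝ q.snd v := by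
  rw [WithLp.prod_inner_apply]
  simp

theorem norm_toLp_fst (v : S d) : ‖(WithLp.toLp 2 (v, 0) : X d)‖ = ‖v‖ := by
  simp

theorem norm_toLp_snd (v : S d) : ‖(WithLp.toLp 2 (0, v) : X d)‖ = ‖v‖ := by
  simp

theorem integrable_fderiv_apply (hu : ContDiff ℝ 1 u) (hui : Integrable (fderiv ℝ u) m)
    {U : X d → X d} (hU : Measurable U) {K : ℝ} (hK : ∀ x, ‖U x‖ ≤ K) :
    Integrable (fun x => fderiv ℝ u x (U x)) m :=
  Integrable.mono' (hui.norm.mul_const K) (aestronglyMeasurable_fderiv_apply hu hU)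
    (.of_forall fun x => (ContinuousLinearMap.le_opNorm _ _).trans (by gcongr; exact hK x))

theorem integrable_jac (hu : ContDiff ℝ 1 u) (hui : Integrable (fderiv ℝ u) m) (i : Fin n) :
    Integrable (fun x => jac u x i) m :=
  hui.mono (continuous_jac hu i).aestronglyMeasurable
    (.of_forall fun x => norm_jac_le (hu.differentiable (by simp) x) i)

theorem continuous_withLp_fst : Continuous fun x : X d => x.fst := by fun_prop

theorem continuous_withLp_snd : Continuous fun x : X d => x.snd := by fun_prop

theorem integrable_withLp_fst {f : X d → X d} (hf : Integrable f m) :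
    Integrable (fun x => (f x).fst) m :=
  hf.mono (continuous_withLp_fst.comp_aestronglyMeasurable hf.1)
    (.of_forall fun x => WithLp.norm_fst_le (S d) (f x))

theorem integrable_withLp_snd {f : X d → X d} (hf : Integrable f m) :
    Integrable (fun x => (f x).snd) m :=
  hf.mono (continuous_withLp_snd.comp_aestronglyMeasurable hf.1)
    (.of_forall fun x => WithLp.norm_snd_le (S d) (f x))

variable [IsProbabilityMeasure m]

/-- As `Θ₁` depends on `x₁` only, it can be moved inside the conditional expectation of `∂_{x₁} u`.
-/
theorem mulV_grad_adapted_ae_eq (hu : ContDiff ℝ 1 u) (hui : Integrable (fderiv ℝ u) m)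
    {Θ : X d → X d} {Θ₁ : S d → S d} {Θ₂ : X d → S d}
    (hΘ : ∀ x, Θ x = WithLp.toLp 2 (Θ₁ x.fst, Θ₂ x)) (hΘ₁ : Measurable Θ₁) {K : ℝ}
    (hK : ∀ y, ‖Θ₁ y‖ ≤ K) :
    (fun x => mulV (grad .adapted m u x) (Θ x)) =ᵐ[m] fun x =>
      kerE m (fun x => fderiv ℝ u x (WithLp.toLp 2 (Θ₁ x.fst, 0))) x.fst +
        fderiv ℝ u x (WithLp.toLp 2 (0, Θ₂ x)) := by
  have hd : ∀ x, DifferentiableAt ℝ u x := hu.differentiable (by simp)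
  have hA : Integrable (fun x => fderiv ℝ u x (WithLp.toLp 2 (Θ₁ x.fst, 0))) m :=
    integrable_fderiv_apply hu hui (by fun_prop) (fun x => (norm_toLp_fst _).trans_le (hK x.fst))
  have hj := fun i => integrable_withLp_fst (integrable_jac hu hui i)
  filter_upwards [ae_all_iff.2 fun i => condE1_ae_eq (hj i),
    ae_all_iff.2 fun i => ae_integrable_slice (hj i), ae_integrable_slice hA] with x h1 h2 h3
  ext i
  have e1 : kerE m (fun x => fderiv ℝ u x (WithLp.toLp 2 (Θ₁ x.fst, 0))) x.fst i =
      inner ℝ (kerE m (fun x => (jac u x i).fst) x.fst) (Θ₁ x.fst) := by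
    rw [real_inner_comm]
    simp only [kerE]
    rw [← integral_inner (h2 i)]
    refine ((EuclideanSpace.proj i : EuclideanSpace ℝ (Fin n) →L[ℝ] ℝ).integral_comp_comm
      h3).symm.trans ?_
    refine integral_congr_ae (.of_forall fun z => ?_)
    simp only [EuclideanSpace.coe_proj]
    rw [← inner_jac (hd _), inner_toLp_fst, real_inner_comm]
    rfl
  rw [PiLp.add_apply, e1, ← inner_jac (hd _), inner_toLp_snd]
  simp only [mulV, grad, hΘ, h1 i]
  rw [WithLp.prod_inner_apply]

/-- By the tower property, adapted fields do not distinguish the adapted gradient from the full one.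
The operators of the theorem thus become plain directional derivatives. -/
theorem integral_mulV_grad_adapted (hu : ContDiff ℝ 1 u) (hui : Integrable (fderiv ℝ u) m)
    {Θ : X d → X d} {Θ₁ : S d → S d} {Θ₂ : X d → S d}
    (hΘ : ∀ x, Θ x = WithLp.toLp 2 (Θ₁ x.fst, Θ₂ x)) (hΘ₁ : Measurable Θ₁) (hΘ₂ : Measurable Θ₂)
    {K : ℝ} (hK₁ : ∀ y, ‖Θ₁ y‖ ≤ K) (hK₂ : ∀ x, ‖Θ₂ x‖ ≤ K) :
    ∫ x, mulV (grad .adapted m u x) (Θ x) ∂m = ∫ x, fderiv ℝ u x (Θ x) ∂m := by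
  have hA : Integrable (fun x => fderiv ℝ u x (WithLp.toLp 2 (Θ₁ x.fst, 0))) m :=
    integrable_fderiv_apply hu hui (by fun_prop) (fun x => (norm_toLp_fst _).trans_le (hK₁ x.fst))
  have hB : Integrable (fun x => fderiv ℝ u x (WithLp.toLp 2 (0, Θ₂ x))) m :=
    integrable_fderiv_apply hu hui (by fun_prop) (fun x => (norm_toLp_snd _).trans_le (hK₂ x))
  rw [integral_congr_ae (mulV_grad_adapted_ae_eq hu hui hΘ hΘ₁ hK₁),
    integral_add (integrable_kerE hA) hB, integral_kerE hA, ← integral_add hA hB]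
  refine integral_congr_ae (.of_forall fun x => ?_)
  simp only [← map_add, hΘ, ← WithLp.toLp_add]
  simp

theorem condE1_mulV_grad_adapted (hu : ContDiff ℝ 1 u) (hui : Integrable (fderiv ℝ u) m)
    {Θ : X d → X d} {Θ₁ : S d → S d} {Θ₂ : X d → S d}
    (hΘ : ∀ x, Θ x = WithLp.toLp 2 (Θ₁ x.fst, Θ₂ x)) (hΘ₁ : Measurable Θ₁) (hΘ₂ : Measurable Θ₂)
    {K : ℝ} (hK₁ : ∀ y, ‖Θ₁ y‖ ≤ K) (hK₂ : ∀ x, ‖Θ₂ x‖ ≤ K) :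
    condE1 m (fun x => mulV (grad .adapted m u x) (Θ x)) =ᵐ[m]
      fun x => kerE m (fun x => fderiv ℝ u x (Θ x)) x.fst := by
  have hA : Integrable (fun x => fderiv ℝ u x (WithLp.toLp 2 (Θ₁ x.fst, 0))) m :=
    integrable_fderiv_apply hu hui (by fun_prop) (fun x => (norm_toLp_fst _).trans_le (hK₁ x.fst))
  have hB : Integrable (fun x => fderiv ℝ u x (WithLp.toLp 2 (0, Θ₂ x))) m :=
    integrable_fderiv_apply hu hui (by fun_prop) (fun x => (norm_toLp_snd _).trans_le (hK₂ x))
  have h1 := condExp_congr_ae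
    (m := MeasurableSpace.comap (fun x : X d => x.fst) inferInstance)
    (mulV_grad_adapted_ae_eq hu hui hΘ hΘ₁ hK₁)
  refine h1.trans ((condE1_ae_eq ((integrable_kerE hA).add hB)).trans ?_)
  filter_upwards [ae_integrable_slice hA, ae_integrable_slice hB] with x hxA hxB
  refine (integral_add (f := fun _ => kerE m
    (fun x => fderiv ℝ u x (WithLp.toLp 2 (Θ₁ x.fst, 0))) x.fst) (integrable_const _) hxB).trans ?_
  rw [integral_const, probReal_univ, one_smul]
  refine (integral_add hxA hxB).symm.trans ?_
  refine integral_congr_ae (.of_forall fun z => ?_)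
  simp only [← map_add, hΘ, ← WithLp.toLp_add]
  simp

end AdaptedGradient

/-! ### Vertical fields that solve the conditional constraint. -/

section VerticalFields

variable {d l : ℕ} {ψ : X d → EuclideanSpace ℝ (Fin l)}
  {P : S d → EuclideanSpace ℝ (Fin l) →ₗ[ℝ] EuclideanSpace ℝ (Fin l)}

/-- The vertical vector field `(0, (∂_{x₂} ψ)ᵀ P g)`. -/
noncomputable def vertical (ψ : X d → EuclideanSpace ℝ (Fin l))
    (P : S d → EuclideanSpace ℝ (Fin l) →ₗ[ℝ] EuclideanSpace ℝ (Fin l))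
    (g : S d → EuclideanSpace ℝ (Fin l)) (x : X d) : X d :=
  WithLp.toLp 2 (0, tmulV (jac2 ψ x) (P x.fst (g x.fst)))

theorem vertical_fst (g : S d → EuclideanSpace ℝ (Fin l)) (x : X d) :
    (vertical ψ P g x).fst = 0 := rfl

theorem tmulV_add {E : Type*} [NormedAddCommGroup E] [InnerProductSpace ℝ E] (A : Fin l → E)
    (c c' : EuclideanSpace ℝ (Fin l)) : tmulV A (c + c') = tmulV A c + tmulV A c' := by
  simp [tmulV, add_smul, Finset.sum_add_distrib]

theorem tmulV_smul {E : Type*} [NormedAddCommGroup E] [InnerProductSpace ℝ E] (A : Fin l → E)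
    (a : ℝ) (c : EuclideanSpace ℝ (Fin l)) : tmulV A (a • c) = a • tmulV A c := by
  simp [tmulV, mul_smul, Finset.smul_sum]

theorem tmulV_sub {E : Type*} [NormedAddCommGroup E] [InnerProductSpace ℝ E] (A : Fin l → E)
    (c c' : EuclideanSpace ℝ (Fin l)) : tmulV A (c - c') = tmulV A c - tmulV A c' := by
  simp [tmulV, sub_smul, Finset.sum_sub_distrib]

theorem vertical_add (g g' : S d → EuclideanSpace ℝ (Fin l)) (x : X d) :
    vertical ψ P (fun y => g y + g' y) x = vertical ψ P g x + vertical ψ P g' x := by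
  simp only [vertical, map_add, tmulV_add, ← WithLp.toLp_add, Prod.mk_add_mk, add_zero]

theorem vertical_sub (g g' : S d → EuclideanSpace ℝ (Fin l)) (x : X d) :
    vertical ψ P (fun y => g y - g' y) x = vertical ψ P g x - vertical ψ P g' x := by
  simp only [vertical, map_sub, tmulV_sub, ← WithLp.toLp_sub, Prod.mk_sub_mk, sub_zero]

theorem vertical_smul (a : ℝ) (g : S d → EuclideanSpace ℝ (Fin l)) (x : X d) :
    vertical ψ P (fun y => a • g y) x = a • vertical ψ P g x := by
  simp only [vertical, map_smul, tmulV_smul, ← WithLp.toLp_smul, Prod.smul_mk, smul_zero]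

theorem continuous_jac2 (hψ : ContDiff ℝ 1 ψ) (i : Fin l) : Continuous fun x => jac2 ψ x i :=
  continuous_withLp_snd.comp (continuous_jac hψ i)

theorem norm_jac2_le (hψ : ContDiff ℝ 1 ψ) (i : Fin l) (x : X d) :
    ‖jac2 ψ x i‖ ≤ ‖fderiv ℝ ψ x‖ :=
  (WithLp.norm_snd_le (S d) _).trans (norm_jac_le (hψ.differentiable (by simp) x) i)

theorem measurable_vertical (hψ : ContDiff ℝ 1 ψ)
    (hPm : ∀ g : S d → EuclideanSpace ℝ (Fin l), Measurable g → Measurable fun y => P y (g y))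
    {g : S d → EuclideanSpace ℝ (Fin l)} (hg : Measurable g) : Measurable (vertical ψ P g) := by
  have h1 : Measurable fun x : X d => P x.fst (g x.fst) := (hPm g hg).comp measurable_fst
  have h2 : Measurable fun x : X d => tmulV (jac2 ψ x) (P x.fst (g x.fst)) := by
    refine Finset.measurable_fun_sum _ fun i _ => ?_
    exact ((EuclideanSpace.proj i : EuclideanSpace ℝ (Fin l) →L[ℝ] ℝ).continuous.measurable.comp
      h1).smul (continuous_jac2 hψ i).measurable
  unfold vertical
  fun_prop

theorem norm_vertical_le (hψ : ContDiff ℝ 1 ψ) {K : ℝ} (hK : ∀ x, ‖fderiv ℝ ψ x‖ ≤ K) {C : ℝ}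
    (hPC : ∀ y v, ‖P y v‖ ≤ C * ‖v‖) (g : S d → EuclideanSpace ℝ (Fin l)) (x : X d) :
    ‖vertical ψ P g x‖ ≤ l * K * C * ‖g x.fst‖ := by
  have hK0 : 0 ≤ K := (norm_nonneg _).trans (hK 0)
  rw [vertical, norm_toLp_snd]
  refine (norm_tmulV_le (fun i => (norm_jac2_le hψ i x).trans (hK x)) _).trans ?_
  rw [mul_assoc (l * K : ℝ)]
  gcongr
  exact hPC _ _

/-- Vertical fields are a right inverse of the linearised conditional constraint: the factor
`(∂_{x₂}ψ)(∂_{x₂}ψ)ᵀ` averages to the Gram matrix, which `P` inverts. -/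
theorem kerE_fderiv_vertical {m : Measure (X d)} [IsProbabilityMeasure m] (hψ : ContDiff ℝ 1 ψ)
    {y : S d}
    (hP : ∀ v, kerE m (fun x => mulV (jac2 ψ x) (tmulV (jac2 ψ x) (P y v))) y = v)
    (g : S d → EuclideanSpace ℝ (Fin l)) :
    kerE m (fun x => fderiv ℝ ψ x (vertical ψ P g x)) y = g y := by
  rw [← hP (g y)]
  simp only [vertical, fderiv_apply_snd (hψ.differentiable (by simp) _)]
  rfl

end VerticalFields

/-! ### Duality on the kernel of the linearised conditional constraint. -/

section AdaptedFields

variable {d k l : ℕ} {p : ℝ} {φ : Pp d p → EuclideanSpace ℝ (Fin k)}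
  {D : Pp d p → X d → EuclideanSpace ℝ (Fin k)} {ψ : X d → EuclideanSpace ℝ (Fin l)}
  {P : S d → EuclideanSpace ℝ (Fin l) →ₗ[ℝ] EuclideanSpace ℝ (Fin l)}

theorem IsTestField.measurable {V : X d → X d} (h : IsTestField .adapted V) : Measurable V := by
  obtain ⟨V₁, V₂, h1, -, h2, -, h⟩ := h
  have := h1.continuous.measurable
  have := h2.continuous.measurable
  rw [show V = fun x => WithLp.toLp 2 (V₁ x.fst, V₂ x) from funext h]
  fun_prop

theorem IsTestField.exists_bound {V : X d → X d} (h : IsTestField .adapted V) :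
    ∃ K, ∀ x, ‖V x‖ ≤ K := by
  obtain ⟨V₁, V₂, h1, h1c, h2, h2c, h⟩ := h
  obtain ⟨K₁, hK₁⟩ := h1c.exists_bound_of_continuous h1.continuous
  obtain ⟨K₂, hK₂⟩ := h2c.exists_bound_of_continuous h2.continuous
  refine ⟨K₁ + K₂, fun x => ?_⟩
  have e : V x = WithLp.toLp 2 (V₁ x.fst, 0) + WithLp.toLp 2 (0, V₂ x) := by
    rw [h, ← WithLp.toLp_add]
    simp
  rw [e]
  refine (norm_add_le _ _).trans ?_
  rw [norm_toLp_fst, norm_toLp_snd]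
  exact add_le_add (hK₁ _) (hK₂ _)

/-- The adapted test fields form a vector space. -/
def adaptedFields (d : ℕ) : Submodule ℝ (X d → X d) where
  carrier := {V | IsTestField .adapted V}
  add_mem' := by
    rintro V V' ⟨V₁, V₂, h1, h1c, h2, h2c, h⟩ ⟨V₁', V₂', h1', h1c', h2', h2c', h'⟩
    refine ⟨V₁ + V₁', V₂ + V₂', h1.add h1', h1c.add h1c', h2.add h2', h2c.add h2c', fun x => ?_⟩
    simp only [Pi.add_apply, h, h', ← WithLp.toLp_add, Prod.mk_add_mk]
  zero_mem' := ⟨0, 0, contDiff_const, HasCompactSupport.zero, contDiff_const,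
    HasCompactSupport.zero, fun _ => rfl⟩
  smul_mem' := by
    rintro c V ⟨V₁, V₂, h1, h1c, h2, h2c, h⟩
    refine ⟨c • V₁, c • V₂, h1.const_smul c, h1c.smul_left (f := fun _ => c), h2.const_smul c,
      h2c.smul_left (f := fun _ => c), fun x => ?_⟩
    simp only [Pi.smul_apply, h, ← WithLp.toLp_smul, Prod.smul_mk]

/-- The projection `V - (0, (∂_{x₂} ψ)ᵀ P 𝔼_1[∂_x ψ V])` onto the kernel of the linearised
conditional constraint. -/
noncomputable def corrected (m : Measure (X d)) [IsFiniteMeasure m]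
    (ψ : X d → EuclideanSpace ℝ (Fin l))
    (P : S d → EuclideanSpace ℝ (Fin l) →ₗ[ℝ] EuclideanSpace ℝ (Fin l)) (V : X d → X d)
    (x : X d) : X d :=
  V x - vertical ψ P (kerE m fun x => fderiv ℝ ψ x (V x)) x

theorem tmulV_fst {n : ℕ} (A : Fin n → X d) (c : EuclideanSpace ℝ (Fin n)) :
    (tmulV A c).fst = tmulV (fun i => (A i).fst) c := by
  refine ext_inner_right ℝ fun v => ?_
  rw [← inner_toLp_fst, inner_tmulV, inner_tmulV]
  simp only [mulV, inner_toLp_fst]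

theorem tmulV_snd {n : ℕ} (A : Fin n → X d) (c : EuclideanSpace ℝ (Fin n)) :
    (tmulV A c).snd = tmulV (fun i => (A i).snd) c := by
  refine ext_inner_right ℝ fun v => ?_
  rw [← inner_toLp_snd, inner_tmulV, inner_tmulV]
  simp only [mulV, inner_toLp_snd]

variable {u : X d → EuclideanSpace ℝ (Fin k)}

theorem continuous_tmulV_jac2 (hu : ContDiff ℝ 1 u) (lam : EuclideanSpace ℝ (Fin k)) :
    Continuous fun x => tmulV (jac2 u x) lam :=
  continuous_finsetSum _ fun i _ => (continuous_jac2 hu i).const_smul (lam i)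

theorem stronglyMeasurable_cross (hψ : ContDiff ℝ 1 ψ) (hu : ContDiff ℝ 1 u)
    (lam : EuclideanSpace ℝ (Fin k)) :
    StronglyMeasurable fun x => mulV (jac2 ψ x) (tmulV (jac2 u x) lam) := by
  simp only [← fderiv_apply_snd (hψ.differentiable (by simp) _)]
  have := (continuous_tmulV_jac2 hu lam).measurable
  exact stronglyMeasurable_fderiv_apply hψ (by fun_prop)

variable {m : Measure (X d)}

theorem memLp_cross (hψ : ContDiff ℝ 1 ψ) {K : ℝ} (hK : ∀ x, ‖fderiv ℝ ψ x‖ ≤ K)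
    (hu : ContDiff ℝ 1 u) {q : ℝ≥0∞} (huq : MemLp (fderiv ℝ u) q m)
    (lam : EuclideanSpace ℝ (Fin k)) :
    MemLp (fun x => mulV (jac2 ψ x) (tmulV (jac2 u x) lam)) q m := by
  refine huq.of_le_mul (c := K * (k * ‖lam‖))
    (stronglyMeasurable_cross hψ hu lam).aestronglyMeasurable (.of_forall fun x => ?_)
  have hK0 : 0 ≤ K := (norm_nonneg _).trans (hK 0)
  rw [← fderiv_apply_snd (hψ.differentiable (by simp) _)]
  refine (ContinuousLinearMap.le_opNorm _ _).trans ?_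
  rw [norm_toLp_snd]
  calc _ ≤ K * (k * ‖fderiv ℝ u x‖ * ‖lam‖) := by
        gcongr
        · exact hK x
        · exact norm_tmulV_le (fun i => norm_jac2_le hu i x) lam
    _ = _ := by ring

variable [IsProbabilityMeasure m]

theorem norm_fderiv_apply_le {K B : ℝ} (hK : ∀ x, ‖fderiv ℝ ψ x‖ ≤ K) {V : X d → X d}
    (hB : ∀ x, ‖V x‖ ≤ B) (x : X d) : ‖fderiv ℝ ψ x (V x)‖ ≤ K * B :=
  (ContinuousLinearMap.le_opNorm _ _).trans (mul_le_mul (hK x) (hB x) (norm_nonneg _)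
    ((norm_nonneg _).trans (hK x)))

theorem measurable_corrected (hψ : ContDiff ℝ 1 ψ)
    (hPm : ∀ g : S d → EuclideanSpace ℝ (Fin l), Measurable g → Measurable fun y => P y (g y))
    {V : X d → X d} (hV : Measurable V) : Measurable (corrected m ψ P V) :=
  hV.sub (measurable_vertical hψ hPm
    (stronglyMeasurable_kerE (stronglyMeasurable_fderiv_apply hψ hV)).measurable)

theorem norm_corrected_le (hψ : ContDiff ℝ 1 ψ) {K : ℝ} (hK : ∀ x, ‖fderiv ℝ ψ x‖ ≤ K) {C : ℝ}
    (hC : 0 ≤ C) (hPC : ∀ y v, ‖P y v‖ ≤ C * ‖v‖) {V : X d → X d} {B : ℝ} (hB : ∀ x, ‖V x‖ ≤ B)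
    (x : X d) : ‖corrected m ψ P V x‖ ≤ B + l * K * C * (K * B) := by
  have hK0 : 0 ≤ K := (norm_nonneg _).trans (hK 0)
  refine (norm_sub_le _ _).trans (add_le_add (hB x) ?_)
  refine (norm_vertical_le hψ hK hPC _ x).trans ?_
  gcongr
  exact norm_kerE_le (norm_fderiv_apply_le hK hB) _

theorem kerE_fderiv_corrected (hψ : ContDiff ℝ 1 ψ) {K : ℝ} (hK : ∀ x, ‖fderiv ℝ ψ x‖ ≤ K)
    {C : ℝ} (hC : 0 ≤ C) (hPC : ∀ y v, ‖P y v‖ ≤ C * ‖v‖)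
    (hPm : ∀ g : S d → EuclideanSpace ℝ (Fin l), Measurable g → Measurable fun y => P y (g y))
    {y : S d} (hP : ∀ v, kerE m (fun x => mulV (jac2 ψ x) (tmulV (jac2 ψ x) (P y v))) y = v)
    {V : X d → X d} (hV : Measurable V) {B : ℝ} (hB : ∀ x, ‖V x‖ ≤ B) :
    kerE m (fun x => fderiv ℝ ψ x (corrected m ψ P V x)) y = 0 := by
  have hK0 : 0 ≤ K := (norm_nonneg _).trans (hK 0)
  have hg : Measurable (kerE m fun x => fderiv ℝ ψ x (V x)) :=
    (stronglyMeasurable_kerE (stronglyMeasurable_fderiv_apply hψ hV)).measurable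
  have hvb : ∀ x, ‖vertical ψ P (kerE m fun x => fderiv ℝ ψ x (V x)) x‖ ≤
      l * K * C * (K * B) := fun x => (norm_vertical_le hψ hK hPC _ x).trans (by
    gcongr
    exact norm_kerE_le (norm_fderiv_apply_le hK hB) _)
  simp only [corrected, map_sub]
  rw [kerE_sub (stronglyMeasurable_fderiv_apply hψ hV) (norm_fderiv_apply_le hK hB)
    (stronglyMeasurable_fderiv_apply hψ (measurable_vertical hψ hPm hg))
    (norm_fderiv_apply_le hK hvb), kerE_fderiv_vertical hψ hP, sub_self]

/-- The density `h` with `𝔼[λ · (∂_x u)(0, (∂_{x₂} ψ)ᵀ P g)] = 𝔼[h(X₁) · g(X₁)]`. -/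
noncomputable def dualDensity (m : Measure (X d)) [IsFiniteMeasure m]
    (ψ : X d → EuclideanSpace ℝ (Fin l))
    (P : S d → EuclideanSpace ℝ (Fin l) →ₗ[ℝ] EuclideanSpace ℝ (Fin l))
    (u : X d → EuclideanSpace ℝ (Fin k)) (lam : EuclideanSpace ℝ (Fin k)) (y : S d) :
    EuclideanSpace ℝ (Fin l) :=
  WithLp.toLp 2 fun i => inner ℝ (kerE m (fun x => mulV (jac2 ψ x) (tmulV (jac2 u x) lam)) y)
    (P y (EuclideanSpace.single i 1))

theorem inner_dualDensity (u : X d → EuclideanSpace ℝ (Fin k)) (lam : EuclideanSpace ℝ (Fin k))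
    (y : S d) (v : EuclideanSpace ℝ (Fin l)) :
    inner ℝ (dualDensity m ψ P u lam y) v =
      inner ℝ (kerE m (fun x => mulV (jac2 ψ x) (tmulV (jac2 u x) lam)) y) (P y v) := by
  conv_rhs => rw [← sum_smul_single_one v]
  simp [dualDensity, PiLp.inner_apply, inner_sum, inner_smul_right, map_sum]

theorem norm_dualDensity_le {C : ℝ} (hC : 0 ≤ C) (hPC : ∀ y v, ‖P y v‖ ≤ C * ‖v‖)
    (u : X d → EuclideanSpace ℝ (Fin k)) (lam : EuclideanSpace ℝ (Fin k)) (y : S d) :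
    ‖dualDensity m ψ P u lam y‖ ≤
      C * ‖kerE m (fun x => mulV (jac2 ψ x) (tmulV (jac2 u x) lam)) y‖ := by
  set h := dualDensity m ψ P u lam y
  set b := kerE m (fun x => mulV (jac2 ψ x) (tmulV (jac2 u x) lam)) y
  -- The duality formula is tested with `v = h` itself.
  have h1 : ‖h‖ * ‖h‖ ≤ ‖b‖ * (C * ‖h‖) := by
    rw [← real_inner_self_eq_norm_mul_norm, inner_dualDensity]
    exact (real_inner_le_norm _ _).trans (by gcongr; exact hPC _ _)
  rcases (norm_nonneg h).eq_or_lt with h0 | h0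
  · rw [← h0]
    positivity
  · nlinarith

theorem measurable_dualDensity (hψ : ContDiff ℝ 1 ψ) (hu : ContDiff ℝ 1 u)
    (hPm : ∀ g : S d → EuclideanSpace ℝ (Fin l), Measurable g → Measurable fun y => P y (g y))
    (lam : EuclideanSpace ℝ (Fin k)) : Measurable (dualDensity m ψ P u lam) := by
  refine (WithLp.measurable_toLp 2 _).comp (measurable_pi_lambda _ fun i => ?_)
  exact (stronglyMeasurable_kerE (stronglyMeasurable_cross hψ hu lam)).measurable.inner
    (hPm _ measurable_const)

theorem memLp_dualDensity (hψ : ContDiff ℝ 1 ψ) {K : ℝ} (hK : ∀ x, ‖fderiv ℝ ψ x‖ ≤ K)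
    (hu : ContDiff ℝ 1 u) {q : ℝ≥0∞} (hq : 1 ≤ q) (huq : MemLp (fderiv ℝ u) q m)
    {C : ℝ} (hC : 0 ≤ C) (hPC : ∀ y v, ‖P y v‖ ≤ C * ‖v‖)
    (hPm : ∀ g : S d → EuclideanSpace ℝ (Fin l), Measurable g → Measurable fun y => P y (g y))
    (lam : EuclideanSpace ℝ (Fin k)) :
    MemLp (fun x : X d => dualDensity m ψ P u lam x.fst) q m := by
  have hb := memLp_cross hψ hK hu huq lam
  have h1 : MemLp (fun x : X d =>
      kerE m (fun x => mulV (jac2 ψ x) (tmulV (jac2 u x) lam)) x.fst) q m :=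
    (hb.condExp hq).ae_eq (condE1_ae_eq (hb.integrable hq))
  exact h1.of_le_mul (c := C)
    ((measurable_dualDensity hψ hu hPm lam).comp measurable_fst).aestronglyMeasurable
    (.of_forall fun x => norm_dualDensity_le hC hPC u lam x.fst)

/-- The gradient of the Lagrangian with multipliers `λ` and `-h`. -/
noncomputable def lagrangian (m : Measure (X d)) [IsFiniteMeasure m]
    (ψ : X d → EuclideanSpace ℝ (Fin l))
    (P : S d → EuclideanSpace ℝ (Fin l) →ₗ[ℝ] EuclideanSpace ℝ (Fin l))
    (u : X d → EuclideanSpace ℝ (Fin k)) (lam : EuclideanSpace ℝ (Fin k)) (x : X d) : X d :=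
  tmulV (jac u x) lam - tmulV (jac ψ x) (dualDensity m ψ P u lam x.fst)

theorem integrable_lagrangian (hψ : ContDiff ℝ 1 ψ) {K : ℝ} (hK : ∀ x, ‖fderiv ℝ ψ x‖ ≤ K)
    (hu : ContDiff ℝ 1 u) (hui : Integrable (fderiv ℝ u) m)
    {C : ℝ} (hC : 0 ≤ C) (hPC : ∀ y v, ‖P y v‖ ≤ C * ‖v‖)
    (hPm : ∀ g : S d → EuclideanSpace ℝ (Fin l), Measurable g → Measurable fun y => P y (g y))
    (lam : EuclideanSpace ℝ (Fin k)) : Integrable (lagrangian m ψ P u lam) m := by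
  refine Integrable.sub ?_ ?_
  · exact integrable_finsetSum _ fun i _ => (integrable_jac hu hui i).smul (lam i)
  · have h1 := (memLp_dualDensity (m := m) hψ hK hu le_rfl (memLp_one_iff_integrable.2 hui) hC hPC
      hPm lam).integrable le_rfl
    refine (h1.norm.const_mul (l * K)).mono' ?_ (.of_forall fun x =>
      norm_tmulV_le (fun i => (norm_jac_le (hψ.differentiable (by simp) x) i).trans (hK x)) _)
    refine Measurable.aestronglyMeasurable (Finset.measurable_fun_sum _ fun i _ => ?_)
    exact ((EuclideanSpace.proj i : EuclideanSpace ℝ (Fin l) →L[ℝ] ℝ).continuous.measurable.comp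
      ((measurable_dualDensity hψ hu hPm lam).comp measurable_fst)).smul
      (continuous_jac hψ i).measurable

/-- Computes the adjoint of the projection: it turns the gradient of `λ · u` into the gradient of
the Lagrangian, tested against the uncorrected field `V`. -/
theorem inner_integral_corrected (hψ : ContDiff ℝ 1 ψ) {K : ℝ} (hK : ∀ x, ‖fderiv ℝ ψ x‖ ≤ K)
    (hu : ContDiff ℝ 1 u) (hui : Integrable (fderiv ℝ u) m)
    {C : ℝ} (hC : 0 ≤ C) (hPC : ∀ y v, ‖P y v‖ ≤ C * ‖v‖)
    (hPm : ∀ g : S d → EuclideanSpace ℝ (Fin l), Measurable g → Measurable fun y => P y (g y))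
    (lam : EuclideanSpace ℝ (Fin k)) {V : X d → X d} (hV : Measurable V) {B : ℝ}
    (hB : ∀ x, ‖V x‖ ≤ B) :
    inner ℝ lam (∫ x, fderiv ℝ u x (corrected m ψ P V x) ∂m) =
      ∫ x, inner ℝ (lagrangian m ψ P u lam x) (V x) ∂m := by
  have hK0 : 0 ≤ K := (norm_nonneg _).trans (hK 0)
  have hud : ∀ x, DifferentiableAt ℝ u x := hu.differentiable (by simp)
  have hψd : ∀ x, DifferentiableAt ℝ ψ x := hψ.differentiable (by simp)
  set g := kerE m fun x => fderiv ℝ ψ x (V x) with hg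
  set h := dualDensity m ψ P u lam with hh
  set b := fun x => mulV (jac2 ψ x) (tmulV (jac2 u x) lam) with hb
  have hgm : Measurable g :=
    (stronglyMeasurable_kerE (stronglyMeasurable_fderiv_apply hψ hV)).measurable
  have hgB : ∀ y, ‖g y‖ ≤ K * B := norm_kerE_le (norm_fderiv_apply_le hK hB)
  have hi1 : Integrable (fun x => fderiv ℝ u x (V x)) m := integrable_fderiv_apply hu hui hV hB
  have hi2 : Integrable (fun x => fderiv ℝ u x (vertical ψ P g x)) m := by
    refine integrable_fderiv_apply hu hui (measurable_vertical hψ hPm hgm)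
      (K := l * K * C * (K * B)) fun x => (norm_vertical_le hψ hK hPC g x).trans ?_
    gcongr
    exact hgB _
  have hbi : Integrable b m :=
    (memLp_cross hψ hK hu (memLp_one_iff_integrable.2 hui) lam).integrable le_rfl
  have hhi : Integrable (fun x : X d => h x.fst) m :=
    (memLp_dualDensity hψ hK hu le_rfl (memLp_one_iff_integrable.2 hui) hC hPC hPm
      lam).integrable le_rfl
  have hψV : Integrable (fun x => fderiv ℝ ψ x (V x)) m :=
    Integrable.of_bound (stronglyMeasurable_fderiv_apply hψ hV).aestronglyMeasurable _
      (.of_forall (norm_fderiv_apply_le hK hB))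
  have hPg : Integrable (fun x : X d => inner ℝ (P x.fst (g x.fst)) (b x)) m := by
    refine (hbi.norm.const_mul (C * (K * B))).mono' ?_ (.of_forall fun x => ?_)
    · exact ((hPm g hgm).comp measurable_fst).aestronglyMeasurable.inner hbi.1
    · refine (norm_inner_le_norm _ _).trans ?_
      gcongr
      refine (hPC _ _).trans ?_
      gcongr
      exact hgB _
  have hhV : Integrable (fun x : X d => inner ℝ (h x.fst) (fderiv ℝ ψ x (V x))) m := by
    refine (hhi.norm.mul_const (K * B)).mono' (hhi.1.inner hψV.1) (.of_forall fun x => ?_)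
    refine (norm_inner_le_norm _ _).trans ?_
    gcongr
    exact norm_fderiv_apply_le hK hB x
  -- Both `P g` and `h` depend on `x₁` only, so a conditional expectation may be inserted or removed
  -- on the other factor.
  have e2 : ∫ x, inner ℝ lam (fderiv ℝ u x (vertical ψ P g x)) ∂m =
      ∫ x, inner ℝ (h x.fst) (fderiv ℝ ψ x (V x)) ∂m := by
    rw [← integral_inner_kerE hψV hhV]
    calc _ = ∫ x, inner ℝ (P x.fst (g x.fst)) (b x) ∂m := by
          refine integral_congr_ae (.of_forall fun x => ?_)
          simp only [vertical, fderiv_apply_snd (hud x)]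
          rw [← inner_tmulV, real_inner_comm, inner_tmulV]
      _ = ∫ x, inner ℝ (P x.fst (g x.fst)) (kerE m b x.fst) ∂m :=
          (integral_inner_kerE (a := fun y => P y (g y)) hbi hPg).symm
      _ = _ := by
          refine integral_congr_ae (.of_forall fun x => ?_)
          simp only [hh]
          rw [inner_dualDensity, real_inner_comm]
  simp only [corrected, map_sub]
  rw [integral_sub hi1 hi2, inner_sub_right, ← integral_inner hi1, ← integral_inner hi2, e2,
    ← integral_sub (hi1.const_inner lam) hhV]
  refine integral_congr_ae (.of_forall fun x => ?_)
  simp only [lagrangian]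
  rw [inner_sub_left, inner_tmulV, inner_tmulV, mulV_jac (hud x), mulV_jac (hψd x)]

/-- Vertical test fields see the whole second component of the Lagrangian gradient, while horizontal
ones, being functions of `x₁`, see only the conditional mean of the first. So it is exactly the
adapted gradient that vanishes, and nonredundancy applies with the multiplier `-h`. -/
theorem eq_zero_of_integral_lagrangian_eq_zero {q : ℝ≥0∞} (hq : 1 ≤ q) (hψ : ContDiff ℝ 1 ψ)
    {K : ℝ} (hK : ∀ x, ‖fderiv ℝ ψ x‖ ≤ K) (hu : ContDiff ℝ 1 u)
    (huq : MemLp (fderiv ℝ u) q m)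
    {C : ℝ} (hC : 0 ≤ C) (hPC : ∀ y v, ‖P y v‖ ≤ C * ‖v‖)
    (hPm : ∀ g : S d → EuclideanSpace ℝ (Fin l), Measurable g → Measurable fun y => P y (g y))
    (hnr : ∃ c > (0 : ℝ), ∀ (lam : EuclideanSpace ℝ (Fin k))
      (h : S d → EuclideanSpace ℝ (Fin l)), MemLp h q (m.map fun x => x.fst) →
      ENNReal.ofReal c * (‖lam‖ₑ + eLpNorm (fun x => h x.fst) q m) ≤
        eLpNorm (fun x => tmulV (grad .adapted m u x) lam + tmulV (grad .adapted m ψ x) (h x.fst))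
          q m)
    {lam : EuclideanSpace ℝ (Fin k)}
    (hlam : ∀ V, IsTestField .adapted V →
      ∫ x, inner ℝ (lagrangian m ψ P u lam x) (V x) ∂m = 0) : lam = 0 := by
  have hui : Integrable (fderiv ℝ u) m := huq.integrable hq
  have hψi : Integrable (fderiv ℝ ψ) m :=
    Integrable.of_bound (hψ.continuous_fderiv (by simp)).aestronglyMeasurable K (.of_forall hK)
  set h := dualDensity m ψ P u lam with hh
  set Q := lagrangian m ψ P u lam with hQ
  have hQi : Integrable Q m := integrable_lagrangian hψ hK hu hui hC hPC hPm lam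
  have hQ1 := integrable_withLp_fst hQi
  have hQ2 := integrable_withLp_snd hQi
  have hsnd : (fun x => (Q x).snd) =ᵐ[m] 0 := by
    refine ae_eq_zero_of_integral_inner_eq_zero hQ2 fun g e hg hgc => ?_
    rw [← hlam (fun x => WithLp.toLp 2 (0, g x • e)) ⟨0, fun x => g x • e, contDiff_const,
      HasCompactSupport.zero, hg.smul contDiff_const, hgc.smul_right, fun x => rfl⟩]
    refine integral_congr_ae (.of_forall fun x => ?_)
    simp only [inner_toLp_snd]
  have hfst : ∀ᵐ x ∂m, kerE m (fun x => (Q x).fst) x.fst = 0 := by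
    refine ae_of_ae_map measurable_fst.aemeasurable (p := fun y => kerE m (fun x => (Q x).fst) y = 0)
      ?_
    have hint : Integrable (kerE m fun x => (Q x).fst) (m.map fun x : X d => x.fst) :=
      (integrable_map_prod hQ1).integral_condDistrib_map measurable_snd.aemeasurable
    refine ae_eq_zero_of_integral_inner_eq_zero hint fun g e hg hgc => ?_
    have hgm := hg.continuous.measurable
    obtain ⟨B, hB⟩ := hgc.exists_bound_of_continuous hg.continuous
    rw [integral_map measurable_fst.aemeasurable (hint.1.inner (by fun_prop))]
    have hi : Integrable (fun x : X d => inner ℝ (g x.fst • e) (Q x).fst) m := by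
      refine (hQ1.norm.const_mul (B * ‖e‖)).mono'
        (AEStronglyMeasurable.inner (Measurable.aestronglyMeasurable (by fun_prop)) hQ1.1)
        (.of_forall fun x => ?_)
      refine (norm_inner_le_norm _ _).trans ?_
      gcongr
      rw [norm_smul]
      gcongr
      exact hB _
    have := integral_inner_kerE (a := fun y => g y • e) hQ1 hi
    simp only [real_inner_comm] at this ⊢
    rw [this, ← hlam (fun x => WithLp.toLp 2 (g x.fst • e, 0)) ⟨fun y => g y • e, 0,
      hg.smul contDiff_const, hgc.smul_right, contDiff_const, HasCompactSupport.zero,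
      fun x => rfl⟩]
    refine integral_congr_ae (.of_forall fun x => ?_)
    simp only [inner_toLp_fst, real_inner_comm]
  have hju := fun i => integrable_withLp_fst (integrable_jac hu hui i)
  have hjψ := fun i => integrable_withLp_fst (integrable_jac hψ hψi i)
  have hzero : (fun x => tmulV (grad .adapted m u x) lam +
      tmulV (grad .adapted m ψ x) (-h x.fst)) =ᵐ[m] 0 := by
    filter_upwards [hsnd, hfst, ae_all_iff.2 fun i => condE1_ae_eq (hju i),
      ae_all_iff.2 fun i => condE1_ae_eq (hjψ i), ae_all_iff.2 fun i => ae_integrable_slice (hju i),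
      ae_all_iff.2 fun i => ae_integrable_slice (hjψ i)] with x h2 h1 hcu hcψ hsu hsψ
    -- The multiplier is constant under the conditional law and comes out of the integral.
    have hfirst : ∑ i, lam i • kerE m (fun x => (jac u x i).fst) x.fst -
        ∑ i, h x.fst i • kerE m (fun x => (jac ψ x i).fst) x.fst = 0 := by
      rw [← h1]
      simp only [kerE, ← integral_smul]
      have hsu' : ∀ i, Integrable (fun z => lam i • (jac u (WithLp.toLp 2 (x.fst, z)) i).fst)
          (condLaw m x.fst) := fun i => (hsu i).smul (lam i)
      have hsψ' : ∀ i, Integrable (fun z => h x.fst i • (jac ψ (WithLp.toLp 2 (x.fst, z)) i).fst)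
          (condLaw m x.fst) := fun i => (hsψ i).smul (h x.fst i)
      rw [← integral_finsetSum _ fun i _ => hsu' i, ← integral_finsetSum _ fun i _ => hsψ' i,
        ← integral_sub (integrable_finsetSum _ fun i _ => hsu' i)
          (integrable_finsetSum _ fun i _ => hsψ' i)]
      refine integral_congr_ae (.of_forall fun z => ?_)
      simp only [hQ, lagrangian, WithLp.sub_fst, tmulV_fst]
      rfl
    have h2' : tmulV (fun i => (jac u x i).snd) lam -
        tmulV (fun i => (jac ψ x i).snd) (h x.fst) = 0 := by
      rw [← tmulV_snd, ← tmulV_snd, ← WithLp.sub_snd]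
      exact h2
    refine WithLp.ofLp_injective 2 (Prod.ext ?_ ?_)
    · change (tmulV (grad .adapted m u x) lam + tmulV (grad .adapted m ψ x) (-h x.fst)).fst = 0
      rw [WithLp.add_fst, tmulV_fst, tmulV_fst, ← hfirst]
      simp [tmulV, grad, hcu, hcψ, sub_eq_add_neg]
    · change (tmulV (grad .adapted m u x) lam + tmulV (grad .adapted m ψ x) (-h x.fst)).snd = 0
      rw [WithLp.add_snd, tmulV_snd, tmulV_snd, ← h2']
      simp [tmulV, grad, sub_eq_add_neg]
  obtain ⟨c, hc, hnr⟩ := hnr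
  have hmem : MemLp (fun y => -h y) q (m.map fun x : X d => x.fst) := by
    refine (memLp_map_measure_iff ?_ measurable_fst.aemeasurable).2 ?_
    · exact (measurable_dualDensity hψ hu hPm lam).neg.aestronglyMeasurable
    · exact (memLp_dualDensity hψ hK hu hq huq hC hPC hPm lam).neg
  have key := hnr lam (fun y => -h y) hmem
  rw [eLpNorm_congr_ae hzero, eLpNorm_zero, nonpos_iff_eq_zero, mul_eq_zero] at key
  rcases key with key | key
  · simp at key
    linarith
  · simpa using (add_eq_zero.1 key).1

/-- Projected test fields still reach every value of the derivative of `u`; the multiplier argument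
excludes an orthogonal direction. -/
theorem exists_adapted_fields {q : ℝ≥0∞} (hq : 1 ≤ q) (hψ : ContDiff ℝ 1 ψ)
    {K : ℝ} (hK : ∀ x, ‖fderiv ℝ ψ x‖ ≤ K) (hu : ContDiff ℝ 1 u)
    (huq : MemLp (fderiv ℝ u) q m)
    {C : ℝ} (hC : 0 ≤ C) (hPC : ∀ y v, ‖P y v‖ ≤ C * ‖v‖)
    (hPm : ∀ g : S d → EuclideanSpace ℝ (Fin l), Measurable g → Measurable fun y => P y (g y))
    (hnr : ∃ c > (0 : ℝ), ∀ (lam : EuclideanSpace ℝ (Fin k))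
      (h : S d → EuclideanSpace ℝ (Fin l)), MemLp h q (m.map fun x => x.fst) →
      ENNReal.ofReal c * (‖lam‖ₑ + eLpNorm (fun x => h x.fst) q m) ≤
        eLpNorm (fun x => tmulV (grad .adapted m u x) lam + tmulV (grad .adapted m ψ x) (h x.fst))
          q m) :
    ∃ V : Fin k → X d → X d, (∀ j, IsTestField .adapted (V j)) ∧
      ∀ j, ∫ x, fderiv ℝ u x (corrected m ψ P (V j) x) ∂m = EuclideanSpace.single j 1 := by
  have hui : Integrable (fderiv ℝ u) m := huq.integrable hq
  have hint : ∀ V : adaptedFields d,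
      Integrable (fun x => fderiv ℝ u x (corrected m ψ P V.1 x)) m := by
    intro V
    obtain ⟨B, hB⟩ := V.2.exists_bound
    exact integrable_fderiv_apply hu hui (measurable_corrected hψ hPm V.2.measurable)
      (norm_corrected_le hψ hK hC hPC hB)
  let L : adaptedFields d →ₗ[ℝ] EuclideanSpace ℝ (Fin k) :=
    { toFun := fun V => ∫ x, fderiv ℝ u x (corrected m ψ P V.1 x) ∂m
      map_add' := fun V V' => by
        rw [← integral_add (hint V) (hint V')]
        refine integral_congr_ae (.of_forall fun x => ?_)
        obtain ⟨B, hB⟩ := V.2.exists_bound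
        obtain ⟨B', hB'⟩ := V'.2.exists_bound
        have e : (kerE m fun x => fderiv ℝ ψ x ((V + V').1 x)) =
            fun y => kerE m (fun x => fderiv ℝ ψ x (V.1 x)) y +
              kerE m (fun x => fderiv ℝ ψ x (V'.1 x)) y := by
          funext y
          rw [← kerE_add (stronglyMeasurable_fderiv_apply hψ V.2.measurable)
            (norm_fderiv_apply_le hK hB) (stronglyMeasurable_fderiv_apply hψ V'.2.measurable)
            (norm_fderiv_apply_le hK hB')]
          simp
        simp only [corrected, e, vertical_add, ← map_add]
        congr 1
        simp only [Submodule.coe_add, Pi.add_apply]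
        abel
      map_smul' := fun c V => by
        rw [RingHom.id_apply, ← integral_smul]
        refine integral_congr_ae (.of_forall fun x => ?_)
        have e : (kerE m fun x => fderiv ℝ ψ x ((c • V).1 x)) =
            fun y => c • kerE m (fun x => fderiv ℝ ψ x (V.1 x)) y := by
          funext y
          simp [kerE, integral_smul]
        simp only [corrected, e, vertical_smul, ← map_smul]
        congr 1
        simp only [Submodule.coe_smul, Pi.smul_apply, smul_sub] }
  obtain ⟨V, hV⟩ := exists_preimage_single L fun lam hlam =>
    eq_zero_of_integral_lagrangian_eq_zero hq hψ hK hu huq hC hPC hPm hnr fun V hV => by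
      obtain ⟨B, hB⟩ := hV.exists_bound
      rw [← inner_integral_corrected hψ hK hu hui hC hPC hPm lam hV.measurable hB]
      exact hlam ⟨V, hV⟩
  exact ⟨fun j => (V j).1, fun j => (V j).2, hV⟩

end AdaptedFields

/-! ### The right inverse in the adapted case. -/

section AdaptedCorrection

variable {d k l : ℕ} {p : ℝ}

theorem lipschitz_bound_of_contDiff {f : S d → S d} (hf : ContDiff ℝ 1 f)
    (hc : HasCompactSupport f) : ∃ L : ℝ≥0, ∀ y y', ‖f y - f y'‖ ≤ L * ‖y - y'‖ := by
  obtain ⟨L, hL⟩ := ContDiff.lipschitzWith_of_hasCompactSupport hc hf (by simp)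
  exact ⟨L, fun y y' => by simpa [dist_eq_norm] using hL.dist_le_mul y y'⟩

theorem enorm_integral_fderiv_le (hp : 1 < p) {m : Measure (X d)}
    {u : X d → EuclideanSpace ℝ (Fin k)} (hu : ContDiff ℝ 1 u) {U : X d → X d}
    (hU : Measurable U) :
    ‖∫ x, fderiv ℝ u x (U x) ∂m‖ₑ ≤
      eLpNorm (fderiv ℝ u) (ENNReal.ofReal (conj p)) m * eLpNorm U (ENNReal.ofReal p) m := by
  have hpq : (conj p).HolderConjugate p := (Real.HolderConjugate.conjExponent hp).symm
  have : ENNReal.HolderTriple (ENNReal.ofReal (conj p)) (ENNReal.ofReal p) 1 := hpq.ennrealOfReal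
  refine (enorm_integral_le_lintegral_enorm _).trans ?_
  rw [← eLpNorm_one_eq_lintegral_enorm]
  have := eLpNorm_le_eLpNorm_mul_eLpNorm_of_nnnorm (p := ENNReal.ofReal (conj p))
    (q := ENNReal.ofReal p) (r := 1) (μ := m)
    (hu.continuous_fderiv (by simp)).aestronglyMeasurable hU.aestronglyMeasurable
    (fun (A : X d →L[ℝ] EuclideanSpace ℝ (Fin k)) v => A v) 1
    (.of_forall fun x => by
      rw [one_mul]
      exact ContinuousLinearMap.le_opNNNorm _ _)
  simpa using this

/-- In the adapted case, the linearised constraints have a bounded linear right inverse. -/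
theorem exists_adapted_correction (hp : 1 < p) {m : Measure (X d)} [IsProbabilityMeasure m]
    {u : X d → EuclideanSpace ℝ (Fin k)} (hu : ContDiff ℝ 1 u)
    (huq : MemLp (fderiv ℝ u) (ENNReal.ofReal (conj p)) m)
    {ψ : X d → EuclideanSpace ℝ (Fin l)} (hψ : ContDiff ℝ 1 ψ) {K : ℝ}
    (hK : ∀ x, ‖fderiv ℝ ψ x‖ ≤ K) (hA : AssumptionWad p m u ψ) :
    ∃ (G : Set (S d)) (T : EuclideanSpace ℝ (Fin k) ×
        boundedMeasurable (S d) (EuclideanSpace ℝ (Fin l)) → X d → X d) (B L : ℝ) (C : ℝ≥0),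
      MeasurableSet G ∧ (∀ᵐ x ∂m, x.fst ∈ G) ∧ 0 ≤ B ∧ 0 ≤ L ∧ (∀ z, Measurable (T z)) ∧
      (∀ z z' x, T (z - z') x = T z x - T z' x) ∧ (∀ z x, ‖T z x‖ ≤ B * ‖z‖) ∧
      (∀ z, ∫ x, fderiv ℝ u x (T z x) ∂m = z.1) ∧
      (∀ z, ∀ y ∈ G, kerE m (fun x => fderiv ℝ ψ x (T z x)) y = z.2.1 y) ∧
      (∀ z, ∃ τ : S d → S d, (∀ x, (T z x).fst = τ x.fst) ∧
        ∀ y y', ‖τ y - τ y'‖ ≤ L * ‖z‖ * ‖y - y'‖) ∧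
      ∀ z, eLpNorm (T z) (ENNReal.ofReal p) m ≤
        C * (‖z.1‖ₑ + eLpNorm (fun x : X d => z.2.1 x.fst) (ENNReal.ofReal p) m) := by
  have hK0 : 0 ≤ K := (norm_nonneg _).trans (hK 0)
  obtain ⟨G, hG, hGae, P, C, hC, hPC, hPm, hP⟩ := exists_gram_inverse hψ hK hA.gram
  obtain ⟨V, hV, hVe⟩ := exists_adapted_fields (one_le_ofReal_conj hp) hψ hK hu huq hC hPC hPm
    hA.nonredundant
  have hui : Integrable (fderiv ℝ u) m := huq.integrable (one_le_ofReal_conj hp)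
  choose B hB using fun j => (hV j).exists_bound
  have hV' := hV
  choose V₁ V₂ hV₁ hV₁c hV₂ hV₂c hVV using hV'
  choose L hL using fun j => lipschitz_bound_of_contDiff (hV₁ j) (hV₁c j)
  set W : Fin k → X d → X d := fun j => corrected m ψ P (V j) with hW
  have hWm : ∀ j, Measurable (W j) := fun j => measurable_corrected hψ hPm (hV j).measurable
  obtain ⟨b, hb0, hWb⟩ : ∃ b : ℝ, 0 ≤ b ∧ ∀ j x, ‖W j x‖ ≤ b := by
    have h1 := fun j => norm_corrected_le (m := m) hψ hK hC hPC (hB j)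
    have h0 : ∀ j, 0 ≤ B j + l * K * C * (K * B j) := fun j => (norm_nonneg _).trans (h1 j 0)
    exact ⟨∑ j, (B j + l * K * C * (K * B j)), Finset.sum_nonneg fun j _ => h0 j,
      fun j x => (h1 j x).trans (Finset.single_le_sum (fun j _ => h0 j) (Finset.mem_univ j))⟩
  have hWi : ∀ j, Integrable (fun x => fderiv ℝ u x (W j x)) m := fun j =>
    integrable_fderiv_apply hu hui (hWm j) (hWb j)
  set a : ℝ := l * K * C with ha
  have ha0 : 0 ≤ a := by positivity
  let 𝓑 := boundedMeasurable (S d) (EuclideanSpace ℝ (Fin l))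
  set R : 𝓑 → X d → X d := fun g => vertical ψ P fun y => g.1 y with hR
  have hRm : ∀ g, Measurable (R g) := fun g => measurable_vertical hψ hPm g.2
  have hRb' : ∀ g x, ‖R g x‖ ≤ a * ‖g.1 x.fst‖ := fun g x => norm_vertical_le hψ hK hPC _ x
  have hRb : ∀ g x, ‖R g x‖ ≤ a * ‖g‖ := fun g x => (hRb' g x).trans (by
    gcongr
    exact norm_boundedMeasurable_apply_le g _)
  have hRsub : ∀ g g' x, R (g - g') x = R g x - R g' x := fun g g' x =>
    vertical_sub (ψ := ψ) (P := P) (fun y => g.1 y) (fun y => g'.1 y) x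
  have hRi : ∀ g, Integrable (fun x => fderiv ℝ u x (R g x)) m := fun g =>
    integrable_fderiv_apply hu hui (hRm g) (hRb g)
  -- `c g` is the side effect on the first constraint of solving the conditional constraint by `R
  -- g`.
  set c : 𝓑 → EuclideanSpace ℝ (Fin k) := fun g => ∫ x, fderiv ℝ u x (R g x) ∂m with hc
  have hcsub : ∀ g g', c (g - g') = c g - c g' := by
    intro g g'
    simp only [hc, hRsub, map_sub]
    exact integral_sub (hRi g) (hRi g')
  set A₁ : ℝ := ∫ x, ‖fderiv ℝ u x‖ ∂m with hA₁
  have hA₁0 : 0 ≤ A₁ := integral_nonneg fun _ => norm_nonneg _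
  have hcb : ∀ g, ‖c g‖ ≤ A₁ * (a * ‖g‖) := by
    intro g
    rw [hA₁, ← integral_mul_const]
    refine norm_integral_le_of_norm_le (hui.norm.mul_const _) (.of_forall fun x => ?_)
    exact (ContinuousLinearMap.le_opNorm _ _).trans (by gcongr; exact hRb g x)
  -- `R` produces the second component, and the fields `W j`, invisible to the conditional
  -- constraint, adjust the first component by what `R` has left over.
  set T : EuclideanSpace ℝ (Fin k) × 𝓑 → X d → X d :=
    fun z x => tmulV (fun j => W j x) (z.1 - c z.2) + R z.2 x with hT
  have hcoef : ∀ z : EuclideanSpace ℝ (Fin k) × 𝓑, ‖z.1 - c z.2‖ ≤ (1 + A₁ * a) * ‖z‖ := by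
    intro z
    refine (norm_sub_le _ _).trans ?_
    have h1 := norm_fst_le z
    have h2 : A₁ * (a * ‖z.2‖) ≤ A₁ * (a * ‖z‖) := by gcongr; exact norm_snd_le z
    linarith [hcb z.2]
  refine ⟨G, T, k * b * (1 + A₁ * a) + a, k * (∑ j, L j) * (1 + A₁ * a),
    (ENNReal.ofReal (k * b) + ENNReal.ofReal (k * b) *
      (eLpNorm (fderiv ℝ u) (ENNReal.ofReal (conj p)) m * ENNReal.ofReal a) +
      ENNReal.ofReal a).toNNReal, hG, hGae, by positivity, by positivity, ?_, ?_, ?_, ?_, ?_, ?_,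
      ?_⟩
  · intro z
    refine Measurable.add (Finset.measurable_fun_sum _ fun j _ => ?_) (hRm z.2)
    exact (hWm j).const_smul ((z.1 - c z.2) j)
  · intro z z' x
    simp only [hT, Prod.fst_sub, Prod.snd_sub, hcsub, hRsub]
    rw [show z.1 - z'.1 - (c z.2 - c z'.2) = (z.1 - c z.2) - (z'.1 - c z'.2) by abel, tmulV_sub]
    abel
  · intro z x
    refine (norm_add_le _ _).trans ?_
    rw [add_mul, mul_assoc (k * b : ℝ)]
    refine add_le_add ((norm_tmulV_le (fun j => hWb j x) _).trans ?_) ((hRb _ _).trans ?_)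
    · gcongr
      exact hcoef z
    · gcongr
      exact norm_snd_le z
  · intro z
    have hi : ∀ j, Integrable (fun x => (z.1 - c z.2) j • fderiv ℝ u x (W j x)) m := fun j =>
      (hWi j).smul ((z.1 - c z.2) j)
    simp only [hT, map_add, tmulV, map_sum, map_smul]
    rw [integral_add (integrable_finsetSum _ fun j _ => hi j) (hRi z.2),
      integral_finsetSum _ fun j _ => hi j]
    simp only [integral_smul, hW, hVe]
    rw [sum_smul_single_one, sub_add_cancel]
  · intro z y hy
    have hi : ∀ j, Integrable (fun s => (z.1 - c z.2) j • fderiv ℝ ψ (WithLp.toLp 2 (y, s))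
        (W j (WithLp.toLp 2 (y, s)))) (condLaw m y) := fun j =>
      (integrable_slice (stronglyMeasurable_fderiv_apply hψ (hWm j))
        (norm_fderiv_apply_le hK (hWb j)) y).smul ((z.1 - c z.2) j)
    have hi' : Integrable (fun s => fderiv ℝ ψ (WithLp.toLp 2 (y, s))
        (R z.2 (WithLp.toLp 2 (y, s)))) (condLaw m y) :=
      integrable_slice (stronglyMeasurable_fderiv_apply hψ (hRm z.2))
        (norm_fderiv_apply_le hK (hRb z.2)) y
    have h0 : ∀ j, ∫ s, fderiv ℝ ψ (WithLp.toLp 2 (y, s)) (W j (WithLp.toLp 2 (y, s)))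
        ∂condLaw m y = 0 := fun j =>
      kerE_fderiv_corrected hψ hK hC hPC hPm (hP y hy) (hV j).measurable (hB j)
    have h1 : ∫ s, fderiv ℝ ψ (WithLp.toLp 2 (y, s)) (R z.2 (WithLp.toLp 2 (y, s)))
        ∂condLaw m y = z.2.1 y := kerE_fderiv_vertical hψ (hP y hy) fun y => z.2.1 y
    simp only [kerE, hT, map_add, tmulV, map_sum, map_smul]
    rw [integral_add (integrable_finsetSum _ fun j _ => hi j) hi',
      integral_finsetSum _ fun j _ => hi j]
    simp only [integral_smul, h0, h1, smul_zero, Finset.sum_const_zero, zero_add]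
  · intro z
    -- Vertical parts do not touch the first coordinate, so it inherits the regularity of the test
    -- fields although `T z` is merely measurable.
    refine ⟨fun y => tmulV (fun j => V₁ j y) (z.1 - c z.2), fun x => ?_, fun y y' => ?_⟩
    · simp only [hT, WithLp.add_fst, tmulV_fst, hR, vertical_fst, add_zero, hW, corrected,
        WithLp.sub_fst, sub_zero, hVV]
      rfl
    · have e : tmulV (fun j => V₁ j y) (z.1 - c z.2) - tmulV (fun j => V₁ j y') (z.1 - c z.2) =
          tmulV (fun j => V₁ j y - V₁ j y') (z.1 - c z.2) := by
        simp [tmulV, smul_sub, Finset.sum_sub_distrib]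
      rw [e]
      refine (norm_tmulV_le (K := (∑ j, L j : ℝ≥0) * ‖y - y'‖) (fun j => ?_) _).trans ?_
      · refine (hL j y y').trans ?_
        gcongr
        exact Finset.single_le_sum (fun j _ => zero_le) (Finset.mem_univ j)
      · calc _ ≤ k * ((∑ j, L j : ℝ≥0) * ‖y - y'‖) * ((1 + A₁ * a) * ‖z‖) := by
              gcongr
              exact hcoef z
          _ = _ := by push_cast; ring
  · intro z
    set N := eLpNorm (fun x : X d => z.2.1 x.fst) (ENNReal.ofReal p) m with hN
    have h1p : 1 ≤ ENNReal.ofReal p := by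
      rw [← ENNReal.ofReal_one]
      exact ENNReal.ofReal_le_ofReal hp.le
    have hRN : eLpNorm (R z.2) (ENNReal.ofReal p) m ≤ ENNReal.ofReal a * N :=
      eLpNorm_le_mul_eLpNorm_of_ae_le_mul (.of_forall (hRb' z.2)) _
    -- Hölder's inequality controls `c` by the `L^p` norm, as the final estimate demands, instead of
    -- the supremum norm.
    have hcN : ‖c z.2‖ₑ ≤ eLpNorm (fderiv ℝ u) (ENNReal.ofReal (conj p)) m *
        (ENNReal.ofReal a * N) :=
      (enorm_integral_fderiv_le hp hu (hRm z.2)).trans (by gcongr)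
    have hfin : ENNReal.ofReal (k * b) + ENNReal.ofReal (k * b) *
      (eLpNorm (fderiv ℝ u) (ENNReal.ofReal (conj p)) m * ENNReal.ofReal a) +
      ENNReal.ofReal a ≠ ∞ := by
      have := huq.2.ne
      finiteness
    rw [ENNReal.coe_toNNReal hfin]
    have hm1 : Measurable fun x => tmulV (fun j => W j x) (z.1 - c z.2) :=
      Finset.measurable_fun_sum _ fun j _ => (hWm j).const_smul ((z.1 - c z.2) j)
    refine (eLpNorm_add_le hm1.aestronglyMeasurable (hRm z.2).aestronglyMeasurable h1p).trans ?_
    have hfirst : eLpNorm (fun x => tmulV (fun j => W j x) (z.1 - c z.2)) (ENNReal.ofReal p) m ≤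
        ENNReal.ofReal (k * b) * (‖z.1‖ₑ + ‖c z.2‖ₑ) := by
      refine (eLpNorm_le_of_ae_bound
        (.of_forall fun x => norm_tmulV_le (fun j => hWb j x) _)).trans ?_
      rw [measure_univ, ENNReal.one_rpow, one_mul, ENNReal.ofReal_mul (by positivity), ofReal_norm]
      gcongr
      exact enorm_sub_le
    calc _ ≤ ENNReal.ofReal (k * b) * (‖z.1‖ₑ +
          eLpNorm (fderiv ℝ u) (ENNReal.ofReal (conj p)) m * (ENNReal.ofReal a * N)) +
          ENNReal.ofReal a * N := by
          refine add_le_add (hfirst.trans ?_) hRN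
          gcongr
      _ = ENNReal.ofReal (k * b) * ‖z.1‖ₑ + (ENNReal.ofReal (k * b) *
          (eLpNorm (fderiv ℝ u) (ENNReal.ofReal (conj p)) m * ENNReal.ofReal a) +
          ENNReal.ofReal a) * N := by ring
      _ ≤ _ := by
          rw [mul_add]
          gcongr
          · rw [add_assoc]
            exact le_self_add
          · exact le_add_self

end AdaptedCorrection

/-! ### The nonlinear conditional constraint and the adapted case. -/

section AdaptedBound

variable {d k l : ℕ} {p : ℝ} {ψ : X d → EuclideanSpace ℝ (Fin l)} {K : ℝ}

theorem norm_sub_le_of_fderiv_le (hψ : ContDiff ℝ 1 ψ) (hK : ∀ x, ‖fderiv ℝ ψ x‖ ≤ K)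
    (x y : X d) : ‖ψ y - ψ x‖ ≤ K * ‖y - x‖ :=
  convex_univ.norm_image_sub_le_of_norm_fderiv_le (𝕜 := ℝ)
    (fun z _ => hψ.differentiable (by simp) z) (fun z _ => hK z) (Set.mem_univ x) (Set.mem_univ y)

/-- The bound on the second derivative lets `∂_x ψ` vary by at most `Kρ` on the ball of radius `ρ`.
-/
theorem norm_sub_sub_fderiv_le (hψ : ContDiff ℝ 2 ψ) (hK : ∀ x, ‖fderiv ℝ (fderiv ℝ ψ) x‖ ≤ K)
    {ρ : ℝ} (x : X d) {u v : X d} (hu : ‖u‖ ≤ ρ) (hv : ‖v‖ ≤ ρ) :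
    ‖ψ (x + u) - ψ (x + v) - fderiv ℝ ψ x (u - v)‖ ≤ K * ρ * ‖u - v‖ := by
  have hK0 : 0 ≤ K := (norm_nonneg (fderiv ℝ (fderiv ℝ ψ) 0)).trans (hK 0)
  have hd : Differentiable ℝ (fderiv ℝ ψ) :=
    (hψ.fderiv_right (m := 1) (by norm_num)).differentiable (by simp)
  have h := (convex_closedBall x ρ).norm_image_sub_le_of_norm_fderiv_le' (𝕜 := ℝ) (f := ψ)
    (φ := fderiv ℝ ψ x) (C := K * ρ) (x := x + v) (y := x + u)
    (fun z _ => hψ.differentiable (by simp) z) (fun z hz => ?_) (by simpa using hv)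
    (by simpa using hu)
  · simpa using h
  · refine (convex_univ.norm_image_sub_le_of_norm_fderiv_le (𝕜 := ℝ) (fun z _ => hd z)
      (fun z _ => hK z) (Set.mem_univ x) (Set.mem_univ z)).trans ?_
    gcongr
    exact mem_closedBall_iff_norm.1 hz

/-- The difference quotient of `ψ` along the field `U`. -/
noncomputable def diffQuot (ψ : X d → EuclideanSpace ℝ (Fin l)) (r : ℝ) (U : X d → X d) (x : X d) :
    EuclideanSpace ℝ (Fin l) :=
  r⁻¹ • (ψ (x + r • U x) - ψ x)

theorem stronglyMeasurable_diffQuot (hψ : ContDiff ℝ 1 ψ) (r : ℝ) {U : X d → X d}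
    (hU : Measurable U) : StronglyMeasurable (diffQuot ψ r U) := by
  have := hψ.continuous.measurable
  exact Measurable.stronglyMeasurable (by unfold diffQuot; fun_prop)

theorem norm_diffQuot_le (hψ : ContDiff ℝ 1 ψ) (hK : ∀ x, ‖fderiv ℝ ψ x‖ ≤ K) (r : ℝ)
    {U : X d → X d} {R : ℝ} (hU : ∀ x, ‖U x‖ ≤ R) (x : X d) : ‖diffQuot ψ r U x‖ ≤ K * R := by
  have hK0 : 0 ≤ K := (norm_nonneg _).trans (hK 0)
  have hR0 : 0 ≤ R := (norm_nonneg _).trans (hU 0)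
  rcases eq_or_ne r 0 with rfl | hr
  · simp only [diffQuot, inv_zero, zero_smul, norm_zero]
    positivity
  rw [diffQuot, norm_smul, norm_inv, inv_mul_le_iff₀ (by positivity)]
  refine (norm_sub_le_of_fderiv_le hψ hK _ _).trans ?_
  rw [add_sub_cancel_left, norm_smul, mul_left_comm]
  gcongr
  exact hU x

theorem norm_diffQuot_sub_le (hψ : ContDiff ℝ 2 ψ) (hK : ∀ x, ‖fderiv ℝ (fderiv ℝ ψ) x‖ ≤ K)
    {r : ℝ} (hr : 0 < r) {U V : X d → X d} {R : ℝ} (hU : ∀ x, ‖U x‖ ≤ R) (hV : ∀ x, ‖V x‖ ≤ R)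
    (x : X d) :
    ‖diffQuot ψ r U x - diffQuot ψ r V x - fderiv ℝ ψ x (U x - V x)‖ ≤
      K * (r * R) * ‖U x - V x‖ := by
  have e : diffQuot ψ r U x - diffQuot ψ r V x - fderiv ℝ ψ x (U x - V x) =
      r⁻¹ • (ψ (x + r • U x) - ψ (x + r • V x) - fderiv ℝ ψ x (r • U x - r • V x)) := by
    rw [← smul_sub r, map_smul, smul_sub r⁻¹ _ (r • _), inv_smul_smul₀ hr.ne', diffQuot, diffQuot,
      ← smul_sub]
    simp
  have hb : ∀ {W : X d → X d}, (∀ x, ‖W x‖ ≤ R) → ‖r • W x‖ ≤ r * R := by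
    intro W hW
    rw [norm_smul, Real.norm_of_nonneg hr.le]
    gcongr
    exact hW x
  rw [e, norm_smul, norm_inv, Real.norm_of_nonneg hr.le, inv_mul_le_iff₀ hr]
  refine (norm_sub_sub_fderiv_le hψ hK x (hb hU) (hb hV)).trans ?_
  rw [← smul_sub, norm_smul, Real.norm_of_nonneg hr.le]
  exact le_of_eq (by ring)

/-- Strict differentiability of the rescaled conditional constraint, uniformly in `y`, with an error
of order `r`. -/
theorem norm_kerE_diffQuot_sub_le {m : Measure (X d)} [IsProbabilityMeasure m]
    (hψ : ContDiff ℝ 2 ψ) (hK₁ : ∀ x, ‖fderiv ℝ ψ x‖ ≤ K)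
    (hK₂ : ∀ x, ‖fderiv ℝ (fderiv ℝ ψ) x‖ ≤ K) {r : ℝ} (hr : 0 < r) {U V : X d → X d}
    (hUm : Measurable U) (hVm : Measurable V) {R N : ℝ} (hU : ∀ x, ‖U x‖ ≤ R)
    (hV : ∀ x, ‖V x‖ ≤ R) (hUV : ∀ x, ‖U x - V x‖ ≤ N) (y : S d) :
    ‖kerE m (diffQuot ψ r U) y - kerE m (diffQuot ψ r V) y -
      kerE m (fun x => fderiv ℝ ψ x (U x - V x)) y‖ ≤ K * (r * R) * N := by
  have hψ1 : ContDiff ℝ 1 ψ := hψ.of_le (by norm_num)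
  have hK0 : 0 ≤ K := (norm_nonneg _).trans (hK₁ 0)
  have hR0 : 0 ≤ R := (norm_nonneg _).trans (hU 0)
  have hsU := stronglyMeasurable_diffQuot hψ1 r hUm
  have hsV := stronglyMeasurable_diffQuot hψ1 r hVm
  have hbU := norm_diffQuot_le hψ1 hK₁ r hU
  have hbV := norm_diffQuot_le hψ1 hK₁ r hV
  rw [← kerE_sub hsU hbU hsV hbV,
    ← kerE_sub (f := fun x => diffQuot ψ r U x - diffQuot ψ r V x)
      (g := fun x => fderiv ℝ ψ x (U x - V x)) (hsU.sub hsV)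
      (fun x => norm_sub_le_of_le (hbU x) (hbV x))
      (stronglyMeasurable_fderiv_apply hψ1 (hUm.sub hVm)) (norm_fderiv_apply_le hK₁ hUV)]
  refine norm_kerE_le (fun x => (norm_diffQuot_sub_le hψ hK₂ hr hU hV x).trans ?_) y
  gcongr
  exact hUV x

theorem continuous_of_norm_sub_le {f : S d → S d} {c : ℝ}
    (hf : ∀ y y', ‖f y - f y'‖ ≤ c * ‖y - y'‖) : Continuous f := by
  refine (LipschitzWith.of_dist_le_mul (K := c.toNNReal) fun y y' => ?_).continuous
  rw [dist_eq_norm, dist_eq_norm]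
  refine (hf y y').trans ?_
  gcongr
  exact Real.le_coe_toNNReal c

/-- A perturbation of the identity by a contraction is injective; being also continuous between
Polish spaces, it is a measurable embedding. -/
theorem exists_measurable_leftInverse {q : S d → S d} {c : ℝ} (hc : c < 1)
    (hq : ∀ y y', ‖q y - q y'‖ ≤ c * ‖y - y'‖) :
    ∃ g : S d → S d, Measurable g ∧ ∀ y, g (y + q y) = y := by
  have hqc : Continuous q := continuous_of_norm_sub_le hq
  have hinj : Function.Injective fun y => y + q y := by
    intro y y' h
    have h1 : y - y' = -(q y - q y') := by
      have h : y + q y = y' + q y' := h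
      rw [sub_eq_iff_eq_add, eq_comm, ← sub_eq_iff_eq_add'.2 h]
      abel
    have h2 := hq y y'
    rw [← norm_neg (q y - q y'), ← h1] at h2
    have h3 := norm_nonneg (y - y')
    have : ‖y - y'‖ = 0 := by nlinarith
    exact sub_eq_zero.1 (norm_eq_zero.1 this)
  have he : MeasurableEmbedding fun y => y + q y :=
    (continuous_id.add hqc).measurableEmbedding hinj
  obtain ⟨g, hg, hge⟩ := he.exists_measurable_extend measurable_id fun _ => ⟨0⟩
  exact ⟨g, hg, congrFun hge⟩

/-- Two small adapted perturbations of the same law, coupled through that law, are bi-causally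
coupled. -/
theorem transportDist_adapted_shift_le (hp : 1 < p) (μ : Measure (X d)) [IsFiniteMeasure μ]
    {Θ W : X d → X d} (hΘ : Measurable Θ) (hW : Measurable W) {θ τ : S d → S d}
    (hθ : ∀ x, (Θ x).fst = θ x.fst) (hτ : ∀ x, (W x).fst = τ x.fst) {L L' : ℝ} (hL' : 0 ≤ L')
    (hθL : ∀ y y', ‖θ y - θ y'‖ ≤ L * ‖y - y'‖) (hτL : ∀ y y', ‖τ y - τ y'‖ ≤ L' * ‖y - y'‖)
    {r : ℝ} (hr : 0 ≤ r) (hrL : r * (L + L') < 1) :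
    transportDist .adapted p (shift μ fun x => r • Θ x) (shift μ fun x => r • (Θ x + W x)) ≤
      ENNReal.ofReal r * eLpNorm W (ENNReal.ofReal p) μ := by
  have hsc : ∀ {f : S d → S d} {c : ℝ}, (∀ y y', ‖f y - f y'‖ ≤ c * ‖y - y'‖) →
      ∀ y y', ‖r • f y - r • f y'‖ ≤ r * c * ‖y - y'‖ := by
    intro f c hf y y'
    rw [← smul_sub, norm_smul, Real.norm_of_nonneg hr, mul_assoc]
    gcongr
    exact hf y y'
  have hsum : ∀ y y', ‖(θ y + τ y) - (θ y' + τ y')‖ ≤ (L + L') * ‖y - y'‖ := by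
    intro y y'
    rw [add_sub_add_comm, add_mul]
    exact norm_add_le_of_le (hθL y y') (hτL y y')
  have hrL1 : r * L < 1 := by nlinarith [mul_nonneg hr hL']
  obtain ⟨g, hg, hgl⟩ := exists_measurable_leftInverse hrL1 (hsc hθL)
  obtain ⟨g', hg', hgl'⟩ := exists_measurable_leftInverse hrL (hsc hsum)
  have hθm := (continuous_of_norm_sub_le hθL).measurable
  have hτm := (continuous_of_norm_sub_le hτL).measurable
  rw [← lintegral_shift_sub_rpow hp μ Θ W hr]
  -- Each map recovers `x₁` from one shifted first coordinate and then applies the other shift.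
  refine transportDist_adapted_map_le (q := fun y => g y + r • (θ (g y) + τ (g y)))
    (q' := fun y => g' y + r • θ (g' y)) μ (by fun_prop) (by fun_prop) (by fun_prop) (by fun_prop)
    (fun x => ?_) (fun x => ?_)
  · simp [hθ, hτ, hgl]
  · have := hgl' x.fst
    simp only [WithLp.add_fst, WithLp.smul_fst, hθ, hτ, this]

theorem Pp.integrable_of_fderiv_le (hp : 1 < p) (μ : Pp d p) (hψ : ContDiff ℝ 1 ψ)
    (hK : ∀ x, ‖fderiv ℝ ψ x‖ ≤ K) : Integrable ψ μ.1 := by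
  have := μ.2.1
  have h1 : Integrable (fun x => x) μ.1 := (μ.memLp_id hp).integrable (by
    rw [← ENNReal.ofReal_one]
    exact ENNReal.ofReal_le_ofReal hp.le)
  refine ((integrable_const ‖ψ 0‖).add (h1.norm.const_mul K)).mono'
    hψ.continuous.aestronglyMeasurable (.of_forall fun x => ?_)
  have := norm_sub_le_of_fderiv_le hψ hK 0 x
  have h2 := norm_add_le (ψ 0) (ψ x - ψ 0)
  simp only [add_sub_cancel, sub_zero] at this h2
  simp only [Pi.add_apply]
  linarith

/-- After the shift, `h` is evaluated at `x₁ + rθ(x₁)`, still a function of `x₁`. The constraint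
thus follows once `ψ(X + rU)` has conditional mean zero, and this splits into the assumption on `ψ`
and the difference quotient. -/
theorem push_mem_perp_calE (hp : 1 < p) (μ : Pp d p) [IsProbabilityMeasure μ.1]
    (hψ : ContDiff ℝ 1 ψ)
    (hK : ∀ x, ‖fderiv ℝ ψ x‖ ≤ K) (hψ0 : condE1 μ.1 ψ =ᵐ[μ.1] 0) {G : Set (S d)}
    (hG : ∀ᵐ x ∂μ.1, x.fst ∈ G) {r : ℝ} (hr : r ≠ 0) {U : X d → X d} (hU : Measurable U) {R : ℝ}
    (hR : ∀ x, ‖U x‖ ≤ R) {θ : S d → S d} (hθ : Measurable θ) (hUθ : ∀ x, (U x).fst = θ x.fst)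
    (h : ∀ y ∈ G, kerE μ.1 (diffQuot ψ r U) y = 0) :
    (push μ fun x => r • U x) ∈ perp p (calE ψ) := by
  rintro f ⟨g, ⟨hg, B, hB⟩, rfl⟩
  have hψi := μ.integrable_of_fderiv_le hp hψ hK
  have hψc := hψ.continuous.measurable
  have hgc := hg.continuous.measurable
  rw [push_val hp μ (K := ‖r‖ * R) (by fun_prop) (fun x => by
    rw [norm_smul]
    gcongr
    exact hR x), shift, integral_map (by fun_prop)
    (Measurable.aestronglyMeasurable (by fun_prop))]
  set a : S d → EuclideanSpace ℝ (Fin l) := fun y => g (y + r • θ y) with ha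
  have ham : Measurable a := by fun_prop
  have hDi : Integrable (diffQuot ψ r U) μ.1 :=
    Integrable.of_bound (stronglyMeasurable_diffQuot hψ r hU).aestronglyMeasurable _
      (.of_forall (norm_diffQuot_le hψ hK r hR))
  have hai : ∀ {f : X d → EuclideanSpace ℝ (Fin l)}, Integrable f μ.1 →
      Integrable (fun x => inner ℝ (a x.fst) (f x)) μ.1 := by
    intro f hf
    refine (hf.norm.const_mul B).mono' (AEStronglyMeasurable.inner
      (Measurable.aestronglyMeasurable (by fun_prop)) hf.1) (.of_forall fun x => ?_)
    refine (norm_inner_le_norm _ _).trans ?_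
    gcongr
    exact (hB _).1
  have e : ∀ x : X d, inner ℝ (g (x + r • U x).fst) (ψ (x + r • U x)) =
      r * inner ℝ (a x.fst) (diffQuot ψ r U x) + inner ℝ (a x.fst) (ψ x) := by
    intro x
    rw [← real_inner_smul_right, ← inner_add_right, diffQuot, smul_inv_smul₀ hr, sub_add_cancel]
    simp [ha, hUθ]
  simp only [e]
  rw [integral_add ((hai hDi).const_mul r) (hai hψi), integral_const_mul,
    ← integral_inner_kerE hDi (hai hDi), ← integral_inner_kerE hψi (hai hψi),
    integral_eq_zero_of_ae, integral_eq_zero_of_ae]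
  · simp
  · filter_upwards [condE1_ae_eq hψi, hψ0] with x h1 h2
    simp [← h1, h2]
  · filter_upwards [hG] with x hx
    simp [h _ hx]

theorem adapted_bound (hp : 1 < p) {φ : Pp d p → EuclideanSpace ℝ (Fin k)}
    {D : Pp d p → X d → EuclideanSpace ℝ (Fin k)} (h : RegularFunctional φ D) (μ : Pp d p)
    (hμ : φ μ = 0) (hA : AssumptionWad p μ.1 (D μ) ψ) :
    ∃ C : ℝ≥0, 0 < C ∧ ∀ Θ : X d → X d, IsTestField .adapted Θ →
      limsup (fun r : ℝ =>
          distToSet .adapted (shift μ.1 fun x => r • Θ x) (φ ⁻¹' {0} ∩ perp p (calE ψ))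
            / ENNReal.ofReal r) (𝓝[>] 0)
        ≤ C * opNorm .adapted p μ.1 (D μ) ψ Θ := by
  classical
  have := μ.2.1
  have hψ2 := hA.psi_contDiff
  have hψ : ContDiff ℝ 1 ψ := hψ2.of_le (by norm_num)
  obtain ⟨K, hKK⟩ := hA.psi_bounded
  have hK₁ := fun x => (hKK x).1
  have hK₂ := fun x => (hKK x).2
  have hK0 : 0 ≤ K := (norm_nonneg _).trans (hK₁ 0)
  have hu := h.contDiff μ
  have huq := h.memLp_fderiv hp μ
  have hui : Integrable (fderiv ℝ (D μ)) μ.1 := huq.integrable (one_le_ofReal_conj hp)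
  have hψi : Integrable (fderiv ℝ ψ) μ.1 :=
    Integrable.of_bound (hψ.continuous_fderiv (by simp)).aestronglyMeasurable K (.of_forall hK₁)
  obtain ⟨G, T, B, L, C, hG, hGae, hB0, hL0, hTm, hTsub, hTB, hTint, hTker, hTτ, hTC⟩ :=
    exists_adapted_correction hp hu huq hψ hK₁ hA
  refine ⟨C + 1, by positivity, fun Θ hΘ => ?_⟩
  have hΘm := hΘ.measurable
  obtain ⟨A, hAΘ⟩ := hΘ.exists_bound
  have hA0 : 0 ≤ A := (norm_nonneg _).trans (hAΘ 0)
  obtain ⟨Θ₁, Θ₂, hΘ₁, hΘ₁c, hΘ₂, hΘ₂c, hΘe⟩ := hΘ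
  obtain ⟨A₁, hA₁⟩ := hΘ₁c.exists_bound_of_continuous hΘ₁.continuous
  obtain ⟨A₂, hA₂⟩ := hΘ₂c.exists_bound_of_continuous hΘ₂.continuous
  obtain ⟨L₀, hL₀⟩ := lipschitz_bound_of_contDiff hΘ₁ hΘ₁c
  have hop1 : opL1 .adapted μ.1 (D μ) Θ = ∫ x, fderiv ℝ (D μ) x (Θ x) ∂μ.1 :=
    integral_mulV_grad_adapted hu hui hΘe hΘ₁.continuous.measurable hΘ₂.continuous.measurable
      (fun y => (hA₁ y).trans (le_max_left A₁ A₂)) (fun x => (hA₂ x).trans (le_max_right A₁ A₂))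
  have hop2 : opL2 .adapted μ.1 ψ Θ =ᵐ[μ.1]
      fun x => kerE μ.1 (fun x => fderiv ℝ ψ x (Θ x)) x.fst :=
    condE1_mulV_grad_adapted hψ hψi hΘe hΘ₁.continuous.measurable hΘ₂.continuous.measurable
      (fun y => (hA₁ y).trans (le_max_left A₁ A₂)) (fun x => (hA₂ x).trans (le_max_right A₁ A₂))
  have hkm : Measurable (kerE μ.1 fun x => fderiv ℝ ψ x (Θ x)) :=
    (stronglyMeasurable_kerE (stronglyMeasurable_fderiv_apply hψ hΘm)).measurable
  have hkb : ∀ y, ‖kerE μ.1 (fun x => fderiv ℝ ψ x (Θ x)) y‖ ≤ K * A :=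
    norm_kerE_le (norm_fderiv_apply_le hK₁ hAΘ)
  -- The second component of `z₀`: minus the linearised conditional constraint at `Θ`, cut off
  -- outside the good set.
  obtain ⟨g₀, hg₀⟩ := exists_boundedMeasurable (hkm.neg.indicator hG) (K := K * A) (fun y => by
    refine (norm_indicator_le_norm_self _ _).trans ?_
    simpa using hkb y)
  set z₀ : EuclideanSpace ℝ (Fin k) × boundedMeasurable (S d) (EuclideanSpace ℝ (Fin l)) :=
    (-opL1 .adapted μ.1 (D μ) Θ, g₀) with hz₀
  have hUm : ∀ z, Measurable fun x => Θ x + T z x := fun z => hΘm.add (hTm z)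
  have hUb : ∀ z x, ‖Θ x + T z x‖ ≤ A + B * ‖z‖ := fun z x =>
    norm_add_le_of_le (hAΘ x) (hTB z x)
  -- Off the null complement of the good set `F` is the conditional constraint. On that complement,
  -- where no right inverse is available, it is set to the component `z.2`, so that it differs there
  -- from the identity by nothing.
  have hFex : ∀ (r : ℝ) (z : EuclideanSpace ℝ (Fin k) ×
      boundedMeasurable (S d) (EuclideanSpace ℝ (Fin l))),
      ∃ g : boundedMeasurable (S d) (EuclideanSpace ℝ (Fin l)), ∀ y, g.1 y =
        if y ∈ G then kerE μ.1 (diffQuot ψ r fun x => Θ x + T z x) y else z.2.1 y := by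
    intro r z
    refine exists_boundedMeasurable (K := K * (A + B * ‖z‖) + ‖z.2‖) (Measurable.ite hG
      (stronglyMeasurable_kerE (stronglyMeasurable_diffQuot hψ r (hUm z))).measurable z.2.2)
      fun y => ?_
    split_ifs
    · exact (norm_kerE_le (norm_diffQuot_le hψ hK₁ r (hUb z)) y).trans
        (le_add_of_nonneg_right (norm_nonneg _))
    · exact (norm_boundedMeasurable_apply_le z.2 y).trans (le_add_of_nonneg_left (by positivity))
  choose F hF using hFex
  set R : ℝ := A + B * (‖z₀‖ + 1) with hR
  have hR0 : 0 ≤ R := by positivity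
  have hnorm : ∀ z ∈ Metric.closedBall z₀ 1, ‖z‖ ≤ ‖z₀‖ + 1 := fun z hz =>
    norm_le_norm_add_const_of_dist_le hz
  have hUR : ∀ z ∈ Metric.closedBall z₀ 1, ∀ x, ‖Θ x + T z x‖ ≤ R := by
    intro z hz x
    refine (hUb z x).trans ?_
    rw [hR]
    gcongr
    exact hnorm z hz
  have hsmall : ∀ c : ℝ, ∀ ε > (0 : ℝ), ∀ᶠ r in 𝓝[>] (0 : ℝ), r * c < ε := by
    intro c ε hε
    have ht : Tendsto (fun r : ℝ => r * c) (𝓝[>] 0) (𝓝 0) := by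
      have : Tendsto (fun r : ℝ => r * c) (𝓝 0) (𝓝 (0 * c)) := tendsto_id.mul_const c
      rw [zero_mul] at this
      exact this.mono_left nhdsWithin_le_nhds
    exact ht.eventually (gt_mem_nhds hε)
  -- By the choice of `z₀`, the field `Θ + T z₀` satisfies the linearised conditional constraint.
  have hker0 : ∀ y ∈ G, kerE μ.1 (fun x => fderiv ℝ ψ x (Θ x + T z₀ x)) y = 0 := by
    intro y hy
    simp only [map_add]
    rw [kerE_add (stronglyMeasurable_fderiv_apply hψ hΘm) (norm_fderiv_apply_le hK₁ hAΘ)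
      (stronglyMeasurable_fderiv_apply hψ (hTm z₀)) (norm_fderiv_apply_le hK₁ (hTB z₀)),
      hTker z₀ y hy, hg₀ y, Set.indicator_of_mem hy]
    simp
  have key := h.limsup_distToSet_le hp μ hμ .adapted (P := perp p (calE ψ)) (T := T) hTm hTsub hB0
    hTB hTint hΘm hAΘ (z₀ := z₀) (by simp [hz₀, hop1]) (F := F) ?_ ?_ ?_
  · refine key.trans ((hTC z₀).trans ?_)
    have e : eLpNorm (fun x : X d => z₀.2.1 x.fst) (ENNReal.ofReal p) μ.1 =
        eLpNorm (opL2 .adapted μ.1 ψ Θ) (ENNReal.ofReal p) μ.1 := by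
      refine eLpNorm_congr_norm_ae ?_
      filter_upwards [hop2, hGae] with x h1 h2
      rw [h1, hg₀, Set.indicator_of_mem h2]
      simp
    rw [e, opNorm, hz₀, enorm_neg]
    push_cast
    gcongr
    exact le_self_add
  · intro ε hε
    filter_upwards [self_mem_nhdsWithin, hsmall (K * R * B) ε hε] with r hr hrε z hz z' hz'
    refine norm_boundedMeasurable_le (by positivity) fun y => ?_
    change ‖(F r z).1 y - (F r z').1 y - (z.2.1 y - z'.2.1 y)‖ ≤ ε * ‖z - z'‖
    rw [hF, hF]
    by_cases hy : y ∈ G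
    · rw [if_pos hy, if_pos hy]
      have h1 := norm_kerE_diffQuot_sub_le (m := μ.1) hψ2 hK₁ hK₂ hr (hUm z) (hUm z') (hUR z hz)
        (hUR z' hz') (N := B * ‖z - z'‖) (fun x => by
          rw [add_sub_add_left_eq_sub, ← hTsub]
          exact hTB _ x) y
      simp only [add_sub_add_left_eq_sub, ← hTsub] at h1
      rw [hTker _ y hy] at h1
      refine h1.trans ?_
      calc K * (r * R) * (B * ‖z - z'‖) = r * (K * R * B) * ‖z - z'‖ := by ring
        _ ≤ _ := by gcongr
    · rw [if_neg hy, if_neg hy, sub_self, norm_zero]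
      positivity
  · rw [Metric.tendsto_nhds]
    intro ε hε
    filter_upwards [self_mem_nhdsWithin, hsmall (K * R * R) (ε / 2) (half_pos hε)] with r hr hrε
    rw [dist_zero_right]
    refine lt_of_le_of_lt (norm_boundedMeasurable_le (half_pos hε).le fun y => ?_)
      (half_lt_self hε)
    rw [hF]
    by_cases hy : y ∈ G
    · rw [if_pos hy]
      have hz := hUR z₀ (Metric.mem_closedBall_self zero_le_one)
      -- Comparison with the zero field, whose difference quotient vanishes.
      have h1 := norm_kerE_diffQuot_sub_le (m := μ.1) hψ2 hK₁ hK₂ hr (hUm z₀)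
        (measurable_const (a := (0 : X d))) hz (fun x => by simpa using hR0)
        (fun x => by simpa using hz x) y
      have h2 : kerE μ.1 (diffQuot ψ r fun _ => (0 : X d)) y = 0 := by
        simp [kerE, diffQuot]
      simp only [sub_zero, h2, hker0 y hy] at h1
      refine h1.trans ?_
      linarith [show K * (r * R) * R = r * (K * R * R) by ring]
    · rw [if_neg hy, hg₀, Set.indicator_of_notMem hy, norm_zero]
      exact (half_pos hε).le
  -- The constant bounds the Lipschitz constants of the first components of `Θ + T z` over the unit
  -- ball around `z₀`; multiplied by `r` it must be less than `1` for the shifts of `x₁` to be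
  -- injective.
  · filter_upwards [self_mem_nhdsWithin, hsmall (L₀ + L * (‖z₀‖ + 1)) 1 one_pos] with r hr hrL z hz
      hFz
    obtain ⟨τ, hτ, hτL⟩ := hTτ z
    have hΘ1 : ∀ x, (Θ x).fst = Θ₁ x.fst := fun x => congrArg WithLp.fst (hΘe x)
    have hτL' : ∀ y y', ‖τ y - τ y'‖ ≤ L * (‖z₀‖ + 1) * ‖y - y'‖ := by
      intro y y'
      refine (hτL y y').trans ?_
      gcongr
      exact hnorm z hz
    refine ⟨?_, transportDist_adapted_shift_le hp μ.1 hΘm (hTm z) hΘ1 hτ (by positivity) hL₀ hτL'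
      (le_of_lt hr) hrL⟩
    refine push_mem_perp_calE (θ := fun y => Θ₁ y + τ y) hp μ hψ hK₁ hA.psi_cond hGae
      (ne_of_gt hr) (hUm z) (hUb z) (hΘ₁.continuous.measurable.add
        (continuous_of_norm_sub_le hτL').measurable) (fun x => ?_) fun y hy => ?_
    · rw [WithLp.add_fst, hΘ1, hτ]
    · have h1 := hF r z y
      rw [if_pos hy, hFz] at h1
      exact h1.symm

end AdaptedBound

end ConstrainedDRO

theorem mainTheorem5 {d k l : ℕ} (hd : 1 ≤ d) (kd : Kind) (p : ℝ) (hp : 1 < p)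
    (μ : Pp d p)
    (φ : Pp d p → EuclideanSpace ℝ (Fin k))
    (δφ : Pp d p → X d → EuclideanSpace ℝ (Fin k))
    (ψ : X d → EuclideanSpace ℝ (Fin l))
    (hφ : RegularFunctional φ δφ) (hφμ : φ μ = 0)
    (hA : AssumptionA kd p μ.1 (δφ μ) ψ) :
    ∃ C : ℝ≥0, 0 < C ∧ ∀ Θ : X d → X d, IsTestField kd Θ →
      limsup (fun r : ℝ =>
          distToSet kd (shift μ.1 fun x => r • Θ x) (φ ⁻¹' {0} ∩ perp p (calE ψ))
            / ENNReal.ofReal r) (𝓝[>] 0)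
        ≤ C * opNorm kd p μ.1 (δφ μ) ψ Θ := by
  cases kd with
  | classical => exact classical_bound hp hφ μ hφμ hA
  | adapted => exact adapted_bound hp hφ μ hφμ hA
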